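/- Let $M\ge 2$ and $N\ge 1$. Let $U$ be an open neighbourhood of $0$ in $\mathbb{C}^M$ and let $\omega=(\omega_1,\dots,\omega_N)$ be an $N$-tuple of holomorphic $1$-forms on $U$. Let $\mathcal{D}$ be the distribution on $U\times\mathbb{C}^N$, with coordinates $(x,z)$, defined by $dz_j=\omega_j$, $j=1,\dots,N$. Write $d\omega=\sum c_K^{ij}x^K\,dx_i\wedge dx_j$ near $0$, where $c_K^{ij}\in\mathbb{C}^N$, $K\in(\mathbb{Z}_{\ge0})^M$, $1\le i<j\le M$. Let $W_{\mathcal{D}}\subseteq\mathbb{C}^N$ be the span of all $c_K^{ij}$ and $\kappa=\operatorname{codim}W_{\mathcal{D}}$. A first integral $H_{\mathcal{D}}(x,z)=T(z)-g(x)$ on $V\times\mathbb{C}^N$ is obtained from a linear surjection $T:\mathbb{C}^N\to\mathbb{C}^\kappa$ with $\ker T=W_{\mathcal{D}}$ and a holomorphic map $g:V\to\mathbb{C}^\kappa$ on an open neighbourhood $V\subseteq U$ of $0$ with $g(0)=0$ and $dg=T\circ\omega$; such data exist. The leaves of a holomorphic vector field on an open set $\Omega$ are its complex orbits in $\Omega$.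 For $d\ge 0$ let $j^d(d\omega)$ be the family of the coefficients $c_K^{ij}$ with $|K|\le d$; for all sufficiently large $d$ these coefficients span $W_{\mathcal{D}}$. Then, for fixed $M$ and $N$, one can assign to each $d\ge 0$ and each jet $J$ of order $d$ a polynomial vector field $X_{d,J}=\sum_{i=1}^M A_i\,\partial/\partial x_i$ on $\mathbb{C}^M$ such that the following holds for every $U$ and $\omega$ as above and every $d$ for which the coefficients in $J=j^d(d\omega)$ span $W_{\mathcal{D}}$. Put $X=X_{d,J}$ and let $$Z(x,z)=\sum_{i=1}^M A_i(x)\frac{\partial}{\partial x_i}+\sum_{j=1}^N\big[\omega_j(x)\cdot X(x)\big]\frac{\partial}{\partial z_j}$$ be the lift of $X$ to $\mathcal{D}$. It is a holomorphic vector field on $U\times\mathbb{C}^N$, tangent to $\mathcal{D}$ and depending only on $x$. There is a hypersurface $S\subset\mathbb{C}^M$, a finite nonempty union of hyperplanes through $0$, such that: 1. $S$ is invariant by $X$, and every orbit of $X$ through a point of $\mathbb{C}^M\setminus S$ is dense in $\mathbb{C}^M$. 2. For each $H_{\mathcal{D}}$ as above and each neighbourhood $\Delta\subseteq V\times\mathbb{C}^N$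 of the origin there is a nonempty open set $\Delta^*\subseteq\Delta$ such that each leaf $L$ of $Z|_{\Delta^*}$ is contained and dense in the level of $H_{\mathcal{D}}|_{\Delta^*}$ containing $L$. 3. If $M=2$, then the hypersurface $\mathcal{S}=(S\times\mathbb{C}^N)\cap(U\times\mathbb{C}^N)$ is invariant by $Z$, and the set $\Delta^*$ in 2 can be chosen of the form $\mathcal{B}\setminus\mathcal{S}$ for some neighbourhood $\mathcal{B}\subseteq\Delta$ of the origin. -/

import Mathlib

open Set Filter Topology

noncomputable section

namespace SepVar

/-- The space of `N`-tuples `ω = (ω_1, …, ω_N)` of (not necessarily holomorphic) differential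
1-forms on `ℂ^M`, seen as one 1-form with values in `ℂ^N`. -/
abbrev FormTuple (M N : ℕ) : Type :=
  (Fin M → ℂ) → (Fin M → ℂ) [⋀^Fin 1]→L[ℂ] (Fin N → ℂ)

/-- The partial derivative `∂f/∂x_i`. -/
def partialD {M N : ℕ} (i : Fin M) (f : (Fin M → ℂ) → (Fin N → ℂ)) :
    (Fin M → ℂ) → (Fin N → ℂ) :=
  fun x => fderiv ℂ f x (Pi.single i 1)

/-- The mixed partial derivative `∂_1^{k_1} ⋯ ∂_M^{k_M} f`. -/
def mixedPartial {M N : ℕ} (K : Fin M → ℕ) (f : (Fin M → ℂ) → (Fin N → ℂ)) :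
    (Fin M → ℂ) → (Fin N → ℂ) :=
  (List.finRange M).foldr (fun i g => (partialD i)^[K i] g) f

/-- The coefficient of `x^K` in the Taylor series of `f` at the origin. -/
def taylorCoeff {M N : ℕ} (K : Fin M → ℕ) (f : (Fin M → ℂ) → (Fin N → ℂ)) : Fin N → ℂ :=
  ((∏ l, (K l).factorial : ℕ) : ℂ)⁻¹ • mixedPartial K f 0

/-- The coefficient `c_K^{ij} ∈ ℂ^N` of `x^K dx_i ∧ dx_j` (for `i < j`) in the series of `dω` at the
origin. -/
def dCoeff {M N : ℕ} (ω : FormTuple M N) (K : Fin M → ℕ) (i j : Fin M) : Fin N → ℂ :=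
  taylorCoeff K (fun x => extDeriv ω x ![Pi.single i 1, Pi.single j 1])

/-- The space `W_𝒟 ⊆ ℂ^N` spanned by all coefficients `c_K^{ij}`, `i < j`, of `dω`. -/
def W {M N : ℕ} (ω : FormTuple M N) : Submodule ℂ (Fin N → ℂ) :=
  Submodule.span ℂ {c | ∃ (K : Fin M → ℕ) (i j : Fin M), i < j ∧ c = dCoeff ω K i j}

/-- Families of coefficients indexed by `(K, i, j)`: the data of a jet of a `ℂ^N`-valued 2-form. -/
abbrev Jet (M N : ℕ) : Type := (Fin M → ℕ) → Fin M → Fin M → (Fin N → ℂ)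

/-- The jet of order `d` of `dω` at the origin: the coefficients `c_K^{ij}` with `i < j` and
`|K| ≤ d`, all others being replaced by `0`. -/
def jet {M N : ℕ} (d : ℕ) (ω : FormTuple M N) : Jet M N := by
  classical
  exact fun K i j => if i < j ∧ ∑ l, K l ≤ d then dCoeff ω K i j else 0

/-- The space spanned by the coefficients in a jet. -/
def jetSpan {M N : ℕ} (J : Jet M N) : Submodule ℂ (Fin N → ℂ) :=
  Submodule.span ℂ {c | ∃ (K : Fin M → ℕ) (i j : Fin M), c = J K i j}

/-- The vector field `A_1 ∂/∂x_1 + ⋯ + A_M ∂/∂x_M` on `ℂ^M` with polynomial components. -/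
def polyField {M : ℕ} (A : Fin M → MvPolynomial (Fin M) ℂ) : (Fin M → ℂ) → (Fin M → ℂ) :=
  fun x i => MvPolynomial.eval x (A i)

/-- The distribution `𝒟` given by `dz = ω`: the subspace of tangent vectors `(v, w)` at `p = (x, z)`
with `w_j = ω_j(x) · v` for all `j`. -/
def distribution {M N : ℕ} (ω : FormTuple M N) (p : (Fin M → ℂ) × (Fin N → ℂ)) :
    Submodule ℂ ((Fin M → ℂ) × (Fin N → ℂ)) where
  carrier := {u | u.2 = ω p.1 ![u.1]}
  zero_mem' := by
    have h : (![0] : Fin 1 → Fin M → ℂ) = 0 := by ext i; simp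
    simp only [mem_ofPred_eq, Prod.snd_zero, Prod.fst_zero, h]
    exact (ContinuousAlternatingMap.map_zero _).symm
  add_mem' := by
    intro a b ha hb
    simp only [mem_ofPred_eq] at ha hb
    have h := (ω p.1).map_update_add ![0] 0 a.1 b.1
    have e : ∀ v : Fin M → ℂ, Function.update (![0] : Fin 1 → Fin M → ℂ) 0 v = ![v] := by
      intro v; ext i; fin_cases i; simp
    simp only [e] at h
    simp only [mem_ofPred_eq, Prod.snd_add, Prod.fst_add, ha, hb, h]
  smul_mem' := by
    intro c a ha
    simp only [mem_ofPred_eq] at ha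
    have h := (ω p.1).map_update_smul ![0] 0 c a.1
    have e : ∀ v : Fin M → ℂ, Function.update (![0] : Fin 1 → Fin M → ℂ) 0 v = ![v] := by
      intro v; ext i; fin_cases i; simp
    simp only [e] at h
    simp only [mem_ofPred_eq, Prod.smul_snd, Prod.smul_fst, ha, h]

/-- `Z` is a holomorphic vector field on the open set `Ω` that is tangent to `𝒟`. -/
def IsLegendrian {M N : ℕ} (ω : FormTuple M N)
    (Z : (Fin M → ℂ) × (Fin N → ℂ) → (Fin M → ℂ) × (Fin N → ℂ))
    (Ω : Set ((Fin M → ℂ) × (Fin N → ℂ))) : Prop :=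
  DifferentiableOn ℂ Z Ω ∧ ∀ p ∈ Ω, Z p ∈ distribution ω p

section Leaves

variable {E : Type*} [NormedAddCommGroup E] [NormedSpace ℂ E]

/-- The leaf through `p` of the restriction to `Ω` of the one-dimensional holomorphic foliation
generated by the vector field `Z`, that is, the complex orbit of `p`: all end points of paths
`γ : [0, 1] → Ω` from `p` with `γ'(t) = θ(t) Z(γ(t))` for some continuous `θ : [0, 1] → ℂ`. It is
the single point `p` when `Z p = 0`. -/
def leaf (Z : E → E) (Ω : Set E) (p : E) : Set E :=
  {q | ∃ (γ : ℝ → E) (θ : ℝ → ℂ), γ 0 = p ∧ γ 1 = q ∧ ContinuousOn θ (Icc 0 1) ∧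
    ∀ t ∈ Icc (0 : ℝ) 1, γ t ∈ Ω ∧ HasDerivWithinAt γ (θ t • Z (γ t)) (Icc 0 1) t}

/-- The set `S` is invariant by the vector field `Z` on `Ω`. -/
def IsInvariant (Z : E → E) (Ω S : Set E) : Prop :=
  ∀ p ∈ Ω ∩ S, leaf Z Ω p ⊆ S

/-- Each leaf of `Z` restricted to `Ω` is contained and dense in the level set of `H` restricted
to `Ω` that contains it. -/
def LeavesDenseInLevels {F : Type*} (Z : E → E) (H : E → F) (Ω : Set E) : Prop :=
  ∀ p ∈ Ω, leaf Z Ω p ⊆ {q ∈ Ω | H q = H p} ∧ {q ∈ Ω | H q = H p} ⊆ closure (leaf Z Ω p)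

end Leaves

/-- `S` is a (nonempty, finite) union of hyperplanes through the origin of `ℂ^M`. -/
def IsHyperplaneUnion {M : ℕ} (S : Set (Fin M → ℂ)) : Prop :=
  ∃ s : Finset (Module.Dual ℂ (Fin M → ℂ)), s.Nonempty ∧ (∀ l ∈ s, l ≠ 0) ∧
    S = {x | ∃ l ∈ s, l x = 0}

/-- The data `(V, T, g)` from which the first integral `H_𝒟` is built: `T : ℂ^N → ℂ^κ` is linear and
onto with kernel `W_𝒟`, and `g : V → ℂ^κ` is holomorphic on the open neighbourhood `V ⊆ U` of the
origin with `g(0) = 0` and `dg = T ∘ ω`. (Then `κ` is the codimension of `W_𝒟`.) -/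
structure IsFirstIntegralData {M N κ : ℕ} (U : Set (Fin M → ℂ)) (ω : FormTuple M N)
    (V : Set (Fin M → ℂ)) (T : (Fin N → ℂ) →ₗ[ℂ] (Fin κ → ℂ))
    (g : (Fin M → ℂ) → (Fin κ → ℂ)) : Prop where
  isOpen : IsOpen V
  zero_mem : (0 : Fin M → ℂ) ∈ V
  subset : V ⊆ U
  surjective : Function.Surjective T
  ker_eq : LinearMap.ker T = W ω
  map_zero : g 0 = 0
  differentiableOn : DifferentiableOn ℂ g V
  fderiv_eq : ∀ x ∈ V, ∀ v, fderiv ℂ g x v = T (ω x ![v])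

/-- The map `H_𝒟(x, z) = T(z) - g(x)`. -/
def firstIntegral {M N κ : ℕ} (T : (Fin N → ℂ) →ₗ[ℂ] (Fin κ → ℂ))
    (g : (Fin M → ℂ) → (Fin κ → ℂ)) : (Fin M → ℂ) × (Fin N → ℂ) → (Fin κ → ℂ) :=
  fun p => T p.2 - g p.1

end SepVar

end

noncomputable section

set_option linter.unusedSectionVars false

/-! ### Leaves of a vector field and leafwise paths -/

section

namespace SepVar

/-! Put M = m + 2 and write x = `pt u y`, where u = x_last / x_0 and y holds the other coordinates.
The field is built so that off S its orbits satisfy dy_i / y_i = `rate i u` du, where `rate i` has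
simple poles at the points c_j with `blk j = i`, with residues λ_j. An orbit is therefore a lift of
a path in the u-line without the c_j, and a loop around c_j multiplies y_(blk j) by exp(2πi λ_j). In
each coordinate the residues generate a dense subgroup of ℂ, so the holonomy on the slice u = 0 is
dense in (ℂ*)^(m+1). This already gives the dense orbits of X (`IsGood.dense_leaf`).

Lifted to Z, a loop also translates z by an integral of ω. Multipliers commute, so the commutator of
two loops fixes y and only translates z, by `commShift`. Expanded at y = 0 and integrated by parts,
the part of weight k of this translation depends on a tuple of polynomials in u. If it vanishes for
all pairs of loops, the tuple is that of an exact form. This is the property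
`IsGood.exists_eq_const`: for residues tending to 0 the integrals become evaluations at the c_j,
which determine polynomials of bounded degree, and the conclusion persists for small residues. Hence
a functional that kills all commutator translations kills the coefficients of dω up to order d, and
the translations, conjugated by holonomy, span W over ℝ (`IsGood.subset_span_commShift`).

Density in a level is first proved on the slice (`exists_slice_subset_closure`). The holonomy aligns
y, a contraction moves the point close to y = 0, commutators there translate z by tiny vectors
spanning W, a walk with such steps corrects z, and the inverse contraction leads back. Each
excursion has size comparable with its starting and end points, so nothing leaves the given
neighbourhood. The first integral ensures that the correction in z lies nearly in W. The saturation
of the slice is open and inherits the density (`leavesDenseInLevels_saturation`).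

For M = 2, the conditions Re λ_j < 0 and ∑ |λ_j| < 1 make lifts shrink when u leaves a c_j or comes
in from infinity. So all points near the origin off S reach the slice (`exists_reachesSlice`), and
the saturation contains them. -/

/-- A smooth reparametrization of the unit interval, defined on the whole line, that has
speed zero at both ends. -/
def smoothStep (t : ℝ) : ℝ := (1 - Real.cos (Real.pi * t)) / 2

theorem smoothStep_zero : smoothStep 0 = 0 := by simp [smoothStep]

theorem smoothStep_one : smoothStep 1 = 1 := by simp [smoothStep]

theorem smoothStep_mem (t : ℝ) : smoothStep t ∈ Icc (0 : ℝ) 1 := by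
  have h1 := Real.cos_le_one (Real.pi * t)
  have h2 := Real.neg_one_le_cos (Real.pi * t)
  unfold smoothStep
  constructor <;> linarith

theorem hasDerivAt_smoothStep (t : ℝ) :
    HasDerivAt smoothStep (Real.pi * Real.sin (Real.pi * t) / 2) t := by
  have h1 : HasDerivAt (fun t : ℝ => Real.pi * t) Real.pi t := by
    simpa using (hasDerivAt_id t).const_mul Real.pi
  have h2 := ((h1.cos).const_sub 1).div_const 2
  refine h2.congr_deriv ?_
  ring

theorem continuous_smoothStep : Continuous smoothStep := by
  unfold smoothStep
  fun_prop

section Leaves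

variable {E : Type*} [NormedAddCommGroup E] [NormedSpace ℂ E] {Z : E → E} {Ω Ω' : Set E} {p q r : E}

theorem leaf_subset : leaf Z Ω p ⊆ Ω := by
  rintro q ⟨γ, θ, -, h1, -, h⟩
  rw [← h1]
  exact (h 1 (by simp)).1

theorem source_mem_of_mem_leaf (h : q ∈ leaf Z Ω p) : p ∈ Ω := by
  obtain ⟨γ, θ, h0, -, -, h⟩ := h
  rw [← h0]
  exact (h 0 (by simp)).1

theorem mem_leaf_self (hp : p ∈ Ω) : p ∈ leaf Z Ω p :=
  ⟨fun _ => p, fun _ => 0, rfl, rfl, continuousOn_const, fun t _ =>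
    ⟨hp, by simpa using hasDerivWithinAt_const t _ p⟩⟩

theorem leaf_mono (h : Ω ⊆ Ω') : leaf Z Ω p ⊆ leaf Z Ω' p := by
  rintro q ⟨γ, θ, h0, h1, hθ, hγ⟩
  exact ⟨γ, θ, h0, h1, hθ, fun t ht => ⟨h (hγ t ht).1, (hγ t ht).2⟩⟩

theorem leaf_congr {Z' : E → E} (h : ∀ x ∈ Ω, Z x = Z' x) : leaf Z Ω p = leaf Z' Ω p := by
  ext q
  constructor
  · rintro ⟨γ, θ, h0, h1, hθ, hγ⟩
    exact ⟨γ, θ, h0, h1, hθ, fun t ht => ⟨(hγ t ht).1, h _ (hγ t ht).1 ▸ (hγ t ht).2⟩⟩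
  · rintro ⟨γ, θ, h0, h1, hθ, hγ⟩
    exact ⟨γ, θ, h0, h1, hθ, fun t ht => ⟨(hγ t ht).1, (h _ (hγ t ht).1).symm ▸ (hγ t ht).2⟩⟩

/-- Two points of a leaf are joined by a leafwise path that is defined on the whole line and has
speed zero at both end points. -/
theorem exists_curve_of_mem_leaf (h : q ∈ leaf Z Ω p) :
    ∃ (γ : ℝ → E) (θ : ℝ → ℂ), γ 0 = p ∧ γ 1 = q ∧ Continuous θ ∧ θ 0 = 0 ∧ θ 1 = 0 ∧
      (∀ t, γ t ∈ γ '' Icc 0 1) ∧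
      ∀ t, γ t ∈ Ω ∧ HasDerivAt γ (θ t • Z (γ t)) t := by
  obtain ⟨γ, θ, h0, h1, hθ, hγ⟩ := h
  refine ⟨γ ∘ smoothStep,
    fun t => ((Real.pi * Real.sin (Real.pi * t) / 2 : ℝ) : ℂ) * θ (smoothStep t), ?_, ?_, ?_, ?_, ?_,
      ?_, ?_⟩
  · simp [smoothStep_zero, h0]
  · simp [smoothStep_one, h1]
  · exact (by fun_prop : Continuous fun t : ℝ => ((Real.pi * Real.sin (Real.pi * t) / 2 : ℝ) : ℂ)).mul
      (hθ.comp_continuous continuous_smoothStep smoothStep_mem)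
  · simp
  · simp
  · intro t
    have hs := smoothStep_mem t
    obtain ⟨s, hs1, hs2⟩ := intermediate_value_Icc zero_le_one
      (continuous_smoothStep.continuousOn (s := Icc 0 1)) (by
        rw [smoothStep_zero, smoothStep_one]; exact hs)
    exact ⟨s, hs1, by simp [hs2]⟩
  · intro t
    obtain ⟨hm, hd⟩ := hγ _ (smoothStep_mem t)
    refine ⟨hm, ?_⟩
    have := HasDerivWithinAt.scomp (s := univ) t hd (hasDerivAt_smoothStep t).hasDerivWithinAt
      (fun s _ => smoothStep_mem s)
    rw [hasDerivWithinAt_univ] at this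
    convert this using 1
    rw [mul_smul]
    rfl

theorem mem_leaf_of_curve {γ : ℝ → E} {θ : ℝ → ℂ} (hθ : Continuous θ)
    (hd : ∀ t, HasDerivAt γ (θ t • Z (γ t)) t) (hm : ∀ t ∈ Icc (0 : ℝ) 1, γ t ∈ Ω) :
    γ 1 ∈ leaf Z Ω (γ 0) :=
  ⟨γ, θ, rfl, rfl, hθ.continuousOn, fun t ht => ⟨hm t ht, (hd t).hasDerivWithinAt⟩⟩

theorem leaf_symm (h : q ∈ leaf Z Ω p) : p ∈ leaf Z Ω q := by
  obtain ⟨γ, θ, h0, h1, hθ, -, -, -, hγ⟩ := exists_curve_of_mem_leaf h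
  refine ⟨fun t => γ (1 - t), fun t => - θ (1 - t), by simp [h1], by simp [h0],
    by fun_prop, fun t _ => ⟨(hγ _).1, ?_⟩⟩
  have h2 : HasDerivAt (fun t : ℝ => 1 - t) (-1) t := by
    simpa using (hasDerivAt_id t).const_sub 1
  have := HasDerivAt.scomp t (hγ (1 - t)).2 h2
  refine (this.congr_deriv ?_).hasDerivWithinAt
  simp

/-- The concatenation is differentiable at the junction because both paths, slowed down by
`exists_curve_of_mem_leaf`, have speed zero there. -/
theorem leaf_trans (h : q ∈ leaf Z Ω p) (h' : r ∈ leaf Z Ω q) : r ∈ leaf Z Ω p := by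
  obtain ⟨γ, θ, h0, h1, hθ, -, hθ1, -, hγ⟩ := exists_curve_of_mem_leaf h
  obtain ⟨γ', θ', h0', h1', hθ', hθ0', -, -, hγ'⟩ := exists_curve_of_mem_leaf h'
  refine ⟨fun t => if t ≤ 1 / 2 then γ (2 * t) else γ' (2 * t - 1),
    fun t => if t ≤ 1 / 2 then 2 * θ (2 * t) else 2 * θ' (2 * t - 1), by simp [h0],
    by norm_num [h1'], ?_, ?_⟩
  · refine (Continuous.if_le (by fun_prop) (by fun_prop) continuous_id continuous_const ?_).continuousOn
    rintro t ht
    simp only [id] at ht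
    subst ht
    norm_num [hθ1, hθ0']
  · intro t _
    have e1 : HasDerivAt (fun t : ℝ => 2 * t) 2 t := by
      simpa using (hasDerivAt_id t).const_mul (2 : ℝ)
    have d1 : HasDerivAt (fun t => γ (2 * t)) ((2 * θ (2 * t)) • Z (γ (2 * t))) t := by
      refine (HasDerivAt.scomp t (hγ (2 * t)).2 e1).congr_deriv ?_
      rw [mul_smul]
      exact (RCLike.real_smul_eq_coe_smul (K := ℂ) (2 : ℝ) _).trans (by norm_num)
    have d2 : HasDerivAt (fun t => γ' (2 * t - 1)) ((2 * θ' (2 * t - 1)) • Z (γ' (2 * t - 1))) t := by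
      refine (HasDerivAt.scomp t (hγ' (2 * t - 1)).2 (e1.sub_const 1)).congr_deriv ?_
      rw [mul_smul]
      exact (RCLike.real_smul_eq_coe_smul (K := ℂ) (2 : ℝ) _).trans (by norm_num)
    rcases lt_trichotomy t (1 / 2) with ht | ht | ht
    · simp only [ht.le, if_true]
      refine ⟨(hγ _).1, (d1.congr_of_eventuallyEq ?_).hasDerivWithinAt⟩
      filter_upwards [Iio_mem_nhds ht] with s hs
      rw [if_pos (le_of_lt hs)]
    · refine ⟨by simp only [ht.le, if_true]; exact (hγ _).1, HasDerivAt.hasDerivWithinAt ?_⟩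
      have hz : γ (2 * t) = γ' (2 * t - 1) := by subst ht; norm_num [h1, h0']
      have hz2 : θ (2 * t) = θ' (2 * t - 1) := by subst ht; norm_num [hθ1, hθ0']
      rw [← hasDerivWithinAt_univ, ← Iic_union_Ici (a := (1 / 2 : ℝ))]
      simp only [ht.le, if_true]
      refine HasDerivWithinAt.union (d1.hasDerivWithinAt.congr ?_ ?_)
        ((d2.congr_deriv (by rw [hz, hz2])).hasDerivWithinAt.congr ?_ ?_)
      · intro s hs
        exact if_pos hs
      · exact if_pos ht.le
      · intro s hs
        rcases eq_or_lt_of_le (show 1 / 2 ≤ s from hs) with h | h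
        · subst h
          norm_num [h1, h0']
        · exact if_neg (not_le.mpr h)
      · simp only [ht.le, if_true]
        exact hz
    · simp only [not_le.mpr ht, if_false]
      refine ⟨(hγ' _).1, (d2.congr_of_eventuallyEq ?_).hasDerivWithinAt⟩
      filter_upwards [Ioi_mem_nhds ht] with s hs
      rw [if_neg (not_le.mpr hs)]

theorem leaf_eq_of_mem (h : q ∈ leaf Z Ω p) : leaf Z Ω q = leaf Z Ω p :=
  Set.ext fun _ => ⟨fun h' => leaf_trans h h', fun h' => leaf_trans (leaf_symm h) h'⟩

/-- Every path in a leaf stays in the leaf, so restricting the domain to a union of leaves does not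
change them. -/
theorem leaf_subset_leaf_of_saturated (hs : ∀ x ∈ leaf Z Ω p, x ∈ Ω') :
    leaf Z Ω p ⊆ leaf Z Ω' p := by
  intro q hq
  obtain ⟨γ, θ, h0, h1, hθ, -, -, -, hγ⟩ := exists_curve_of_mem_leaf hq
  refine ⟨γ, θ, h0, h1, hθ.continuousOn, fun t ht => ⟨hs _ ?_, (hγ t).2.hasDerivWithinAt⟩⟩
  -- The initial piece of the path up to time t shows that γ t is itself in the leaf.
  refine ⟨fun s => γ (s * t), fun s => t * θ (s * t), by simp [h0], by simp, by fun_prop,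
    fun s _ => ⟨(hγ _).1, HasDerivAt.hasDerivWithinAt ?_⟩⟩
  have e1 : HasDerivAt (fun s : ℝ => s * t) t s := by
    simpa using (hasDerivAt_id s).mul_const t
  refine (HasDerivAt.scomp s (hγ (s * t)).2 e1).congr_deriv ?_
  rw [mul_smul]
  rfl

/-- The image of a leaf under a linear projection that maps `Z` to `X`. -/
theorem map_mem_leaf {F : Type*} [NormedAddCommGroup F] [NormedSpace ℂ F] {X : F → F} {Ω₁ : Set F}
    (f : E →L[ℂ] F) (hf : ∀ x ∈ Ω, f (Z x) = X (f x)) (hΩ : ∀ x ∈ Ω, f x ∈ Ω₁)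
    (h : q ∈ leaf Z Ω p) : f q ∈ leaf X Ω₁ (f p) := by
  obtain ⟨γ, θ, h0, h1, hθ, hγ⟩ := h
  refine ⟨f ∘ γ, θ, by simp [h0], by simp [h1], hθ, fun t ht => ⟨hΩ _ (hγ t ht).1, ?_⟩⟩
  have := (f.restrictScalars ℝ).hasFDerivAt.comp_hasDerivWithinAt t (hγ t ht).2
  refine this.congr_deriv ?_
  simp [hf _ (hγ t ht).1]

/-- A function whose derivative vanishes along `Z` is constant on the leaves. -/
theorem eq_of_mem_leaf {F : Type*} [NormedAddCommGroup F] [NormedSpace ℂ F] {H : E → F}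
    (H' : E → E →L[ℂ] F) (hH : ∀ x ∈ Ω, HasFDerivAt H (H' x) x) (h0 : ∀ x ∈ Ω, H' x (Z x) = 0)
    (h : q ∈ leaf Z Ω p) : H q = H p := by
  obtain ⟨γ, θ, e0, e1, -, -, -, -, hγ⟩ := exists_curve_of_mem_leaf h
  have hd : ∀ t, HasDerivAt (H ∘ γ) 0 t := by
    intro t
    have := ((hH _ (hγ t).1).restrictScalars ℝ).comp_hasDerivAt t (hγ t).2
    refine this.congr_deriv ?_
    simp [h0 _ (hγ t).1]
  have := is_const_of_deriv_eq_zero (fun t => (hd t).differentiableAt) (fun t => (hd t).deriv) 1 0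
  simpa [e0, e1] using this

/-- A linear form that divides its own derivative along `Z` vanishes on a leaf as soon as it
vanishes at a point of it. -/
theorem eq_zero_of_mem_leaf (l : E →L[ℂ] ℂ) (k : E → ℂ) (hk : ContinuousOn k Ω)
    (hl : ∀ x ∈ Ω, l (Z x) = k x * l x) (h0 : l p = 0) (h : q ∈ leaf Z Ω p) : l q = 0 := by
  obtain ⟨γ, θ, e0, e1, hθ, -, -, -, hγ⟩ := exists_curve_of_mem_leaf h
  have hγc : Continuous γ := continuous_iff_continuousAt.mpr fun t => (hγ t).2.continuousAt
  have hc : Continuous fun t => θ t * k (γ t) :=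
    hθ.mul (hk.comp_continuous hγc fun t => (hγ t).1)
  set B : ℝ → ℂ := fun t => ∫ s in (0 : ℝ)..t, θ s * k (γ s)
  have hB : ∀ t, HasDerivAt B (θ t * k (γ t)) t := fun t =>
    intervalIntegral.integral_hasDerivAt_right (hc.intervalIntegrable _ _)
      (hc.stronglyMeasurableAtFilter _ _) hc.continuousAt
  -- Integrating factor for the linear equation that l satisfies along the path.
  have hd : ∀ t, HasDerivAt (fun t => Complex.exp (-B t) * l (γ t)) 0 t := by
    intro t
    have h1 := (hB t).neg.cexp
    have h2 := (l.restrictScalars ℝ).hasFDerivAt.comp_hasDerivAt t (hγ t).2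
    refine (h1.mul h2).congr_deriv ?_
    simp [hl _ (hγ t).1]
    ring
  have := is_const_of_deriv_eq_zero (fun t => (hd t).differentiableAt) (fun t => (hd t).deriv) 1 0
  simpa [e0, e1, h0, B] using this

end Leaves
end SepVar

end

/-! ### Cauchy estimates and partial derivatives in several variables -/

section

namespace SepVar

section Taylor

variable {M N : ℕ}

/-- `f` is holomorphic in a neighbourhood of the origin. -/
def HolNearZero (f : (Fin M → ℂ) → (Fin N → ℂ)) : Prop :=
  ∀ᶠ x in 𝓝 0, DifferentiableAt ℂ f x

/-- The value of a tuple of polynomials. -/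
def evalTuple (p : Fin N → MvPolynomial (Fin M) ℂ) (x : Fin M → ℂ) : Fin N → ℂ :=
  fun j => MvPolynomial.eval x (p j)

/-- The polynomial map `p` agrees with `f` up to terms of order `n` at the origin. -/
def HasTaylor (n : ℕ) (f : (Fin M → ℂ) → (Fin N → ℂ)) (p : Fin N → MvPolynomial (Fin M) ℂ) : Prop :=
  (fun x => f x - evalTuple p x) =O[𝓝 0] fun x => ‖x‖ ^ n

theorem HolNearZero.continuousAt {f : (Fin M → ℂ) → (Fin N → ℂ)} (hf : HolNearZero f) :
    ContinuousAt f 0 := hf.self_of_nhds.continuousAt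

theorem HolNearZero.exists_ball {f : (Fin M → ℂ) → (Fin N → ℂ)} (hf : HolNearZero f) :
    ∃ R > 0, ∀ x, ‖x‖ < R → DifferentiableAt ℂ f x := by
  obtain ⟨R, hR, h⟩ := Metric.eventually_nhds_iff.mp hf
  exact ⟨R, hR, fun x hx => h (by simpa using hx)⟩

theorem HolNearZero.sub {f g : (Fin M → ℂ) → (Fin N → ℂ)} (hf : HolNearZero f)
    (hg : HolNearZero g) : HolNearZero (fun x => f x - g x) := by
  filter_upwards [hf, hg] with x h1 h2 using h1.fun_sub h2

theorem norm_single_one (i : Fin M) : ‖(Pi.single i 1 : Fin M → ℂ)‖ = 1 := by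
  simp [Pi.norm_single]

/-- The Cauchy estimate for the directional derivative of a holomorphic map. -/
theorem norm_fderiv_apply_le {f : (Fin M → ℂ) → (Fin N → ℂ)} {x v : Fin M → ℂ} {ρ C : ℝ} (hρ : 0 < ρ)
    (hv : ‖v‖ = 1) (hd : ∀ y, ‖y - x‖ ≤ ρ → DifferentiableAt ℂ f y)
    (hC : ∀ y, ‖y - x‖ ≤ ρ → ‖f y‖ ≤ C) : ‖fderiv ℂ f x v‖ ≤ C / ρ := by
  have h1 : HasDerivAt (fun s : ℂ => x + s • v) v 0 := by
    simpa using ((hasDerivAt_id (0 : ℂ)).smul_const v).const_add x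
  have hin : ∀ s : ℂ, ‖s‖ ≤ ρ → ‖(x + s • v) - x‖ ≤ ρ := fun s hs => by
    simpa [norm_smul, hv] using hs
  have h2 : HasDerivAt (fun s : ℂ => f (x + s • v)) (fderiv ℂ f x v) 0 := by
    have := (hd x (by simpa using hρ.le)).hasFDerivAt
    have h3 : HasFDerivAt f (fderiv ℂ f x) (x + (0 : ℂ) • v) := by simpa using this
    exact h3.comp_hasDerivAt (0 : ℂ) h1
  rw [← h2.deriv]
  refine Complex.norm_deriv_le_of_forall_mem_sphere_norm_le hρ ?_ ?_
  · refine DifferentiableOn.diffContOnCl ?_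
    intro s hs
    have hs' : ‖s‖ ≤ ρ := by
      have := Metric.closure_ball_subset_closedBall hs
      simpa using this
    refine DifferentiableAt.differentiableWithinAt ?_
    exact (hd _ (hin s hs')).comp s (by fun_prop)
  · intro s hs
    exact hC _ (hin s (by simpa using (mem_sphere_zero_iff_norm.mp hs).le))

theorem norm_fderiv_le {f : (Fin M → ℂ) → (Fin N → ℂ)} {x : Fin M → ℂ} {ρ C : ℝ} (hρ : 0 < ρ)
    (hC0 : 0 ≤ C) (hd : ∀ y, ‖y - x‖ ≤ ρ → DifferentiableAt ℂ f y)
    (hC : ∀ y, ‖y - x‖ ≤ ρ → ‖f y‖ ≤ C) : ‖fderiv ℂ f x‖ ≤ C / ρ := by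
  refine ContinuousLinearMap.opNorm_le_bound _ (by positivity) fun v => ?_
  by_cases hv : v = 0
  · simp [hv]
  have hn : (‖v‖ : ℂ) ≠ 0 := by simpa using hv
  have h1 : ‖((‖v‖ : ℂ)⁻¹ • v)‖ = 1 := by
    rw [norm_smul]; simp [hv]
  have h2 := norm_fderiv_apply_le hρ h1 hd hC
  rw [map_smul, norm_smul] at h2
  have hv' : 0 < ‖v‖ := norm_pos_iff.mpr hv
  simp only [norm_inv, Complex.norm_real, norm_norm] at h2
  rwa [inv_mul_le_iff₀ hv', mul_comm] at h2

/-- The partial derivatives of a holomorphic map in several variables are holomorphic. -/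
theorem HolNearZero.partialD {f : (Fin M → ℂ) → (Fin N → ℂ)} (hf : HolNearZero f) (i : Fin M) :
    HolNearZero (partialD i f) := by
  obtain ⟨R, hR, hd⟩ := hf.exists_ball
  -- Room for three steps of size ρ: the point, the circle around it, and the ball of the Cauchy
  -- estimate.
  set ρ := R / 4 with hρ
  have hρ0 : 0 < ρ := by positivity
  set e : Fin M → ℂ := Pi.single i 1 with he
  have hen : ‖e‖ = 1 := norm_single_one i
  have hcl : ContinuousOn f (Metric.closedBall 0 (3 * ρ)) := fun y hy =>
    (hd y (by simp at hy; linarith)).continuousAt.continuousWithinAt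
  obtain ⟨C, hC⟩ := (isCompact_closedBall (0 : Fin M → ℂ) (3 * ρ)).exists_bound_of_continuousOn hcl
  have hC0 : 0 ≤ C := (norm_nonneg _).trans (hC 0 (by simp; positivity))
  have hbd : ∀ y, ‖y‖ ≤ 2 * ρ → ‖fderiv ℂ f y‖ ≤ C / ρ := fun y hy => by
    have aux : ∀ z, ‖z - y‖ ≤ ρ → ‖z‖ ≤ 3 * ρ := fun z hz => by
      have := norm_add_le (z - y) y
      rw [sub_add_cancel] at this
      linarith
    exact norm_fderiv_le hρ0 hC0 (fun z hz => hd z (by have := aux z hz; linarith))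
      (fun z hz => hC z (by simpa using aux z hz))
  -- Cauchy's formula in the direction e turns the partial derivative into an integral of values of
  -- f, which can be differentiated under the integral sign; `hbd` supplies the dominating bound.
  have hcauchy : ∀ x, ‖x‖ < ρ → SepVar.partialD i f x =
      (2 * Real.pi * Complex.I : ℂ)⁻¹ • ∮ z in C(0, ρ), ((z - 0) ^ 2)⁻¹ • f (x + z • e) := by
    intro x hx
    have h1 : HasDerivAt (fun s : ℂ => x + s • e) e 0 := by
      simpa using ((hasDerivAt_id (0 : ℂ)).smul_const e).const_add x
    have h2 : HasDerivAt (fun s : ℂ => f (x + s • e)) (fderiv ℂ f x e) 0 := by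
      have h3 : HasFDerivAt f (fderiv ℂ f x) (x + (0 : ℂ) • e) := by
        simpa using (hd x (by linarith)).hasFDerivAt
      exact h3.comp_hasDerivAt (0 : ℂ) h1
    rw [Complex.two_pi_I_inv_smul_circleIntegral_sub_sq_inv_smul_of_differentiable
      (U := Metric.ball 0 (2 * ρ)) Metric.isOpen_ball
      (Metric.closedBall_subset_ball (by linarith)) ?_ (by simpa using hρ0), h2.deriv]
    · rfl
    · intro s hs
      have hs' : ‖s‖ < 2 * ρ := by simpa using hs
      refine DifferentiableAt.differentiableWithinAt ?_
      refine (hd _ ?_).comp s (by fun_prop)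
      have := norm_add_le x (s • e)
      rw [norm_smul, hen] at this
      linarith
  have key : ∀ x, ‖x‖ < ρ / 2 →
      DifferentiableAt ℂ (fun x => ∮ z in C(0, ρ), ((z - 0) ^ 2)⁻¹ • f (x + z • e)) x := by
    intro x hx
    have hcm : Continuous (circleMap (0 : ℂ) ρ) := continuous_circleMap 0 ρ
    have hcd : Continuous fun t => deriv (circleMap (0 : ℂ) ρ) t := by
      simp only [deriv_circleMap]; fun_prop
    have hinv : Continuous fun t : ℝ => ((circleMap (0 : ℂ) ρ t - 0) ^ 2)⁻¹ :=
      Continuous.inv₀ ((hcm.sub continuous_const).pow 2) fun t => by simpa using hρ0.ne'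
    have hs : Metric.ball (0 : Fin M → ℂ) ρ ∈ 𝓝 x :=
      Metric.isOpen_ball.mem_nhds (by simp; linarith)
    have hin : ∀ y, ‖y‖ < ρ → ∀ t, ‖y + circleMap 0 ρ t • e‖ < 2 * ρ := fun y hy t => by
      have := norm_add_le y (circleMap 0 ρ t • e)
      rw [norm_smul, hen, norm_circleMap_zero, abs_of_pos hρ0] at this
      linarith
    have hcont : ∀ y, ‖y‖ < ρ → Continuous fun t : ℝ => deriv (circleMap (0 : ℂ) ρ) t •
        ((circleMap 0 ρ t - 0) ^ 2)⁻¹ • f (y + circleMap 0 ρ t • e) := fun y hy => by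
      refine hcd.smul (hinv.smul ?_)
      refine hcl.comp_continuous (by fun_prop) fun t => ?_
      have := hin y hy t
      simp
      linarith
    refine HasFDerivAt.differentiableAt
      (intervalIntegral.hasFDerivAt_integral_of_dominated_of_fderiv_le (𝕜 := ℂ)
        (F := fun y (t : ℝ) => deriv (circleMap (0 : ℂ) ρ) t •
          ((circleMap 0 ρ t - 0) ^ 2)⁻¹ • f (y + circleMap 0 ρ t • e))
        (F' := fun y t => deriv (circleMap (0 : ℂ) ρ) t •
          ((circleMap 0 ρ t - 0) ^ 2)⁻¹ • fderiv ℂ f (y + circleMap 0 ρ t • e))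
        (bound := fun t => ρ * (ρ ^ 2)⁻¹ * (C / ρ)) hs ?_ ?_ ?_ ?_ ?_ ?_)
    · filter_upwards [hs] with y hy
      exact (hcont y (by simpa using hy)).aestronglyMeasurable
    · exact (hcont x (by linarith)).intervalIntegrable _ _
    -- Continuity of the derivative is not known at this point; measurability suffices.
    · have hm : Measurable fun t : ℝ => fderiv ℂ f (x + circleMap 0 ρ t • e) :=
        (measurable_fderiv ℂ f).comp (by fun_prop : Continuous fun t : ℝ =>
          x + circleMap 0 ρ t • e).measurable
      exact hcd.aestronglyMeasurable.smul
        (hinv.aestronglyMeasurable.smul hm.stronglyMeasurable.aestronglyMeasurable)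
    · refine Eventually.of_forall fun t _ y hy => ?_
      have hy' : ‖y‖ < ρ := by simpa using hy
      rw [norm_smul, norm_smul]
      have e1 : ‖deriv (circleMap (0 : ℂ) ρ) t‖ = ρ := by
        simp [deriv_circleMap, abs_of_pos hρ0]
      have e2 : ‖((circleMap (0 : ℂ) ρ t - 0) ^ 2)⁻¹‖ = (ρ ^ 2)⁻¹ := by
        simp [abs_of_pos hρ0]
      rw [e1, e2, mul_assoc]
      have := hbd _ (hin y hy' t).le
      gcongr
    · exact intervalIntegrable_const
    · refine Eventually.of_forall fun t _ y hy => ?_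
      have hy' : ‖y‖ < ρ := by simpa using hy
      have h1 := (hd (y + circleMap 0 ρ t • e) (by have := hin y hy' t; linarith)).hasFDerivAt
      have h2 : HasFDerivAt (fun y => f (y + circleMap 0 ρ t • e))
          (fderiv ℂ f (y + circleMap 0 ρ t • e)) y := by
        simpa using h1.comp y ((hasFDerivAt_id y).add_const (circleMap 0 ρ t • e))
      exact (h2.fun_const_smul _).fun_const_smul _
  have hev : ∀ᶠ x : Fin M → ℂ in 𝓝 0, ‖x‖ < ρ / 2 := by
    filter_upwards [Metric.ball_mem_nhds (0 : Fin M → ℂ) (half_pos hρ0)] with x hx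
    simpa using hx
  filter_upwards [hev] with x hx
  refine DifferentiableAt.congr_of_eventuallyEq 
    ((key x hx).fun_const_smul (2 * Real.pi * Complex.I : ℂ)⁻¹) ?_
  filter_upwards [Metric.isOpen_ball.mem_nhds (show x ∈ Metric.ball 0 ρ by simp; linarith)] with y hy
  exact hcauchy y (by simpa using hy)

end Taylor
end SepVar

end

/-! ### Taylor polynomials and the identity theorem at the origin -/

section

namespace SepVar

section TaylorPolynomials

variable {M N : ℕ}

theorem differentiableAt_evalTuple (p : Fin N → MvPolynomial (Fin M) ℂ) (x : Fin M → ℂ) :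
    DifferentiableAt ℂ (evalTuple p) x := by
  rw [differentiableAt_pi]
  intro j
  have h := AnalyticOnNhd.eval_mvPolynomial (𝕜 := ℂ) (p j)
  exact (h x (mem_univ _)).differentiableAt

theorem hasFDerivAt_eval (p : MvPolynomial (Fin M) ℂ) (x : Fin M → ℂ) (i : Fin M) :
    HasDerivAt (fun s : ℂ => MvPolynomial.eval (x + s • Pi.single i 1) p)
      (MvPolynomial.eval x (MvPolynomial.pderiv i p)) 0 := by
  induction p using MvPolynomial.induction_on with
  | C a => simpa using hasDerivAt_const (0 : ℂ) a
  | add p q hp hq => simpa using hp.fun_add hq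
  | mul_X p j hp =>
    have h1 : HasDerivAt (fun s : ℂ => (x + s • (Pi.single i 1 : Fin M → ℂ)) j)
        ((Pi.single i 1 : Fin M → ℂ) j) 0 := by
      simpa using ((hasDerivAt_id (0 : ℂ)).mul_const ((Pi.single i 1 : Fin M → ℂ) j)).const_add (x j)
    have h2 := hp.mul h1
    simp only [map_mul, MvPolynomial.eval_X]
    refine h2.congr_deriv ?_
    rw [Derivation.leibniz, MvPolynomial.pderiv_X]
    simp only [zero_smul, add_zero, smul_eq_mul, map_add, map_mul, MvPolynomial.eval_X]
    have : MvPolynomial.eval x (Pi.single (M := fun _ => MvPolynomial (Fin M) ℂ) i 1 j) =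
        (Pi.single i 1 : Fin M → ℂ) j := by
      by_cases h : j = i
      · subst h; simp
      · simp [h]
    rw [this]
    ring

theorem partialD_evalTuple (p : Fin N → MvPolynomial (Fin M) ℂ) (i : Fin M) :
    partialD i (evalTuple p) = evalTuple fun j => MvPolynomial.pderiv i (p j) := by
  funext x
  have h1 : HasDerivAt (fun s : ℂ => x + s • (Pi.single i 1 : Fin M → ℂ)) (Pi.single i 1) 0 := by
    simpa using ((hasDerivAt_id (0 : ℂ)).smul_const (Pi.single i 1 : Fin M → ℂ)).const_add x
  have h3 : HasFDerivAt (evalTuple p) (fderiv ℂ (evalTuple p) x)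
      (x + (0 : ℂ) • (Pi.single i 1 : Fin M → ℂ)) := by
    simpa using (differentiableAt_evalTuple p x).hasFDerivAt
  have h2 := h3.comp_hasDerivAt (0 : ℂ) h1
  refine h2.unique ?_
  rw [hasDerivAt_pi]
  exact fun j => hasFDerivAt_eval (p j) x i

theorem holNearZero_evalTuple (p : Fin N → MvPolynomial (Fin M) ℂ) : HolNearZero (evalTuple p) :=
  Eventually.of_forall fun x => differentiableAt_evalTuple p x

/-- Cauchy's estimate on the ball of radius ‖x‖ about x trades one order of vanishing of f - p for
one derivative. -/
theorem HasTaylor.partialD {n : ℕ} {f : (Fin M → ℂ) → (Fin N → ℂ)}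
    {p : Fin N → MvPolynomial (Fin M) ℂ} (hf : HolNearZero f) (h : HasTaylor (n + 1) f p)
    (i : Fin M) :
    HasTaylor n (partialD i f) (fun j => MvPolynomial.pderiv i (p j)) := by
  set g := fun x => f x - evalTuple p x with hg
  have hgh : HolNearZero g := hf.sub (holNearZero_evalTuple p)
  obtain ⟨C, hC0, hC⟩ := h.exists_pos
  obtain ⟨r, hr, hr'⟩ := Metric.eventually_nhds_iff.mp (hC.bound.and hgh)
  have hpd : ∀ᶠ x in 𝓝 0, SepVar.partialD i f x - evalTuple (fun j => MvPolynomial.pderiv i (p j)) x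
      = fderiv ℂ g x (Pi.single i 1) := by
    filter_upwards [hf] with x hx
    rw [← partialD_evalTuple]
    simp only [hg, SepVar.partialD]
    rw [fderiv_fun_sub hx (differentiableAt_evalTuple p x)]
    rfl
  have hest : ∀ x : Fin M → ℂ, ∀ ρ > 0, ‖x‖ + ρ < r →
      ‖fderiv ℂ g x (Pi.single i 1)‖ ≤ C * (‖x‖ + ρ) ^ (n + 1) / ρ := by
    intro x ρ hρ hxr
    have aux : ∀ y, ‖y - x‖ ≤ ρ → ‖y‖ ≤ ‖x‖ + ρ := fun y hy => by
      have := norm_add_le (y - x) x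
      rw [sub_add_cancel] at this
      linarith
    refine norm_fderiv_apply_le hρ (norm_single_one i) (fun y hy => ?_) (fun y hy => ?_)
    · exact (hr' (y := y) (by simpa using (aux y hy).trans_lt hxr)).2
    · have h1 := (hr' (y := y) (by simpa using (aux y hy).trans_lt hxr)).1
      refine h1.trans ?_
      rw [norm_pow, norm_norm]
      have := aux y hy
      gcongr
  refine Asymptotics.IsBigO.of_bound (C * 2 ^ (n + 1)) ?_
  have hev : ∀ᶠ x : Fin M → ℂ in 𝓝 0, ‖x‖ < r / 2 := by
    filter_upwards [Metric.ball_mem_nhds (0 : Fin M → ℂ) (half_pos hr)] with x hx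
    simpa using hx
  filter_upwards [hpd, hev] with x hx hxr
  rw [hx, norm_pow, norm_norm]
  by_cases hx0 : x = 0
  -- At x = 0 the radius ‖x‖ degenerates, so the estimate is applied with small ρ > 0 and ρ tends to
  -- 0.
  · subst hx0
    have hlim : Tendsto (fun ρ : ℝ => C * ρ ^ n) (𝓝[>] 0) (𝓝 (C * 0 ^ n)) := by
      have : Continuous fun ρ : ℝ => C * ρ ^ n := by fun_prop
      exact (this.tendsto 0).mono_left nhdsWithin_le_nhds
    have h1 : ‖fderiv ℂ g 0 (Pi.single i 1)‖ ≤ C * 0 ^ n := by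
      refine ge_of_tendsto hlim ?_
      filter_upwards [Ioo_mem_nhdsGT hr] with ρ hρ
      refine (hest 0 ρ hρ.1 (by simpa using hρ.2)).trans (le_of_eq ?_)
      have := hρ.1.ne'
      field_simp
      rw [norm_zero, zero_add]
      ring
    rw [norm_zero]
    refine h1.trans ?_
    have : (1 : ℝ) ≤ 2 ^ (n + 1) := one_le_pow₀ (by norm_num)
    have h0 : (0 : ℝ) ≤ C * 0 ^ n := by positivity
    nlinarith
  · have hpos : 0 < ‖x‖ := norm_pos_iff.mpr hx0
    refine (hest x ‖x‖ hpos (by linarith)).trans (le_of_eq ?_)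
    field_simp
    ring

/-- For a monomial of degree e it suffices to divide by e + 1. The lemma integrates Taylor
polynomials along rays. -/
theorem exists_radial_primitive (q : MvPolynomial (Fin M) ℂ) :
    ∃ Q : MvPolynomial (Fin M) ℂ, ∀ (x : Fin M → ℂ) (s : ℝ),
      HasDerivAt (fun s : ℝ => (s : ℂ) * MvPolynomial.eval ((s : ℂ) • x) Q)
        (MvPolynomial.eval ((s : ℂ) • x) q) s := by
  induction q using MvPolynomial.induction_on' with
  | monomial K a =>
    refine ⟨MvPolynomial.monomial K (a / ((K.degree : ℂ) + 1)), fun x s => ?_⟩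
    have hev : ∀ (b : ℂ) (s : ℂ), MvPolynomial.eval (s • x) (MvPolynomial.monomial K b) =
        s ^ K.degree * MvPolynomial.eval x (MvPolynomial.monomial K b) := by
      intro b s
      simp only [MvPolynomial.eval_monomial, Pi.smul_apply, smul_eq_mul, mul_pow,
        Finsupp.prod, Finset.prod_mul_distrib, Finset.prod_pow_eq_pow_sum, Finsupp.degree_apply]
      ring
    simp only [hev]
    have hne : (K.degree : ℂ) + 1 ≠ 0 := Nat.cast_add_one_ne_zero _
    have h1 : HasDerivAt (fun s : ℝ => ((s : ℂ)) ^ (K.degree + 1))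
        ((K.degree + 1 : ℕ) * (s : ℂ) ^ K.degree) s := by
      simpa using (hasDerivAt_pow (K.degree + 1) (s : ℂ)).comp_ofReal
    have h2 := h1.mul_const (MvPolynomial.eval x (MvPolynomial.monomial K (a / ((K.degree : ℂ) + 1))))
    refine (h2.congr_of_eventuallyEq (Eventually.of_forall fun t => ?_)).congr_deriv ?_
    · simp only
      ring
    · simp only [MvPolynomial.eval_monomial]
      push_cast
      field_simp
  | add p q hp hq =>
    obtain ⟨P, hP⟩ := hp
    obtain ⟨Q, hQ⟩ := hq
    refine ⟨P + Q, fun x s => ?_⟩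
    refine (((hP x s).add (hQ x s)).congr_of_eventuallyEq (Eventually.of_forall fun t => ?_)).congr_deriv
      ?_
    · simp [mul_add]
    · simp

/-- A holomorphic map has Taylor polynomials of all orders at the origin. -/
theorem HolNearZero.exists_hasTaylor (n : ℕ) {f : (Fin M → ℂ) → (Fin N → ℂ)} (hf : HolNearZero f) :
    ∃ p, HasTaylor n f p := by
  induction n generalizing f with
  | zero =>
    refine ⟨0, ?_⟩
    have h1 : ContinuousAt (fun x => f x - evalTuple (0 : Fin N → MvPolynomial (Fin M) ℂ) x) 0 :=
      hf.continuousAt.sub (differentiableAt_evalTuple _ _).continuousAt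
    simpa [HasTaylor] using h1.isBigO_one ℝ
  | succ n ih =>
    -- The polynomial of order n + 1 comes from those of the partial derivatives through f(x) = f(0)
    -- + ∑ x_i ∫ ∂_i f(s x) ds over 0 ≤ s ≤ 1.
    choose q hq using fun i : Fin M => ih (hf.partialD i)
    choose Q hQ using fun i j => exists_radial_primitive (q i j)
    refine ⟨fun j => MvPolynomial.C (f 0 j) + ∑ i, MvPolynomial.X i * Q i j, ?_⟩
    choose C hC0 hC using fun i => (hq i).exists_pos
    have hall : ∀ᶠ x in 𝓝 (0 : Fin M → ℂ), DifferentiableAt ℂ f x ∧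
        ∀ i, ‖SepVar.partialD i f x - evalTuple (q i) x‖ ≤ C i * ‖x‖ ^ n := by
      refine hf.and (eventually_all.mpr fun i => ?_)
      filter_upwards [(hC i).bound] with x hx
      simpa using hx
    obtain ⟨r, hr, hr'⟩ := Metric.eventually_nhds_iff.mp hall
    refine Asymptotics.IsBigO.of_bound (∑ i, C i) ?_
    filter_upwards [Metric.ball_mem_nhds (0 : Fin M → ℂ) hr] with x hx
    have hx' : ‖x‖ < r := by simpa using hx
    set φ : ℝ → Fin N → ℂ := fun s j => f ((s : ℂ) • x) j -
      ∑ i, x i * ((s : ℂ) * MvPolynomial.eval ((s : ℂ) • x) (Q i j)) with hφ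
    have hsx : ∀ s ∈ Icc (0 : ℝ) 1, ‖(s : ℂ) • x‖ ≤ ‖x‖ := by
      intro s hs
      rw [norm_smul, Complex.norm_real, Real.norm_of_nonneg hs.1]
      exact mul_le_of_le_one_left (norm_nonneg _) hs.2
    have hderiv : ∀ s ∈ Icc (0 : ℝ) 1, HasDerivAt φ
        (∑ i, x i • (SepVar.partialD i f ((s : ℂ) • x) - evalTuple (q i) ((s : ℂ) • x))) s := by
      intro s hs
      rw [hasDerivAt_pi]
      intro j
      have hd := (hr' (y := (s : ℂ) • x) (by simpa using (hsx s hs).trans_lt hx')).1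
      have h1 : HasDerivAt (fun s : ℝ => (s : ℂ) • x) x s := by
        have := (Complex.ofRealCLM.hasDerivAt (x := s)).smul_const x
        simpa using this
      have h2 := (hd.hasFDerivAt.restrictScalars ℝ).comp_hasDerivAt s h1
      have h3 := (hasDerivAt_pi.mp h2) j
      have h4 : HasDerivAt (fun s : ℝ => ∑ i, x i * ((s : ℂ) *
          MvPolynomial.eval ((s : ℂ) • x) (Q i j)))
          (∑ i, x i * MvPolynomial.eval ((s : ℂ) • x) (q i j)) s :=
        HasDerivAt.fun_sum fun i _ => (hQ i j x s).const_mul (x i)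
      refine (h3.sub h4).congr_deriv ?_
      have h5 : fderiv ℂ f ((s : ℂ) • x) x = ∑ i, x i • SepVar.partialD i f ((s : ℂ) • x) := by
        simp only [SepVar.partialD]
        generalize fderiv ℂ f ((s : ℂ) • x) = D
        conv_lhs => rw [pi_eq_sum_univ' x, map_sum]
        simp [map_smul]
      simp only [ContinuousLinearMap.coe_restrictScalars', h5, Finset.sum_apply, Pi.smul_apply,
        Pi.sub_apply, smul_eq_mul, mul_sub, Finset.sum_sub_distrib, evalTuple]
    have hmv := norm_image_sub_le_of_norm_deriv_le_segment_01' (C := (∑ i, C i) * ‖x‖ ^ (n + 1))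
      (fun s hs => (hderiv s hs).hasDerivWithinAt) (fun s hs => ?_)
    · rw [norm_pow, norm_norm]
      refine le_trans (le_of_eq ?_) hmv
      congr 1
      funext j
      simp [hφ, evalTuple]
      ring
    · have hs' : s ∈ Icc (0 : ℝ) 1 := ⟨hs.1, hs.2.le⟩
      rw [Finset.sum_mul]
      refine norm_sum_le_of_le _ fun i _ => ?_
      rw [norm_smul, pow_succ, ← mul_assoc, mul_comm]
      have h6 := (hr' (y := (s : ℂ) • x) (by simpa using (hsx s hs').trans_lt hx')).2 i
      have h7 : ‖(s : ℂ) • x‖ ^ n ≤ ‖x‖ ^ n := pow_le_pow_left₀ (norm_nonneg _) (hsx s hs') n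
      refine mul_le_mul (h6.trans ?_) (norm_le_pi_norm x i) (norm_nonneg _) ?_
      · exact mul_le_mul_of_nonneg_left h7 (hC0 i).le
      · exact mul_nonneg (hC0 i).le (by positivity)

theorem HasTaylor.value {n : ℕ} {f : (Fin M → ℂ) → (Fin N → ℂ)}
    {p : Fin N → MvPolynomial (Fin M) ℂ} (h : HasTaylor (n + 1) f p) (j : Fin N) :
    f 0 j = MvPolynomial.coeff 0 (p j) := by
  obtain ⟨C, hC0, hC⟩ := h.exists_pos
  have := hC.bound.self_of_nhds
  simp only [norm_zero, ne_eq, Nat.succ_ne_zero, not_false_eq_true, zero_pow, mul_zero,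
    norm_le_zero_iff] at this
  have h2 := congrFun this j
  simp only [evalTuple, Pi.sub_apply, Pi.zero_apply, sub_eq_zero] at h2
  rw [h2, ← MvPolynomial.constantCoeff_eq, ← MvPolynomial.eval_zero]

theorem HasTaylor.iterate_partialD {n k : ℕ} {f : (Fin M → ℂ) → (Fin N → ℂ)}
    {p : Fin N → MvPolynomial (Fin M) ℂ} (hf : HolNearZero f) (h : HasTaylor (n + k) f p)
    (i : Fin M) : HolNearZero ((SepVar.partialD i)^[k] f) ∧
      HasTaylor n ((SepVar.partialD i)^[k] f) (fun j => (MvPolynomial.pderiv i)^[k] (p j)) := by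
  induction k generalizing f p with
  | zero => exact ⟨hf, h⟩
  | succ k ih => exact ih (hf.partialD i) (HasTaylor.partialD hf h i)

theorem coeff_iterate_pderiv (i : Fin M) (k : ℕ) (p : MvPolynomial (Fin M) ℂ) (K : Fin M →₀ ℕ)
    (hK : K i = 0) : MvPolynomial.coeff K ((MvPolynomial.pderiv i)^[k] p) =
      (k.factorial : ℂ) * MvPolynomial.coeff (K + Finsupp.single i k) p := by
  have key : ∀ (k l : ℕ), MvPolynomial.coeff (K + Finsupp.single i l)
      ((MvPolynomial.pderiv i)^[k] p) * (l.factorial : ℂ) =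
      ((l + k).factorial : ℂ) * MvPolynomial.coeff (K + Finsupp.single i (l + k)) p := by
    intro k
    induction k with
    | zero => intro l; simp [mul_comm]
    | succ k ih =>
      intro l
      rw [Function.iterate_succ_apply', MvPolynomial.coeff_pderiv, add_assoc, ← Finsupp.single_add]
      have := ih (l + 1)
      rw [Nat.factorial_succ] at this
      simp only [Finsupp.coe_add, Pi.add_apply, hK, Finsupp.single_eq_same, zero_add]
      rw [show l + (k + 1) = l + 1 + k by ring, ← this]
      push_cast
      ring
  simpa using key k 0

/-- Iterated derivatives of f and of p agree at the origin up to order n - 1. This replaces Taylor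
coefficients by polynomial algebra in all that follows. -/
theorem taylorCoeff_eq {n : ℕ} {f : (Fin M → ℂ) → (Fin N → ℂ)}
    {p : Fin N → MvPolynomial (Fin M) ℂ} (hf : HolNearZero f) (h : HasTaylor n f p)
    (K : Fin M →₀ ℕ) (hK : K.degree < n) (j : Fin N) :
    taylorCoeff K f j = MvPolynomial.coeff K (p j) := by
  -- Induction along the list of variables in `mixedPartial`. Each variable i costs K i orders of
  -- approximation, and the exponents I compared vanish on the variables already treated.
  have key : ∀ (L : List (Fin M)), L.Nodup → ∀ n, HasTaylor (n + (L.map K).sum) f p →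
      HolNearZero (L.foldr (fun i g => (SepVar.partialD i)^[K i] g) f) ∧
      HasTaylor n (L.foldr (fun i g => (SepVar.partialD i)^[K i] g) f)
        (fun j => L.foldr (fun i g => (MvPolynomial.pderiv i)^[K i] g) (p j)) ∧
      ∀ j (I : Fin M →₀ ℕ), (∀ i ∈ L, I i = 0) →
        MvPolynomial.coeff I (L.foldr (fun i g => (MvPolynomial.pderiv i)^[K i] g) (p j)) =
        (L.map fun i => ((K i).factorial : ℂ)).prod *
          MvPolynomial.coeff (I + (L.map fun i => Finsupp.single i (K i)).sum) (p j) := by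
    intro L
    induction L with
    | nil => intro _ n h; exact ⟨hf, by simpa using h, by simp⟩
    | cons i L ih =>
      intro hL n h
      obtain ⟨hi, hL'⟩ := List.nodup_cons.mp hL
      obtain ⟨h1, h2, h3⟩ := ih hL' (n + K i) (by
        simpa [add_assoc] using h)
      obtain ⟨h4, h5⟩ := h2.iterate_partialD h1 i
      refine ⟨h4, h5, fun j I hI => ?_⟩
      simp only [List.foldr_cons, List.map_cons, List.prod_cons, List.sum_cons]
      rw [coeff_iterate_pderiv i (K i) _ I (hI i (by simp)), h3, mul_assoc, add_assoc]
      intro i' hi'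
      have hne : i ≠ i' := fun h => hi (h ▸ hi')
      simp [hI i' (by simp [hi']), hne]
  have hsum : ((List.finRange M).map K).sum = K.degree := by
    rw [← List.ofFn_eq_map, List.sum_ofFn, Finsupp.degree_eq_sum]
  obtain ⟨c, hc⟩ := Nat.exists_eq_add_of_lt hK
  obtain ⟨-, h2, h3⟩ := key (List.finRange M) (List.nodup_finRange M) (c + 1) (by
    rw [hsum, show c + 1 + K.degree = n by omega]; exact h)
  have h4 := h2.value j
  rw [h3 j 0 (by simp)] at h4
  have e1 : ((List.finRange M).map fun i => ((K i).factorial : ℂ)).prod =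
      ((∏ l, (K l).factorial : ℕ) : ℂ) := by
    rw [← List.ofFn_eq_map, List.prod_ofFn]
    push_cast
    rfl
  have e2 : ((List.finRange M).map fun i => Finsupp.single i (K i)).sum = K := by
    rw [← List.ofFn_eq_map, List.sum_ofFn]
    exact Finsupp.univ_sum_single K
  rw [e1, e2, zero_add] at h4
  have hne : ((∏ l, (K l).factorial : ℕ) : ℂ) ≠ 0 := by
    exact_mod_cast (Finset.prod_pos fun l _ => Nat.factorial_pos (K l)).ne'
  unfold taylorCoeff mixedPartial
  rw [Pi.smul_apply, h4, smul_eq_mul, inv_mul_cancel_left₀ hne]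

theorem norm_eval_monomial_le (K : Fin M →₀ ℕ) (a : ℂ) (x : Fin M → ℂ) :
    ‖MvPolynomial.eval x (MvPolynomial.monomial K a)‖ ≤ ‖a‖ * ‖x‖ ^ K.degree := by
  rw [MvPolynomial.eval_monomial, norm_mul, Finsupp.prod, norm_prod, Finsupp.degree_apply,
    ← Finset.prod_pow_eq_pow_sum]
  refine mul_le_mul_of_nonneg_left (Finset.prod_le_prod (fun _ _ => norm_nonneg _) fun i _ => ?_)
    (norm_nonneg _)
  rw [norm_pow]
  exact pow_le_pow_left₀ (norm_nonneg _) (norm_le_pi_norm x i) _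

theorem eval_isBigO {n : ℕ} (p : MvPolynomial (Fin M) ℂ)
    (hp : ∀ K : Fin M →₀ ℕ, K.degree < n → MvPolynomial.coeff K p = 0) :
    (fun x => MvPolynomial.eval x p) =O[𝓝 0] fun x => ‖x‖ ^ n := by
  have h : (fun x : Fin M → ℂ => MvPolynomial.eval x p) = fun x => ∑ K ∈ p.support,
      MvPolynomial.eval x (MvPolynomial.monomial K (MvPolynomial.coeff K p)) := by
    funext x
    conv_lhs => rw [p.as_sum, map_sum]
  rw [h]
  suffices hs : ∀ K ∈ p.support, (fun x : Fin M → ℂ =>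
      MvPolynomial.eval x (MvPolynomial.monomial K (MvPolynomial.coeff K p))) =O[𝓝 0]
      fun x => ‖x‖ ^ n from Asymptotics.IsBigO.fun_sum hs
  intro K hK
  have hKn : n ≤ K.degree := by
    by_contra hlt
    exact (MvPolynomial.mem_support_iff.mp hK) (hp K (not_le.mp hlt))
  refine Asymptotics.IsBigO.of_bound ‖MvPolynomial.coeff K p‖ ?_
  filter_upwards [Metric.ball_mem_nhds (0 : Fin M → ℂ) one_pos] with x hx
  rw [norm_pow, norm_norm]
  refine (norm_eval_monomial_le K _ x).trans (mul_le_mul_of_nonneg_left ?_ (norm_nonneg _))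
  exact pow_le_pow_of_le_one (norm_nonneg _) (by simpa using (mem_ball_zero_iff.mp hx).le) hKn

/-- The identity theorem at the origin: a holomorphic map with vanishing Taylor coefficients
vanishes near the origin. -/
theorem HolNearZero.eventually_eq_zero {f : (Fin M → ℂ) → (Fin N → ℂ)} (hf : HolNearZero f)
    (h : ∀ K : Fin M → ℕ, taylorCoeff K f = 0) : ∀ᶠ x in 𝓝 0, f x = 0 := by
  have hO : ∀ n, f =O[𝓝 0] fun x : Fin M → ℂ => ‖x‖ ^ n := by
    intro n
    obtain ⟨p, hp⟩ := hf.exists_hasTaylor n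
    have h2 : evalTuple p =O[𝓝 0] fun x : Fin M → ℂ => ‖x‖ ^ n := by
      rw [Asymptotics.isBigO_pi]
      intro j
      refine eval_isBigO (p j) fun K hK => ?_
      rw [← taylorCoeff_eq hf hp K hK j, h]
      rfl
    simpa using hp.add h2
  obtain ⟨R, hR, hd⟩ := hf.exists_ball
  filter_upwards [Metric.ball_mem_nhds (0 : Fin M → ℂ) hR] with x hx
  have hxR : ‖x‖ < R := by simpa using hx
  by_cases hx0 : x = 0
  · subst hx0
    obtain ⟨C, hC⟩ := (hO 1).bound
    simpa using hC.self_of_nhds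
  have hxpos : 0 < ‖x‖ := norm_pos_iff.mpr hx0
  -- On the complex line through x the problem has one variable: g is flat at 0, hence zero near 0,
  -- and the identity theorem on the disc extends this to s = 1.
  set g : ℂ → Fin N → ℂ := fun s => f (s • x) with hg
  have hgd : DifferentiableOn ℂ g (Metric.ball 0 (R / ‖x‖)) := by
    intro s hs
    have hs' : ‖s‖ * ‖x‖ < R := (lt_div_iff₀ hxpos).mp (by simpa using hs)
    refine DifferentiableAt.differentiableWithinAt ?_
    exact (hd (s • x) (by rwa [norm_smul])).comp s (by fun_prop)
  have hga : AnalyticOnNhd ℂ g (Metric.ball 0 (R / ‖x‖)) := hgd.analyticOnNhd Metric.isOpen_ball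
  have h0 : (0 : ℂ) ∈ Metric.ball (0 : ℂ) (R / ‖x‖) := by
    simp only [Metric.mem_ball, dist_self]; positivity
  have hgO : ∀ n, g =O[𝓝 0] fun s : ℂ => ‖s‖ ^ n := by
    intro n
    have ht : Tendsto (fun s : ℂ => s • x) (𝓝 0) (𝓝 0) := by
      have : Continuous fun s : ℂ => s • x := by fun_prop
      simpa using this.tendsto 0
    refine ((hO n).comp_tendsto ht).trans (Asymptotics.IsBigO.of_bound (‖x‖ ^ n) ?_)
    refine Eventually.of_forall fun s => ?_
    simp [norm_smul, mul_pow, mul_comm]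
  have hev : ∀ᶠ s in 𝓝 (0 : ℂ), g s = 0 := by
    by_contra hne
    obtain ⟨n, u, hu, hu0, hgu⟩ := (hga 0 h0).exists_eventuallyEq_pow_smul_nonzero_iff.mpr hne
    obtain ⟨C, hC⟩ := (hgO (n + 1)).bound
    have h1 : ∀ᶠ s in 𝓝[≠] (0 : ℂ), ‖u s‖ ≤ C * ‖s‖ := by
      filter_upwards [nhdsWithin_le_nhds hgu, nhdsWithin_le_nhds hC, self_mem_nhdsWithin]
        with s hs1 hs2 hs3
      rw [hs1, norm_smul, sub_zero] at hs2
      have hs3' : 0 < ‖s‖ := norm_pos_iff.mpr hs3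
      simp only [norm_pow, norm_norm] at hs2
      have h4 : ‖s‖ ^ n * ‖u s‖ ≤ ‖s‖ ^ n * (C * ‖s‖) := by
        calc _ ≤ _ := hs2
          _ = _ := by ring
      exact le_of_mul_le_mul_left h4 (by positivity)
    have h2 : Tendsto (fun s => ‖u s‖) (𝓝[≠] 0) (𝓝 ‖u 0‖) :=
      (hu.continuousAt.norm.tendsto).mono_left nhdsWithin_le_nhds
    have h3 : Tendsto (fun s : ℂ => C * ‖s‖) (𝓝[≠] 0) (𝓝 0) := by
      have : Continuous fun s : ℂ => C * ‖s‖ := by fun_prop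
      simpa using (this.tendsto 0).mono_left nhdsWithin_le_nhds
    have h4 := le_of_tendsto_of_tendsto h2 h3 h1
    exact hu0 (norm_le_zero_iff.mp h4)
  have := hga.eqOn_zero_of_preconnected_of_eventuallyEq_zero
    (convex_ball (0 : ℂ) _).isPreconnected h0 hev
  have h1 : (1 : ℂ) ∈ Metric.ball (0 : ℂ) (R / ‖x‖) := by
    simp only [Metric.mem_ball, dist_zero_right, norm_one]
    rwa [lt_div_iff₀ hxpos, one_mul]
  simpa [hg] using this h1

end TaylorPolynomials
end SepVar

end

/-! ### Holomorphic one-forms, jets of dω and the first integral -/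

section

namespace SepVar

section Forms

variable {M N : ℕ}

/-- The coefficient `ω_l` in `ω = ∑ ω_l dx_l`. -/
def comp (ω : FormTuple M N) (l : Fin M) : (Fin M → ℂ) → (Fin N → ℂ) :=
  fun x => ω x ![Pi.single l 1]

/-- A `1`-form as a map into the space of linear maps. -/
def formCLM (ω : FormTuple M N) (x : Fin M → ℂ) : (Fin M → ℂ) →L[ℂ] (Fin N → ℂ) :=
  (ContinuousAlternatingMap.ofSubsingletonLIE (𝕜 := ℂ) (0 : Fin 1)).symm (ω x)

theorem formCLM_apply (ω : FormTuple M N) (x v : Fin M → ℂ) : formCLM ω x v = ω x ![v] := by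
  have h : ω x = ContinuousAlternatingMap.ofSubsingletonLIE (𝕜 := ℂ) (0 : Fin 1) (formCLM ω x) := by
    simp [formCLM]
  conv_rhs => rw [h]
  rfl

theorem differentiableAt_formCLM {ω : FormTuple M N} {x : Fin M → ℂ} (h : DifferentiableAt ℂ ω x) :
    DifferentiableAt ℂ (formCLM ω) x :=
  ((ContinuousAlternatingMap.ofSubsingletonLIE (𝕜 := ℂ) (E := Fin M → ℂ) (F := Fin N → ℂ)
    (0 : Fin 1)).symm.toContinuousLinearEquiv.differentiableAt (x := ω x)).comp x h

theorem clm_apply_eq_sum {F : Type*} [NormedAddCommGroup F] [NormedSpace ℂ F]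
    (D : (Fin M → ℂ) →L[ℂ] F) (v : Fin M → ℂ) : D v = ∑ l, v l • D (Pi.single l 1) := by
  conv_lhs => rw [pi_eq_sum_univ' v, map_sum]
  simp [map_smul]

theorem differentiableAt_comp {ω : FormTuple M N} {x : Fin M → ℂ} (h : DifferentiableAt ℂ ω x)
    (l : Fin M) : DifferentiableAt ℂ (comp ω l) x := by
  have : comp ω l = fun x => formCLM ω x (Pi.single l 1) := by
    funext y; rw [formCLM_apply]; rfl
  rw [this]
  exact (differentiableAt_formCLM h).clm_apply (differentiableAt_const _)

theorem extDeriv_single {ω : FormTuple M N} {x : Fin M → ℂ} (h : DifferentiableAt ℂ ω x)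
    (i j : Fin M) : extDeriv ω x ![Pi.single i 1, Pi.single j 1] =
      partialD i (comp ω j) x - partialD j (comp ω i) x := by
  rw [extDeriv_apply h, Fin.sum_univ_two]
  have e0 : (0 : Fin 2).removeNth (![Pi.single i 1, Pi.single j 1] : Fin 2 → Fin M → ℂ) =
      ![Pi.single j 1] := by
    ext a; fin_cases a; simp [Fin.removeNth]
  have e1 : (1 : Fin 2).removeNth (![Pi.single i 1, Pi.single j 1] : Fin 2 → Fin M → ℂ) =
      ![Pi.single i 1] := by
    ext a; fin_cases a; simp [Fin.removeNth, Fin.succAbove]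
  rw [e0, e1]
  simp [partialD, sub_eq_add_neg]
  rfl

/-- `ω` is holomorphic near the origin. -/
def FormHolNearZero (ω : FormTuple M N) : Prop := ∀ᶠ x in 𝓝 0, DifferentiableAt ℂ ω x

theorem formHolNearZero {U : Set (Fin M → ℂ)} {ω : FormTuple M N} (hU : IsOpen U)
    (h0 : (0 : Fin M → ℂ) ∈ U) (hω : DifferentiableOn ℂ ω U) : FormHolNearZero ω := by
  filter_upwards [hU.mem_nhds h0] with x hx
  exact hω.differentiableAt (hU.mem_nhds hx)

theorem FormHolNearZero.comp {ω : FormTuple M N} (h : FormHolNearZero ω) (l : Fin M) :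
    HolNearZero (comp ω l) := by
  filter_upwards [h] with x hx using differentiableAt_comp hx l

theorem HolNearZero.congr {f g : (Fin M → ℂ) → (Fin N → ℂ)} (hf : HolNearZero f)
    (h : f =ᶠ[𝓝 0] g) : HolNearZero g := by
  filter_upwards [hf, h.eventually_nhds] with x hx h'
  exact hx.congr_of_eventuallyEq (EventuallyEq.symm h')

theorem FormHolNearZero.extDeriv_eventuallyEq {ω : FormTuple M N} (h : FormHolNearZero ω)
    (i j : Fin M) : (fun x => partialD i (SepVar.comp ω j) x - partialD j (SepVar.comp ω i) x) =ᶠ[𝓝 0]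
      fun x => extDeriv ω x ![Pi.single i 1, Pi.single j 1] := by
  filter_upwards [h] with x hx
  exact (extDeriv_single hx i j).symm

theorem FormHolNearZero.extDeriv {ω : FormTuple M N} (h : FormHolNearZero ω) (i j : Fin M) :
    HolNearZero fun x => extDeriv ω x ![Pi.single i 1, Pi.single j 1] :=
  (((h.comp j).partialD i).sub ((h.comp i).partialD j)).congr (h.extDeriv_eventuallyEq i j)

theorem dCoeff_eq {ω : FormTuple M N} (h : FormHolNearZero ω) {n : ℕ}
    {p : Fin M → Fin N → MvPolynomial (Fin M) ℂ} (hp : ∀ l, HasTaylor (n + 1) (comp ω l) (p l))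
    (K : Fin M →₀ ℕ) (hK : K.degree < n) (i j : Fin M) (s : Fin N) :
    dCoeff ω K i j s =
      MvPolynomial.coeff (K + Finsupp.single i 1) (p j s) * (K i + 1) -
      MvPolynomial.coeff (K + Finsupp.single j 1) (p i s) * (K j + 1) := by
  have h1 : HasTaylor n (fun x => extDeriv ω x ![Pi.single i 1, Pi.single j 1])
      (fun s => MvPolynomial.pderiv i (p j s) - MvPolynomial.pderiv j (p i s)) := by
    have h2 := ((hp j).partialD (h.comp j) i).sub ((hp i).partialD (h.comp i) j)
    refine h2.congr' ?_ EventuallyEq.rfl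
    filter_upwards [h.extDeriv_eventuallyEq i j] with x hx
    rw [← hx]
    funext s
    simp [evalTuple]
    ring
  unfold dCoeff
  rw [taylorCoeff_eq (h.extDeriv i j) h1 K hK s, MvPolynomial.coeff_sub, MvPolynomial.coeff_pderiv,
    MvPolynomial.coeff_pderiv]

theorem jetSpan_jet_le (d : ℕ) (ω : FormTuple M N) : jetSpan (jet d ω) ≤ W ω := by
  refine Submodule.span_le.mpr ?_
  rintro _ ⟨K, i, j, rfl⟩
  simp only [jet, SetLike.mem_coe]
  split_ifs with h
  · exact Submodule.subset_span ⟨K, i, j, h.1, rfl⟩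
  · exact Submodule.zero_mem _

theorem dCoeff_mem_jetSpan {d : ℕ} {ω : FormTuple M N} {K : Fin M → ℕ} {i j : Fin M} (hij : i < j)
    (hK : ∑ l, K l ≤ d) : dCoeff ω K i j ∈ jetSpan (jet d ω) := by
  refine Submodule.subset_span ⟨K, i, j, ?_⟩
  simp only [jet]
  rw [if_pos ⟨hij, hK⟩]

theorem jetSpan_jet_mono (ω : FormTuple M N) : Monotone fun d => jetSpan (jet d ω) := by
  intro d d' hd
  refine Submodule.span_le.mpr ?_
  rintro _ ⟨K, i, j, rfl⟩
  simp only [jet, SetLike.mem_coe]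
  split_ifs with h
  · exact dCoeff_mem_jetSpan h.1 (h.2.trans hd)
  · exact Submodule.zero_mem _

/-- The spans increase with d in a finite-dimensional space, so they stabilize, and each coefficient
lies in one of them. -/
theorem exists_jetSpan_eq (ω : FormTuple M N) :
    ∃ d₀ : ℕ, ∀ d ≥ d₀, jetSpan (jet d ω) = W ω := by
  obtain ⟨d₀, h⟩ := monotone_stabilizes_iff_noetherian.mpr
    (inferInstance : IsNoetherian ℂ (Fin N → ℂ)) ⟨_, jetSpan_jet_mono ω⟩
  refine ⟨d₀, fun d hd => le_antisymm (jetSpan_jet_le d ω) (Submodule.span_le.mpr ?_)⟩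
  rintro _ ⟨K, i, j, hij, rfl⟩
  have h1 := h d hd
  have h2 := h (max d₀ (∑ l, K l)) (le_max_left _ _)
  simp only [OrderHom.coe_mk] at h1 h2
  rw [SetLike.mem_coe, ← h1, h2]
  exact dCoeff_mem_jetSpan hij (le_max_right _ _)

/-- T maps Taylor polynomials of f to Taylor polynomials of T ∘ f. Applied to dω, this shows that T
∘ dω has zero series when ker T = W. -/
theorem taylorCoeff_comp_linear {k : ℕ} {f : (Fin M → ℂ) → (Fin N → ℂ)} (hf : HolNearZero f)
    (T : (Fin N → ℂ) →ₗ[ℂ] (Fin k → ℂ)) (K : Fin M → ℕ) :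
    HolNearZero (fun x => T (f x)) ∧ taylorCoeff K (fun x => T (f x)) = T (taylorCoeff K f) := by
  set T' := LinearMap.toContinuousLinearMap T with hT'
  have hh : HolNearZero (fun x => T (f x)) := by
    filter_upwards [hf] with x hx
    exact T'.differentiableAt.comp x hx
  refine ⟨hh, ?_⟩
  set K' := Finsupp.equivFunOnFinite.symm K with hK'
  have hKK : (K' : Fin M → ℕ) = K := by simp [hK']
  obtain ⟨p, hp⟩ := hf.exists_hasTaylor (K'.degree + 1)
  set q : Fin k → MvPolynomial (Fin M) ℂ :=
    fun a => ∑ s, MvPolynomial.C (T (Pi.single s 1) a) * p s with hq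
  have hTv : ∀ v a, T v a = ∑ s, T (Pi.single s 1) a * v s := by
    intro v a
    have := clm_apply_eq_sum T' v
    have h2 := congrFun this a
    simp only [hT', LinearMap.coe_toContinuousLinearMap', Finset.sum_apply, Pi.smul_apply,
      smul_eq_mul] at h2
    rw [h2]
    exact Finset.sum_congr rfl fun s _ => mul_comm _ _
  have hq' : HasTaylor (K'.degree + 1) (fun x => T (f x)) q := by
    have h1 : (fun x => T' (f x - evalTuple p x)) =O[𝓝 0] fun x => ‖x‖ ^ (K'.degree + 1) :=
      (T'.isBigO_comp _ _).trans hp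
    refine h1.congr_left fun x => ?_
    rw [map_sub]
    congr 1
    funext a
    simp only [hT', LinearMap.coe_toContinuousLinearMap', evalTuple, hq, map_sum, map_mul,
      MvPolynomial.eval_C]
    exact hTv _ _
  funext a
  have e1 := taylorCoeff_eq hh hq' K' (Nat.lt_succ_self _) a
  have e2 := fun s => taylorCoeff_eq hf hp K' (Nat.lt_succ_self _) s
  rw [hKK] at e1
  simp only [hKK] at e2
  rw [e1, hTv]
  simp only [hq, MvPolynomial.coeff_sum, MvPolynomial.coeff_C_mul]
  exact Finset.sum_congr rfl fun s _ => by rw [e2]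

theorem exists_surjective_ker_eq (P : Submodule ℂ (Fin N → ℂ)) :
    ∃ (κ : ℕ) (T : (Fin N → ℂ) →ₗ[ℂ] (Fin κ → ℂ)), Function.Surjective T ∧ LinearMap.ker T = P := by
  refine ⟨Module.finrank ℂ ((Fin N → ℂ) ⧸ P),
    (Module.finBasis ℂ ((Fin N → ℂ) ⧸ P)).equivFun.toLinearMap ∘ₗ P.mkQ, ?_, ?_⟩
  · exact (Module.finBasis ℂ ((Fin N → ℂ) ⧸ P)).equivFun.surjective.comp P.mkQ_surjective
  · ext x; simp

/-- The first integral `H_𝒟` exists. -/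
theorem exists_isFirstIntegralData {U : Set (Fin M → ℂ)} {ω : FormTuple M N} (hU : IsOpen U)
    (h0 : (0 : Fin M → ℂ) ∈ U) (hω : DifferentiableOn ℂ ω U) :
    ∃ (κ : ℕ) (V : Set (Fin M → ℂ)) (T : (Fin N → ℂ) →ₗ[ℂ] (Fin κ → ℂ))
      (g : (Fin M → ℂ) → (Fin κ → ℂ)), IsFirstIntegralData U ω V T g := by
  obtain ⟨κ, T, hT, hker⟩ := exists_surjective_ker_eq (W ω)
  have hhol := formHolNearZero hU h0 hω
  set T' := LinearMap.toContinuousLinearMap T with hT'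
  -- T ∘ ω is closed near the origin: the Taylor coefficients of T ∘ dω vanish since ker T = W, and
  -- the identity theorem applies.
  have hclosed : ∀ i j, i < j → ∀ᶠ x in 𝓝 (0 : Fin M → ℂ),
      T' (extDeriv ω x ![Pi.single i 1, Pi.single j 1]) = 0 := by
    intro i j hij
    have h1 := fun K => taylorCoeff_comp_linear (hhol.extDeriv i j) T K
    refine (h1 0).1.eventually_eq_zero fun K => ?_
    rw [(h1 K).2, ← LinearMap.mem_ker, hker]
    exact Submodule.subset_span ⟨K, i, j, hij, rfl⟩
  have hall : ∀ᶠ x in 𝓝 (0 : Fin M → ℂ), x ∈ U ∧ ∀ i j, i < j →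
      T' (extDeriv ω x ![Pi.single i 1, Pi.single j 1]) = 0 := by
    refine Eventually.and (hU.mem_nhds h0) (eventually_all.mpr fun i => eventually_all.mpr fun j => ?_)
    by_cases hij : i < j
    · filter_upwards [hclosed i j hij] with x hx _ using hx
    · exact Eventually.of_forall fun x h => absurd h hij
  obtain ⟨r, hr, hr'⟩ := Metric.eventually_nhds_iff.mp hall
  set η : (Fin M → ℂ) → (Fin M → ℂ) →L[ℂ] (Fin κ → ℂ) := fun x => T'.comp (formCLM ω x) with hη
  have hd : ∀ x ∈ Metric.ball (0 : Fin M → ℂ) r, DifferentiableAt ℂ ω x := fun x hx =>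
    hω.differentiableAt (hU.mem_nhds (hr' hx).1)
  have hηd : ∀ x ∈ Metric.ball (0 : Fin M → ℂ) r, DifferentiableAt ℂ η x := fun x hx =>
    (differentiableAt_const T').clm_comp (differentiableAt_formCLM (hd x hx))
  have hfd : ∀ x ∈ Metric.ball (0 : Fin M → ℂ) r, ∀ u v, fderiv ℂ η x u v =
      T' (fderiv ℂ (formCLM ω) x u v) := by
    intro x hx u v
    have := (((ContinuousLinearMap.compL ℂ (Fin M → ℂ) (Fin N → ℂ) (Fin κ → ℂ)) T').hasFDerivAt.comp x
      (differentiableAt_formCLM (hd x hx)).hasFDerivAt).fderiv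
    have h2 : fderiv ℂ η x = _ := this
    rw [h2]
    rfl
  have hpd : ∀ x ∈ Metric.ball (0 : Fin M → ℂ) r, ∀ i j,
      fderiv ℂ (formCLM ω) x (Pi.single i 1) (Pi.single j 1) = partialD i (comp ω j) x := by
    intro x hx i j
    have h1 : comp ω j = fun x => formCLM ω x (Pi.single j 1) := by
      funext y; rw [formCLM_apply]; rfl
    rw [partialD, h1]
    have h2 := (differentiableAt_formCLM (hd x hx)).hasFDerivAt.clm_apply
      (hasFDerivAt_const (Pi.single j 1 : Fin M → ℂ) x)
    rw [h2.fderiv]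
    simp
  have hlt : ∀ x ∈ Metric.ball (0 : Fin M → ℂ) r, ∀ i j, i < j →
      fderiv ℂ η x (Pi.single i 1) (Pi.single j 1) = fderiv ℂ η x (Pi.single j 1) (Pi.single i 1) := by
    intro x hx i j hij
    have := (hr' hx).2 i j hij
    rw [extDeriv_single (hd x hx), map_sub, sub_eq_zero] at this
    rw [hfd x hx, hfd x hx, hpd x hx, hpd x hx, this]
  have hsymm : ∀ x ∈ Metric.ball (0 : Fin M → ℂ) r, ∀ u v,
      fderiv ℂ η x u v = fderiv ℂ η x v u := by
    intro x hx u v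
    have key : ∀ i j, fderiv ℂ η x (Pi.single i 1) (Pi.single j 1) =
        fderiv ℂ η x (Pi.single j 1) (Pi.single i 1) := by
      intro i j
      rcases lt_trichotomy i j with h | h | h
      · exact hlt x hx i j h
      · rw [h]
      · exact (hlt x hx j i h).symm
    rw [clm_apply_eq_sum (fderiv ℂ η x) u, clm_apply_eq_sum (fderiv ℂ η x) v]
    simp only [FunLike.coe_sum, FunLike.coe_smul, Finset.sum_apply, Pi.smul_apply]
    have e1 : ∀ i, fderiv ℂ η x (Pi.single i 1) v =
        ∑ j, v j • fderiv ℂ η x (Pi.single i 1) (Pi.single j 1) := fun i => clm_apply_eq_sum _ v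
    have e2 : ∀ i, fderiv ℂ η x (Pi.single i 1) u =
        ∑ j, u j • fderiv ℂ η x (Pi.single i 1) (Pi.single j 1) := fun i => clm_apply_eq_sum _ u
    simp only [e1, e2, Finset.smul_sum]
    rw [Finset.sum_comm]
    refine Finset.sum_congr rfl fun i _ => Finset.sum_congr rfl fun j _ => ?_
    rw [key j i, smul_comm]
  -- Poincaré lemma on a ball.
  obtain ⟨g, hg⟩ := (convex_ball (0 : Fin M → ℂ) r).exists_forall_hasFDerivAt_of_fderiv_symmetric
    Metric.isOpen_ball (fun x hx => ((hηd x hx).restrictScalars ℝ).differentiableWithinAt)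
    (fun x hx u v => by
      have h1 := ((hηd x hx).hasFDerivAt.restrictScalars ℝ).fderiv
      rw [h1]
      exact hsymm x hx u v)
  refine ⟨κ, Metric.ball 0 r, T, fun x => g x - g 0, Metric.isOpen_ball, Metric.mem_ball_self hr,
    fun x hx => (hr' hx).1, hT, hker, by simp, fun x hx => ?_, fun x hx v => ?_⟩
  · exact ((hg x hx).differentiableAt.sub_const _).differentiableWithinAt
  · rw [((hg x hx).sub_const (g 0)).fderiv, ← formCLM_apply]
    rfl

end Forms
end SepVar

end

/-! ### The vector field in the coordinates (u, y) and the lifts of paths -/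

section

namespace SepVar

/-- Residue data: pairwise different points `c j` of the affine line with residues `lam j`, the
`j`-th of which belongs to the coordinate `blk j`. -/
structure Arrangement (m : ℕ) (ι : Type) where
  /-- the points -/
  c : ι → ℂ
  /-- the residues -/
  lam : ι → ℂ
  /-- the coordinates in which the points are ramified -/
  blk : ι → Fin (m + 1)

/-- The point of `ℂ^(m+2)` with coordinates `y` and last coordinate `u * y 0`. -/
def pt {m : ℕ} (u : ℂ) (y : Fin (m + 1) → ℂ) : Fin (m + 2) → ℂ :=
  Fin.snoc (α := fun _ => ℂ) y (u * y 0)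

@[simp] theorem pt_castSucc {m : ℕ} (u : ℂ) (y : Fin (m + 1) → ℂ) (i : Fin (m + 1)) :
    pt u y i.castSucc = y i := by simp [pt]

@[simp] theorem pt_zero {m : ℕ} (u : ℂ) (y : Fin (m + 1) → ℂ) : pt u y 0 = y 0 :=
  pt_castSucc u y 0

@[simp] theorem pt_last {m : ℕ} (u : ℂ) (y : Fin (m + 1) → ℂ) :
    pt u y (Fin.last (m + 1)) = u * y 0 := by simp [pt]

theorem continuous_pt {m : ℕ} : Continuous fun q : ℂ × (Fin (m + 1) → ℂ) => pt q.1 q.2 := by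
  refine continuous_pi fun l => ?_
  refine Fin.lastCases ?_ (fun i => ?_) l
  · simp only [pt_last]; fun_prop
  · simp only [pt_castSucc]; fun_prop

theorem norm_pt_le {m : ℕ} (u : ℂ) (y : Fin (m + 1) → ℂ) : ‖pt u y‖ ≤ (1 + ‖u‖) * ‖y‖ := by
  refine (pi_norm_le_iff_of_nonneg (by positivity)).mpr fun l => ?_
  refine Fin.lastCases ?_ (fun i => ?_) l
  · rw [pt_last, norm_mul]
    have := norm_le_pi_norm y 0
    nlinarith [norm_nonneg u, norm_nonneg y]
  · rw [pt_castSucc]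
    have := norm_le_pi_norm y i
    nlinarith [norm_nonneg u, norm_nonneg y, mul_nonneg (norm_nonneg u) (norm_nonneg y)]

theorem norm_le_norm_pt {m : ℕ} (u : ℂ) (y : Fin (m + 1) → ℂ) : ‖y‖ ≤ ‖pt u y‖ := by
  refine (pi_norm_le_iff_of_nonneg (norm_nonneg _)).mpr fun i => ?_
  rw [← pt_castSucc u y i]
  exact norm_le_pi_norm _ _

/-- A continuously differentiable path in the complement of the points `c`. -/
structure UPath {ι : Type} (c : ι → ℂ) where
  /-- the path -/
  u : ℝ → ℂ
  /-- its velocity -/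
  u' : ℝ → ℂ
  continuous_u' : Continuous u'
  hasDerivAt : ∀ t, HasDerivAt u (u' t) t
  avoid : ∀ t j, u t ≠ c j

theorem UPath.continuous_u {ι : Type} {c : ι → ℂ} (γ : UPath c) : Continuous γ.u :=
  continuous_iff_continuousAt.mpr fun t => (γ.hasDerivAt t).continuousAt

namespace Arrangement

variable {m N : ℕ} {ι : Type} [Fintype ι] [DecidableEq ι] (D : Arrangement m ι)

/-- The linear form that defines the `j`-th hyperplane. -/
def L (j : ι) (x : Fin (m + 2) → ℂ) : ℂ := x (Fin.last (m + 1)) - D.c j * x 0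

/-- The logarithmic derivative of the `i`-th coordinate along the leaves, with respect to `u`. -/
def rate (i : Fin (m + 1)) (u : ℂ) : ℂ :=
  ∑ j ∈ Finset.univ.filter (fun j => D.blk j = i), D.lam j / (u - D.c j)

/-- The cofactor of the `i`-th coordinate in the vector field. -/
def cofactor (i : Fin (m + 1)) (x : Fin (m + 2) → ℂ) : ℂ :=
  ∑ j ∈ Finset.univ.filter (fun j => D.blk j = i), D.lam j * ∏ k ∈ Finset.univ.erase j, D.L k x

/-- The homogeneous vector field on `ℂ^(m+2)`. -/
def field (x : Fin (m + 2) → ℂ) : Fin (m + 2) → ℂ :=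
  Fin.snoc (α := fun _ => ℂ) (fun i : Fin (m + 1) => x i.castSucc * D.cofactor i x)
    (∏ j, D.L j x + x (Fin.last (m + 1)) * D.cofactor 0 x)

/-- The union of the invariant hyperplanes. -/
def S : Set (Fin (m + 2) → ℂ) :=
  {x | (∃ i : Fin (m + 1), x i.castSucc = 0) ∨ ∃ j, D.L j x = 0}

@[simp] theorem field_castSucc (x : Fin (m + 2) → ℂ) (i : Fin (m + 1)) :
    D.field x i.castSucc = x i.castSucc * D.cofactor i x := by simp [field]

@[simp] theorem field_last (x : Fin (m + 2) → ℂ) :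
    D.field x (Fin.last (m + 1)) = ∏ j, D.L j x + x (Fin.last (m + 1)) * D.cofactor 0 x := by
  simp [field]

@[simp] theorem field_zero (x : Fin (m + 2) → ℂ) : D.field x 0 = x 0 * D.cofactor 0 x :=
  D.field_castSucc x 0

theorem L_pt (j : ι) (u : ℂ) (y : Fin (m + 1) → ℂ) : D.L j (pt u y) = (u - D.c j) * y 0 := by
  simp [L]; ring

theorem pt_notMem_S {u : ℂ} {y : Fin (m + 1) → ℂ} (hy : ∀ i, y i ≠ 0) (hu : ∀ j, u ≠ D.c j) :
    pt u y ∉ D.S := by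
  rintro (⟨i, hi⟩ | ⟨j, hj⟩)
  · exact hy i (by simpa using hi)
  · rw [L_pt] at hj
    exact (mul_ne_zero (sub_ne_zero.mpr (hu j)) (hy 0)) hj

theorem exists_eq_pt {x : Fin (m + 2) → ℂ} (hx : x ∉ D.S) :
    ∃ (u : ℂ) (y : Fin (m + 1) → ℂ), (∀ i, y i ≠ 0) ∧ (∀ j, u ≠ D.c j) ∧ x = pt u y := by
  have h1 : ∀ i : Fin (m + 1), x i.castSucc ≠ 0 := fun i hi => hx (Or.inl ⟨i, hi⟩)
  have h0 : x 0 ≠ 0 := h1 0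
  refine ⟨x (Fin.last (m + 1)) / x 0, fun i => x i.castSucc, h1, fun j hj => ?_, ?_⟩
  · refine hx (Or.inr ⟨j, ?_⟩)
    rw [L, ← hj, div_mul_cancel₀ _ h0, sub_self]
  · funext l
    refine Fin.lastCases ?_ (fun i => ?_) l
    · rw [pt_last, Fin.castSucc_zero, div_mul_cancel₀ _ h0]
    · rw [pt_castSucc]

theorem continuous_L (j : ι) : Continuous (D.L j) := by
  unfold L; fun_prop

theorem isClosed_S : IsClosed D.S := by
  have : D.S = (⋃ i : Fin (m + 1), {x | x i.castSucc = 0}) ∪ ⋃ j, {x | D.L j x = 0} := by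
    ext x; simp [S]
  rw [this]
  refine (isClosed_iUnion_of_finite fun i => ?_).union (isClosed_iUnion_of_finite fun j => ?_)
  · exact isClosed_eq (continuous_apply _) continuous_const
  · exact isClosed_eq (D.continuous_L j) continuous_const

section Curves

variable (γ : UPath D.c)

theorem continuous_rate_comp {P : Type*} [TopologicalSpace P] {f : P → ℂ} (hf : Continuous f)
    (h : ∀ p j, f p ≠ D.c j) (i : Fin (m + 1)) : Continuous fun p => D.rate i (f p) := by
  unfold rate
  refine continuous_finsetSum _ fun j _ => ?_
  exact continuous_const.div (hf.sub continuous_const) fun p => sub_ne_zero.mpr (h p j)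

/-- The logarithm of the `i`-th coordinate along a lifted path. -/
def logCoord (i : Fin (m + 1)) (t : ℝ) : ℂ := ∫ s in (0 : ℝ)..t, D.rate i (γ.u s) * γ.u' s

/-- The multipliers along a lifted path. -/
def mult (t : ℝ) : Fin (m + 1) → ℂ := fun i => Complex.exp (D.logCoord γ i t)

/-- The lift of a path with initial coordinates `y`. -/
def curve (y : Fin (m + 1) → ℂ) (t : ℝ) : Fin (m + 2) → ℂ := pt (γ.u t) (D.mult γ t * y)

/-- The velocity of the lift. -/
def curve' (y : Fin (m + 1) → ℂ) (t : ℝ) : Fin (m + 2) → ℂ :=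
  Fin.snoc (α := fun _ => ℂ) (fun i => D.rate i (γ.u t) * γ.u' t * (D.mult γ t i * y i))
    (γ.u' t * (D.mult γ t 0 * y 0) + γ.u t * (D.rate 0 (γ.u t) * γ.u' t * (D.mult γ t 0 * y 0)))

variable (η : (Fin (m + 2) → ℂ) → (Fin (m + 2) → ℂ) →L[ℂ] (Fin N → ℂ))

/-- The increment of `z` along a lift. -/
def shift (y : Fin (m + 1) → ℂ) (t : ℝ) : Fin N → ℂ :=
  ∫ s in (0 : ℝ)..t, η (D.curve γ y s) (D.curve' γ y s)

@[simp] theorem logCoord_zero (i : Fin (m + 1)) : D.logCoord γ i 0 = 0 := by simp [logCoord]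

@[simp] theorem mult_zero : D.mult γ 0 = 1 := by funext i; simp [mult]

theorem curve_zero (y : Fin (m + 1) → ℂ) : D.curve γ y 0 = pt (γ.u 0) y := by simp [curve]

@[simp] theorem shift_zero (y : Fin (m + 1) → ℂ) : D.shift γ η y 0 = 0 := by simp [shift]

theorem mult_ne_zero (t : ℝ) (i : Fin (m + 1)) : D.mult γ t i ≠ 0 := Complex.exp_ne_zero _

section Families

variable {P : Type*} [TopologicalSpace P] {Γ : P → UPath D.c}
  (hu : Continuous fun q : P × ℝ => (Γ q.1).u q.2) (hu' : Continuous fun q : P × ℝ => (Γ q.1).u' q.2)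

include hu hu'

/-- Joint continuity in a parameter and in time allows whole families of lifts to be perturbed at
once, as in `eventually_exists_mem_leaf`. -/
theorem continuous_logCoord (i : Fin (m + 1)) :
    Continuous fun q : P × ℝ => D.logCoord (Γ q.1) i q.2 :=
  intervalIntegral.continuous_parametric_primitive_of_continuous
    (f := fun p s => D.rate i ((Γ p).u s) * (Γ p).u' s)
    ((D.continuous_rate_comp hu (fun q j => (Γ q.1).avoid q.2 j) i).mul hu')

theorem continuous_mult : Continuous fun q : P × ℝ => D.mult (Γ q.1) q.2 :=
  continuous_pi fun i => (D.continuous_logCoord hu hu' i).cexp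

theorem continuous_curve :
    Continuous fun q : (P × (Fin (m + 1) → ℂ)) × ℝ => D.curve (Γ q.1.1) q.1.2 q.2 := by
  have hq : Continuous fun q : (P × (Fin (m + 1) → ℂ)) × ℝ => (q.1.1, q.2) := by fun_prop
  exact continuous_pt.comp ((hu.comp hq).prodMk
    (((D.continuous_mult hu hu').comp hq).mul (by fun_prop)))

theorem continuous_curve' :
    Continuous fun q : (P × (Fin (m + 1) → ℂ)) × ℝ => D.curve' (Γ q.1.1) q.1.2 q.2 := by
  have hq : Continuous fun q : (P × (Fin (m + 1) → ℂ)) × ℝ => (q.1.1, q.2) := by fun_prop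
  have h1 := hu.comp hq
  have h2 := hu'.comp hq
  have h3 := fun i => (D.continuous_rate_comp hu (fun q j => (Γ q.1).avoid q.2 j) i).comp hq
  have h4 : ∀ i, Continuous fun q : (P × (Fin (m + 1) → ℂ)) × ℝ =>
      D.mult (Γ q.1.1) q.2 i * q.1.2 i := fun i =>
    ((continuous_apply i).comp ((D.continuous_mult hu hu').comp hq)).mul (by fun_prop)
  refine continuous_pi fun l => ?_
  refine Fin.lastCases ?_ (fun i => ?_) l
  · simp only [curve', Fin.snoc_last]
    exact (h2.mul (h4 0)).add (h1.mul (((h3 0).mul h2).mul (h4 0)))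
  · simp only [curve', Fin.snoc_castSucc]
    exact ((h3 i).mul h2).mul (h4 i)

theorem continuous_shift (hη : Continuous η) :
    Continuous fun q : (P × (Fin (m + 1) → ℂ)) × ℝ => D.shift (Γ q.1.1) η q.1.2 q.2 :=
  intervalIntegral.continuous_parametric_primitive_of_continuous
    (f := fun (p : P × (Fin (m + 1) → ℂ)) s => η (D.curve (Γ p.1) p.2 s) (D.curve' (Γ p.1) p.2 s))
    ((hη.comp (D.continuous_curve hu hu')).clm_apply (D.continuous_curve' hu hu'))

end Families

theorem continuous_rate_path (i : Fin (m + 1)) : Continuous fun t => D.rate i (γ.u t) :=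
  D.continuous_rate_comp γ.continuous_u γ.avoid i

theorem hasDerivAt_logCoord (i : Fin (m + 1)) (t : ℝ) :
    HasDerivAt (D.logCoord γ i) (D.rate i (γ.u t) * γ.u' t) t := by
  have hc := (D.continuous_rate_path γ i).mul γ.continuous_u'
  exact intervalIntegral.integral_hasDerivAt_right (hc.intervalIntegrable _ _)
    (hc.stronglyMeasurableAtFilter _ _) hc.continuousAt

theorem hasDerivAt_mult (i : Fin (m + 1)) (t : ℝ) :
    HasDerivAt (fun t => D.mult γ t i) (D.rate i (γ.u t) * γ.u' t * D.mult γ t i) t := by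
  refine (D.hasDerivAt_logCoord γ i t).cexp.congr_deriv ?_
  rw [mul_comm]
  rfl

theorem hasDerivAt_curve (y : Fin (m + 1) → ℂ) (t : ℝ) :
    HasDerivAt (D.curve γ y) (D.curve' γ y t) t := by
  have h1 : ∀ i, HasDerivAt (fun t => D.mult γ t i * y i)
      (D.rate i (γ.u t) * γ.u' t * (D.mult γ t i * y i)) t := fun i =>
    ((D.hasDerivAt_mult γ i t).mul_const (y i)).congr_deriv (by ring)
  rw [hasDerivAt_pi]
  intro l
  refine Fin.lastCases ?_ (fun i => ?_) l
  · simp only [curve, curve', pt_last, Fin.snoc_last]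
    exact (γ.hasDerivAt t).mul (h1 0)
  · simp only [curve, curve', pt_castSucc, Fin.snoc_castSucc]
    exact h1 i

/-- This identity ties the polynomial field to the rational rates: in the coordinates (u, y) the
field is ∏ L_j / y_0 times ∂_u + ∑ rate_i y_i ∂_(y_i). -/
theorem cofactor_eq {u : ℂ} {y : Fin (m + 1) → ℂ} (hy : y 0 ≠ 0) (hu : ∀ j, u ≠ D.c j)
    (i : Fin (m + 1)) : D.cofactor i (pt u y) = D.rate i u / y 0 * ∏ j, D.L j (pt u y) := by
  rw [cofactor, rate, Finset.sum_div, Finset.sum_mul]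
  refine Finset.sum_congr rfl fun j _ => ?_
  rw [← Finset.mul_prod_erase _ _ (Finset.mem_univ j), L_pt]
  have := sub_ne_zero.mpr (hu j)
  field_simp

theorem curve_notMem_S {y : Fin (m + 1) → ℂ} (hy : ∀ i, y i ≠ 0) (t : ℝ) : D.curve γ y t ∉ D.S :=
  D.pt_notMem_S (fun i => mul_ne_zero (D.mult_ne_zero γ t i) (hy i)) (γ.avoid t)

/-- The speed of a lift with respect to the vector field. -/
def speed (y : Fin (m + 1) → ℂ) (t : ℝ) : ℂ :=
  γ.u' t * D.curve γ y t 0 / ∏ j, D.L j (D.curve γ y t)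

theorem prod_L_ne_zero {x : Fin (m + 2) → ℂ} (hx : x ∉ D.S) : ∏ j, D.L j x ≠ 0 :=
  Finset.prod_ne_zero_iff.mpr fun j _ hj => hx (Or.inr ⟨j, hj⟩)

/-- The lift has the logarithmic derivatives prescribed by the rates, so it is tangent to the field;
`speed` compensates the factor ∏ L_j / x_0. -/
theorem curve'_eq {y : Fin (m + 1) → ℂ} (hy : ∀ i, y i ≠ 0) (t : ℝ) :
    D.curve' γ y t = D.speed γ y t • D.field (D.curve γ y t) := by
  have hS := D.prod_L_ne_zero (D.curve_notMem_S γ hy t)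
  have h0 : D.mult γ t 0 * y 0 ≠ 0 := mul_ne_zero (D.mult_ne_zero γ t 0) (hy 0)
  have hcof := fun i => D.cofactor_eq (u := γ.u t) (y := D.mult γ t * y) h0 (γ.avoid t) i
  funext l
  refine Fin.lastCases ?_ (fun i => ?_) l
  · simp only [curve', Fin.snoc_last, Pi.smul_apply, field_last, smul_eq_mul]
    simp only [speed, curve, pt_zero, pt_last] at hS ⊢
    rw [hcof 0]
    simp only [Pi.mul_apply] at *
    have hm := left_ne_zero_of_mul h0
    have hy0 := right_ne_zero_of_mul h0
    field_simp
  · simp only [curve', Fin.snoc_castSucc, Pi.smul_apply, field_castSucc, smul_eq_mul]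
    simp only [speed, curve, pt_zero, pt_castSucc] at hS ⊢
    rw [hcof i]
    simp only [Pi.mul_apply] at *
    have hm := left_ne_zero_of_mul h0
    have hy0 := right_ne_zero_of_mul h0
    field_simp

theorem continuous_curve_path (y : Fin (m + 1) → ℂ) : Continuous (D.curve γ y) :=
  continuous_iff_continuousAt.mpr fun t => (D.hasDerivAt_curve γ y t).continuousAt

theorem continuous_speed {y : Fin (m + 1) → ℂ} (hy : ∀ i, y i ≠ 0) : Continuous (D.speed γ y) := by
  have hc := D.continuous_curve_path γ y
  refine (γ.continuous_u'.mul ((continuous_apply _).comp hc)).div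
    (continuous_finsetProd _ fun j _ => (D.continuous_L j).comp hc) fun t => ?_
  exact D.prod_L_ne_zero (D.curve_notMem_S γ hy t)

/-- The lift of the vector field by the form `η`. -/
def lift (p : (Fin (m + 2) → ℂ) × (Fin N → ℂ)) : (Fin (m + 2) → ℂ) × (Fin N → ℂ) :=
  (D.field p.1, η p.1 (D.field p.1))

theorem continuous_curve'_path (y : Fin (m + 1) → ℂ) : Continuous (D.curve' γ y) := by
  have h0 := γ.continuous_u
  have h1 := γ.continuous_u'
  have h2 := D.continuous_rate_path γ
  have h3 : ∀ i, Continuous fun t => D.mult γ t i := fun i =>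
    continuous_iff_continuousAt.mpr fun t => (D.hasDerivAt_mult γ i t).continuousAt
  refine continuous_pi fun l => ?_
  refine Fin.lastCases ?_ (fun i => ?_) l
  · simp only [curve', Fin.snoc_last]
    fun_prop
  · simp only [curve', Fin.snoc_castSucc]
    fun_prop

variable {η}

theorem hasDerivAt_shift (hη : Continuous η) (y : Fin (m + 1) → ℂ) (t : ℝ) :
    HasDerivAt (D.shift γ η y) (η (D.curve γ y t) (D.curve' γ y t)) t := by
  have hc := (hη.comp (D.continuous_curve_path γ y)).clm_apply (D.continuous_curve'_path γ y)
  exact intervalIntegral.integral_hasDerivAt_right (hc.intervalIntegrable _ _)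
    (hc.stronglyMeasurableAtFilter _ _) hc.continuousAt

theorem hasDerivAt_lift (hη : Continuous η) {y : Fin (m + 1) → ℂ} (hy : ∀ i, y i ≠ 0)
    (z : Fin N → ℂ) (t : ℝ) :
    HasDerivAt (fun t => (D.curve γ y t, z + D.shift γ η y t))
      (D.speed γ y t • D.lift η (D.curve γ y t, z + D.shift γ η y t)) t := by
  have h := (D.hasDerivAt_curve γ y t).prodMk ((D.hasDerivAt_shift γ hη y t).const_add z)
  refine h.congr_deriv ?_
  rw [curve'_eq D γ hy]
  simp [lift, Prod.smul_mk]

theorem mem_leaf_lift (hη : Continuous η) {y : Fin (m + 1) → ℂ} (hy : ∀ i, y i ≠ 0)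
    (z : Fin N → ℂ) {Ω : Set ((Fin (m + 2) → ℂ) × (Fin N → ℂ))}
    (hΩ : ∀ t ∈ Icc (0 : ℝ) 1, (D.curve γ y t, z + D.shift γ η y t) ∈ Ω) :
    (pt (γ.u 1) (D.mult γ 1 * y), z + D.shift γ η y 1) ∈ leaf (D.lift η) Ω (pt (γ.u 0) y, z) := by
  have := mem_leaf_of_curve (D.continuous_speed γ hy) (D.hasDerivAt_lift γ hη hy z) hΩ
  simp only [curve_zero, shift_zero, add_zero] at this
  exact this

end Curves

end Arrangement
end SepVar

end

/-! ### Walks with small steps, and excursions of controlled size -/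

section

namespace SepVar

/-- Walking along the straight segment from `0` to a real combination of small vectors in steps that
add or subtract one of these vectors. -/
theorem exists_walk {V : Type*} [NormedAddCommGroup V] [NormedSpace ℝ V] (s : Finset V) (t : V → ℝ)
    {ε : ℝ} (hs : ∀ v ∈ s, ‖v‖ ≤ ε) (Q : V → Prop) (h0 : Q 0)
    (hstep : ∀ ζ, Q ζ → ‖ζ‖ ≤ ‖∑ v ∈ s, t v • v‖ + 2 * s.card * ε →
      ∀ v ∈ s, Q (ζ + v) ∧ Q (ζ - v)) :
    ∃ ζ, Q ζ ∧ ‖ζ - ∑ v ∈ s, t v • v‖ ≤ s.card * ε := by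
  classical
  obtain ⟨L, hL0, hL⟩ : ∃ L : ℕ, 0 < L ∧ ∀ v ∈ s, |t v| ≤ L := by
    obtain ⟨L, hL⟩ := exists_nat_ge (∑ v ∈ s, |t v|)
    refine ⟨L + 1, Nat.succ_pos L, fun v hv => ?_⟩
    have := Finset.single_le_sum (f := fun v => |t v|) (fun _ _ => abs_nonneg _) hv
    push_cast
    linarith
  have hLr : (0 : ℝ) < L := by exact_mod_cast hL0
  set x : V → ℝ := fun v => t v / L with hx
  have hx1 : ∀ v ∈ s, |x v| ≤ 1 := fun v hv => by
    rw [hx, abs_div, abs_of_pos hLr]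
    exact (div_le_one hLr).mpr (hL v hv)
  have hclose : ∀ (n : V → ℤ) (y C : ℝ), (∀ v ∈ s, |(n v : ℝ) - y * t v| ≤ C) →
      ‖∑ v ∈ s, (n v : ℝ) • v - y • ∑ v ∈ s, t v • v‖ ≤ C * s.card * ε := by
    intro n y C hn
    rw [Finset.smul_sum, ← Finset.sum_sub_distrib]
    refine (norm_sum_le_of_le s (f := fun v => (n v : ℝ) • v - y • t v • v)
      (n := fun _ => C * ε) fun v hv => ?_).trans (le_of_eq ?_)
    · rw [smul_smul, ← sub_smul, norm_smul, Real.norm_eq_abs]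
      exact mul_le_mul (hn v hv) (hs v hv) (norm_nonneg _) ((abs_nonneg _).trans (hn v hv))
    · simp; ring
  have main : ∀ k : ℕ, k ≤ L → Q (∑ v ∈ s, ((⌊(k : ℝ) * x v⌋ : ℤ) : ℝ) • v) := by
    intro k
    induction k with
    | zero => intro _; simpa using h0
    | succ k ih =>
      intro hk
      have hkL : (k : ℝ) / L ≤ 1 := (div_le_one hLr).mpr (by exact_mod_cast (Nat.le_of_succ_le hk))
      have hk0 : (0 : ℝ) ≤ k / L := by positivity
      -- Within one unit of time the floors are updated one vector at a time; F contains the vectors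
      -- already treated.
      have hQ : ∀ F : Finset V, F ⊆ s → Q (∑ v ∈ s,
          (((if v ∈ F then ⌊((k + 1 : ℕ) : ℝ) * x v⌋ else ⌊(k : ℝ) * x v⌋) : ℤ) : ℝ) • v) := by
        intro F
        induction F using Finset.induction_on with
        | empty => intro _; simpa using ih (Nat.le_of_succ_le hk)
        | insert v F hvF ihF =>
          intro hins
          have hv : v ∈ s := hins (Finset.mem_insert_self v F)
          have hF' := ihF fun w hw => hins (Finset.mem_insert_of_mem hw)
          set n : V → ℤ := fun w => if w ∈ F then ⌊((k + 1 : ℕ) : ℝ) * x w⌋ else ⌊(k : ℝ) * x w⌋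
            with hn
          set n' : V → ℤ := fun w => if w ∈ insert v F then ⌊((k + 1 : ℕ) : ℝ) * x w⌋ else
            ⌊(k : ℝ) * x w⌋ with hn'
          have hF : Q (∑ w ∈ s, (n w : ℝ) • w) := hF'
          -- Coefficients deviate from those of the segment by at most 2: one for the floor, one for
          -- the update in progress.
          have hbd : ‖∑ w ∈ s, (n w : ℝ) • w‖ ≤ ‖∑ v ∈ s, t v • v‖ + 2 * s.card * ε := by
            have h1 := hclose n (k / L) 2 fun w hw => by
              have e1 : (k : ℝ) / L * t w = k * x w := by simp only [hx]; ring
              rw [e1]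
              have hxw := abs_le.mp (hx1 w hw)
              simp only [hn]
              split_ifs
              · have := Int.floor_le (((k + 1 : ℕ) : ℝ) * x w)
                have := Int.lt_floor_add_one (((k + 1 : ℕ) : ℝ) * x w)
                push_cast at *
                rw [abs_le]; constructor <;> linarith
              · have := Int.floor_le ((k : ℝ) * x w)
                have := Int.lt_floor_add_one ((k : ℝ) * x w)
                rw [abs_le]; constructor <;> linarith
            have h2 : ‖((k : ℝ) / L) • ∑ v ∈ s, t v • v‖ ≤ ‖∑ v ∈ s, t v • v‖ := by
              rw [norm_smul, Real.norm_of_nonneg hk0]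
              exact mul_le_of_le_one_left (norm_nonneg _) hkL
            have h3 := norm_sub_norm_le (∑ w ∈ s, (n w : ℝ) • w) (((k : ℝ) / L) • ∑ v ∈ s, t v • v)
            linarith
          obtain ⟨hst1, hst2⟩ : Q (∑ w ∈ s, (n w : ℝ) • w + v) ∧ Q (∑ w ∈ s, (n w : ℝ) • w - v) :=
            hstep _ hF hbd v hv
          have hdiff : ∑ w ∈ s, (n' w : ℝ) • w = ∑ w ∈ s, (n w : ℝ) • w +
              ((⌊((k + 1 : ℕ) : ℝ) * x v⌋ : ℝ) - (⌊(k : ℝ) * x v⌋ : ℝ)) • v := by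
            rw [← Finset.add_sum_erase s _ hv, ← Finset.add_sum_erase s (fun w => (n w : ℝ) • w) hv]
            have h1 : ∑ w ∈ s.erase v, (n' w : ℝ) • w = ∑ w ∈ s.erase v, (n w : ℝ) • w := by
              refine Finset.sum_congr rfl fun w hw => ?_
              have : w ≠ v := Finset.ne_of_mem_erase hw
              simp [hn, hn', this]
            rw [h1]
            simp only [hn, hn', Finset.mem_insert_self, if_true, hvF, if_false]
            rw [sub_smul]
            abel
          rw [hdiff]
          have hxv := abs_le.mp (hx1 v hv)
          have hfl : ⌊((k + 1 : ℕ) : ℝ) * x v⌋ - ⌊(k : ℝ) * x v⌋ ≤ 1 ∧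
              -1 ≤ ⌊((k + 1 : ℕ) : ℝ) * x v⌋ - ⌊(k : ℝ) * x v⌋ := by
            have h1 := Int.floor_le (((k + 1 : ℕ) : ℝ) * x v)
            have h2 := Int.lt_floor_add_one (((k + 1 : ℕ) : ℝ) * x v)
            have h3 := Int.floor_le ((k : ℝ) * x v)
            have h4 := Int.lt_floor_add_one ((k : ℝ) * x v)
            push_cast at h1 h2
            constructor
            · have : ((⌊((k + 1 : ℕ) : ℝ) * x v⌋ - ⌊(k : ℝ) * x v⌋ : ℤ) : ℝ) < 2 := by
                push_cast; linarith
              have : ⌊((k + 1 : ℕ) : ℝ) * x v⌋ - ⌊(k : ℝ) * x v⌋ < 2 := by exact_mod_cast this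
              omega
            · have : (-2 : ℝ) < ((⌊((k + 1 : ℕ) : ℝ) * x v⌋ - ⌊(k : ℝ) * x v⌋ : ℤ) : ℝ) := by
                push_cast; linarith
              have : -2 < ⌊((k + 1 : ℕ) : ℝ) * x v⌋ - ⌊(k : ℝ) * x v⌋ := by exact_mod_cast this
              omega
          have hcases : ⌊((k + 1 : ℕ) : ℝ) * x v⌋ - ⌊(k : ℝ) * x v⌋ = 1 ∨
              ⌊((k + 1 : ℕ) : ℝ) * x v⌋ - ⌊(k : ℝ) * x v⌋ = 0 ∨
              ⌊((k + 1 : ℕ) : ℝ) * x v⌋ - ⌊(k : ℝ) * x v⌋ = -1 := by omega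
          rw [← Int.cast_sub]
          rcases hcases with h | h | h <;> rw [h]
          · rwa [Int.cast_one, one_smul]
          · rwa [Int.cast_zero, zero_smul, add_zero]
          · rwa [Int.cast_neg, Int.cast_one, neg_one_smul, ← sub_eq_add_neg]
      have := hQ s subset_rfl
      refine (congrArg Q (Finset.sum_congr rfl fun v hv => ?_)).mp this
      simp [hv]
  refine ⟨_, main L le_rfl, ?_⟩
  have := hclose (fun v => ⌊(L : ℝ) * x v⌋) 1 1 fun v hv => by
    have e1 : (L : ℝ) * x v = t v := by simp only [hx]; field_simp
    rw [e1, one_mul]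
    have := Int.floor_le (t v)
    have := Int.lt_floor_add_one (t v)
    rw [abs_le]; constructor <;> linarith
  simpa using this

namespace Arrangement

variable {m N : ℕ} {ι : Type} [Fintype ι] [DecidableEq ι] (D : Arrangement m ι)
  (η : (Fin (m + 2) → ℂ) → (Fin (m + 2) → ℂ) →L[ℂ] (Fin N → ℂ))

/-- The points off the invariant hyperplanes with `‖x‖ < ρ` and `‖z - z₀‖ < ρ`. -/
def region (ρ : ℝ) (z₀ : Fin N → ℂ) : Set ((Fin (m + 2) → ℂ) × (Fin N → ℂ)) :=
  {w | w.1 ∉ D.S ∧ ‖w.1‖ < ρ ∧ ‖w.2 - z₀‖ < ρ}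

/-- `q` is reached from `p` along the leaf without leaving the region of size `ρ`. -/
def Reach (ρ : ℝ) (p q : (Fin (m + 2) → ℂ) × (Fin N → ℂ)) : Prop :=
  q ∈ leaf (D.lift η) (D.region ρ p.2) p

variable {D η}

theorem Reach.mono {ρ ρ' : ℝ} {p q : (Fin (m + 2) → ℂ) × (Fin N → ℂ)} (h : D.Reach η ρ p q)
    (hρ : ρ ≤ ρ') : D.Reach η ρ' p q :=
  leaf_mono (Ω' := D.region ρ' p.2) (fun _ hw => ⟨hw.1, hw.2.1.trans_le hρ, hw.2.2.trans_le hρ⟩) h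

theorem Reach.norm_lt {ρ : ℝ} {p q : (Fin (m + 2) → ℂ) × (Fin N → ℂ)} (h : D.Reach η ρ p q) :
    ‖q.2 - p.2‖ < ρ := (leaf_subset h).2.2

/-- The region of `Reach` is centred in z at the starting point, and moving the centre costs the
distance of the centres. Hence sizes add up in `Reach.trans` and double in `Reach.symm`. -/
theorem Reach.mem_leaf {ρ R : ℝ} {p q : (Fin (m + 2) → ℂ) × (Fin N → ℂ)} {z₀ : Fin N → ℂ}
    (h : D.Reach η ρ p q) (hR : ‖p.2 - z₀‖ + ρ ≤ R) : q ∈ leaf (D.lift η) (D.region R z₀) p := by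
  refine leaf_mono (Ω' := D.region R z₀) (fun w hw => ⟨hw.1, hw.2.1.trans_le ?_, ?_⟩) h
  · have := norm_add_le (w.2 - p.2) (p.2 - z₀)
    rw [sub_add_sub_cancel] at this
    linarith [hw.2.2]
  · linarith [norm_nonneg (p.2 - z₀)]

theorem Reach.trans {ρ ρ' : ℝ} {p q r : (Fin (m + 2) → ℂ) × (Fin N → ℂ)} (h : D.Reach η ρ p q)
    (h' : D.Reach η ρ' q r) : D.Reach η (ρ + ρ') p r := by
  have h0 : 0 < ρ' := (norm_nonneg _).trans_lt h'.norm_lt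
  refine leaf_trans (h.mono (by linarith)) (h'.mem_leaf ?_)
  linarith [h.norm_lt]

theorem Reach.symm {ρ : ℝ} {p q : (Fin (m + 2) → ℂ) × (Fin N → ℂ)} (h : D.Reach η ρ p q) :
    D.Reach η (2 * ρ) q p := by
  have h0 : 0 < ρ := (norm_nonneg _).trans_lt h.norm_lt
  refine leaf_mono (Ω' := D.region (2 * ρ) q.2) (fun w hw => ⟨hw.1, by linarith [hw.2.1], ?_⟩)
    (leaf_symm h)
  have := norm_sub_le (w.2 - p.2) (q.2 - p.2)
  rw [sub_sub_sub_cancel_right] at this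
  linarith [hw.2.2, h.norm_lt]

variable (D η)

/-- Points over `u` are moved to points over `u'`, with the coordinates `y` multiplied by `e` and
`z` translated by `b y`, inside a region of size `C * ‖y‖`. -/
structure Transport (u u' : ℂ) (e : Fin (m + 1) → ℂ) (C : ℝ)
    (b : (Fin (m + 1) → ℂ) → (Fin N → ℂ)) : Prop where
  one_le : 1 ≤ C
  ne_zero : ∀ i, e i ≠ 0
  norm_le : ‖e‖ ≤ C
  continuous : Continuous b
  norm_shift_le : ∀ y, ‖b y‖ ≤ C * ‖y‖
  reach : ∀ y : Fin (m + 1) → ℂ, (∀ i, y i ≠ 0) → ∀ z,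
    D.Reach η (C * ‖y‖) (pt u y, z) (pt u' (e * y), z + b y)

variable {D η}

theorem Transport.mono {u u' : ℂ} {e : Fin (m + 1) → ℂ} {C C' : ℝ}
    {b : (Fin (m + 1) → ℂ) → (Fin N → ℂ)} (h : D.Transport η u u' e C b) (hC : C ≤ C') :
    D.Transport η u u' e C' b where
  one_le := h.one_le.trans hC
  ne_zero := h.ne_zero
  norm_le := h.norm_le.trans hC
  continuous := h.continuous
  norm_shift_le y := (h.norm_shift_le y).trans (mul_le_mul_of_nonneg_right hC (norm_nonneg _))
  reach y hy z := (h.reach y hy z).mono (mul_le_mul_of_nonneg_right hC (norm_nonneg _))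

theorem norm_pos_of_forall_ne_zero {y : Fin (m + 1) → ℂ} (hy : ∀ i, y i ≠ 0) : 0 < ‖y‖ :=
  norm_pos_iff.mpr fun h => hy 0 (by simp [h])

/-- The factor 1 + ‖u‖ bounds `pt u y` in terms of y, and the additional 1 makes the bound strict.
-/
theorem Transport.refl {u : ℂ} (hu : ∀ j, u ≠ D.c j) : D.Transport η u u 1 (2 + ‖u‖) 0 where
  one_le := by linarith [norm_nonneg u]
  ne_zero := by simp
  norm_le := by simp; linarith [norm_nonneg u]
  continuous := continuous_zero
  norm_shift_le y := by simp; positivity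
  reach y hy z := by
    have h := norm_pos_of_forall_ne_zero hy
    have h1 := norm_pt_le u y
    simp only [one_mul, Pi.zero_apply, add_zero]
    refine mem_leaf_self ⟨D.pt_notMem_S hy hu, by simp only; nlinarith, ?_⟩
    simp only [sub_self, norm_zero]
    positivity

/-- The second excursion starts from e * y, whence the factor ‖e‖: after a contraction everything
becomes cheap. -/
theorem Transport.trans {u u' u'' : ℂ} {e e' : Fin (m + 1) → ℂ} {C C' : ℝ}
    {b b' : (Fin (m + 1) → ℂ) → (Fin N → ℂ)} (h : D.Transport η u u' e C b)
    (h' : D.Transport η u' u'' e' C' b') :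
    D.Transport η u u'' (e' * e) (C + C' * ‖e‖) (fun y => b y + b' (e * y)) where
  one_le := by
    have := mul_nonneg (zero_le_one.trans h'.one_le) (norm_nonneg e)
    linarith [h.one_le]
  ne_zero i := mul_ne_zero (h'.ne_zero i) (h.ne_zero i)
  norm_le := by
    have h1 := norm_mul_le e' e
    have h2 := mul_le_mul_of_nonneg_right h'.norm_le (norm_nonneg e)
    linarith [h.one_le]
  continuous := h.continuous.add (h'.continuous.comp (continuous_const.mul continuous_id))
  norm_shift_le y := by
    have h1 := h.norm_shift_le y
    have h2 := h'.norm_shift_le (e * y)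
    have h3 := mul_le_mul_of_nonneg_left (norm_mul_le e y) (zero_le_one.trans h'.one_le)
    have h4 := norm_add_le (b y) (b' (e * y))
    linarith
  reach y hy z := by
    have h1 := h.reach y hy z
    have h2 := h'.reach (e * y) (fun i => mul_ne_zero (h.ne_zero i) (hy i)) (z + b y)
    have h3 := mul_le_mul_of_nonneg_left (norm_mul_le e y) (zero_le_one.trans h'.one_le)
    have h4 := (h1.trans h2).mono (ρ' := (C + C' * ‖e‖) * ‖y‖) (by linarith)
    rwa [← mul_assoc, add_assoc] at h4

theorem inv_mul_cancel_of_ne_zero {e : Fin (m + 1) → ℂ} (he : ∀ i, e i ≠ 0)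
    (y : Fin (m + 1) → ℂ) : e * (e⁻¹ * y) = y := by
  funext i
  simp [he i]

theorem Transport.symm {u u' : ℂ} {e : Fin (m + 1) → ℂ} {C : ℝ}
    {b : (Fin (m + 1) → ℂ) → (Fin N → ℂ)} (h : D.Transport η u u' e C b) :
    D.Transport η u' u e⁻¹ (2 * C * ‖e⁻¹‖ + 1) (fun y => -b (e⁻¹ * y)) where
  one_le := by
    have := mul_nonneg (zero_le_one.trans h.one_le) (norm_nonneg e⁻¹)
    linarith
  ne_zero i := inv_ne_zero (h.ne_zero i)
  norm_le := by
    have := mul_le_mul_of_nonneg_right h.one_le (norm_nonneg e⁻¹)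
    linarith [norm_nonneg e⁻¹]
  continuous := (h.continuous.comp (continuous_const.mul continuous_id)).neg
  norm_shift_le y := by
    rw [norm_neg]
    have h1 := h.norm_shift_le (e⁻¹ * y)
    have h3 := mul_le_mul_of_nonneg_left (norm_mul_le e⁻¹ y) (zero_le_one.trans h.one_le)
    have h4 : 0 ≤ C * (‖e⁻¹‖ * ‖y‖) :=
      mul_nonneg (zero_le_one.trans h.one_le) (by positivity)
    linarith [norm_nonneg y]
  reach y hy z := by
    have h1 := h.reach (e⁻¹ * y) (fun i => mul_ne_zero (inv_ne_zero (h.ne_zero i)) (hy i))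
      (z - b (e⁻¹ * y))
    rw [inv_mul_cancel_of_ne_zero h.ne_zero, sub_add_cancel] at h1
    have h3 := mul_le_mul_of_nonneg_left (norm_mul_le e⁻¹ y) (zero_le_one.trans h.one_le)
    rw [← sub_eq_add_neg]
    exact h1.symm.mono (by linarith [norm_nonneg y])

end Arrangement
end SepVar

end

/-! ### Size of lifts, and the holonomy of the slice u = 0 -/

section

namespace SepVar
namespace Arrangement

variable {m N : ℕ} {ι : Type} [Fintype ι] [DecidableEq ι] (D : Arrangement m ι)
  {η : (Fin (m + 2) → ℂ) → (Fin (m + 2) → ℂ) →L[ℂ] (Fin N → ℂ)}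

/-- Bounds on a path that control its lifts. -/
structure PathBound (γ : UPath D.c) (K₁ K₂ K₃ : ℝ) : Prop where
  speed : ∀ t ∈ Icc (0 : ℝ) 1, ‖γ.u' t‖ ≤ K₁
  rate : ∀ t ∈ Icc (0 : ℝ) 1, ∀ i, ‖D.rate i (γ.u t)‖ ≤ K₂
  pos : ∀ t ∈ Icc (0 : ℝ) 1, ‖γ.u t‖ ≤ K₃

/-- The size of a lift in terms of bounds on the path. -/
def liftConst (K K₁ K₂ K₃ : ℝ) : ℝ :=
  (1 + K) * (Real.exp (K₂ * K₁) * (1 + K₃ + K₁ + K₂ * K₁ + K₃ * (K₂ * K₁))) + 1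

variable {D}

theorem exists_pathBound (γ : UPath D.c) :
    ∃ K₁ K₂ K₃ : ℝ, 0 ≤ K₁ ∧ 0 ≤ K₂ ∧ 0 ≤ K₃ ∧ D.PathBound γ K₁ K₂ K₃ := by
  obtain ⟨K₁, h1⟩ := isCompact_Icc.exists_bound_of_continuousOn
    (γ.continuous_u'.continuousOn (s := Icc (0 : ℝ) 1))
  obtain ⟨K₃, h3⟩ := isCompact_Icc.exists_bound_of_continuousOn
    (γ.continuous_u.continuousOn (s := Icc (0 : ℝ) 1))
  obtain ⟨K₂, h2⟩ := isCompact_Icc.exists_bound_of_continuousOn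
    ((continuous_pi (D.continuous_rate_path γ)).continuousOn (s := Icc (0 : ℝ) 1))
  have h0 : (0 : ℝ) ∈ Icc (0 : ℝ) 1 := by simp
  exact ⟨K₁, K₂, K₃, (norm_nonneg _).trans (h1 0 h0), (norm_nonneg _).trans (h2 0 h0),
    (norm_nonneg _).trans (h3 0 h0), h1, fun t ht i => (norm_le_pi_norm _ i).trans (h2 t ht), h3⟩

section Bounds

variable {γ : UPath D.c} {K K₁ K₂ K₃ : ℝ} (hb : D.PathBound γ K₁ K₂ K₃) (h1 : 0 ≤ K₁) (h2 : 0 ≤ K₂)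
  (h3 : 0 ≤ K₃)

include hb h1 h2

theorem PathBound.norm_mult_le {t : ℝ} (ht : t ∈ Icc (0 : ℝ) 1) :
    ‖D.mult γ t‖ ≤ Real.exp (K₂ * K₁) := by
  refine (pi_norm_le_iff_of_nonneg (Real.exp_pos _).le).mpr fun i => ?_
  refine (Complex.norm_exp_le_exp_norm _).trans (Real.exp_le_exp.mpr ?_)
  have := intervalIntegral.norm_integral_le_of_norm_le_const (a := 0) (b := t) (C := K₂ * K₁)
    (f := fun s => D.rate i (γ.u s) * γ.u' s) fun s hs => by
      rw [uIoc_of_le ht.1] at hs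
      have hs' : s ∈ Icc (0 : ℝ) 1 := ⟨hs.1.le, hs.2.trans ht.2⟩
      rw [norm_mul]
      exact mul_le_mul (hb.rate s hs' i) (hb.speed s hs') (norm_nonneg _) h2
  refine this.trans ?_
  rw [sub_zero, abs_of_nonneg ht.1]
  exact mul_le_of_le_one_right (mul_nonneg h2 h1) ht.2

include h3

theorem PathBound.norm_curve_le {t : ℝ} (ht : t ∈ Icc (0 : ℝ) 1) (y : Fin (m + 1) → ℂ) :
    ‖D.curve γ y t‖ ≤ Real.exp (K₂ * K₁) * (1 + K₃) * ‖y‖ := by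
  have e1 := norm_pt_le (γ.u t) (D.mult γ t * y)
  have e2 := norm_mul_le (D.mult γ t) y
  have e3 := mul_le_mul_of_nonneg_right (hb.norm_mult_le h1 h2 ht) (norm_nonneg y)
  have e4 := hb.pos t ht
  calc ‖D.curve γ y t‖ ≤ (1 + ‖γ.u t‖) * ‖D.mult γ t * y‖ := e1
    _ ≤ (1 + K₃) * (Real.exp (K₂ * K₁) * ‖y‖) :=
      mul_le_mul (by linarith) (e2.trans e3) (norm_nonneg _) (by linarith)
    _ = _ := by ring

theorem PathBound.norm_curve'_le {t : ℝ} (ht : t ∈ Icc (0 : ℝ) 1) (y : Fin (m + 1) → ℂ) :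
    ‖D.curve' γ y t‖ ≤ Real.exp (K₂ * K₁) * (K₁ + K₂ * K₁ + K₃ * (K₂ * K₁)) * ‖y‖ := by
  set E := Real.exp (K₂ * K₁) * ‖y‖ with hE
  have hE0 : 0 ≤ E := by positivity
  have e0 : ∀ i, ‖D.mult γ t i * y i‖ ≤ E := fun i => by
    rw [norm_mul]
    exact mul_le_mul ((norm_le_pi_norm _ i).trans (hb.norm_mult_le h1 h2 ht)) (norm_le_pi_norm y i)
      (norm_nonneg _) (Real.exp_pos _).le
  have e1 : ∀ i, ‖D.rate i (γ.u t) * γ.u' t * (D.mult γ t i * y i)‖ ≤ K₂ * K₁ * E := fun i => by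
    rw [norm_mul, norm_mul]
    exact mul_le_mul (mul_le_mul (hb.rate t ht i) (hb.speed t ht) (norm_nonneg _) h2) (e0 i)
      (norm_nonneg _) (mul_nonneg h2 h1)
  have e2 : ‖γ.u' t * (D.mult γ t 0 * y 0)‖ ≤ K₁ * E := by
    rw [norm_mul]
    exact mul_le_mul (hb.speed t ht) (e0 0) (norm_nonneg _) h1
  have e3 : ‖γ.u t * (D.rate 0 (γ.u t) * γ.u' t * (D.mult γ t 0 * y 0))‖ ≤ K₃ * (K₂ * K₁ * E) := by
    rw [norm_mul]
    exact mul_le_mul (hb.pos t ht) (e1 0) (norm_nonneg _) h3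
  have e4 : 0 ≤ K₁ * E := by positivity
  have e5 : 0 ≤ K₂ * K₁ * E := by positivity
  have e6 : 0 ≤ K₃ * (K₂ * K₁ * E) := by positivity
  have e7 : Real.exp (K₂ * K₁) * (K₁ + K₂ * K₁ + K₃ * (K₂ * K₁)) * ‖y‖ =
      K₁ * E + K₂ * K₁ * E + K₃ * (K₂ * K₁ * E) := by rw [hE]; ring
  rw [e7]
  refine (pi_norm_le_iff_of_nonneg (by positivity)).mpr fun l => ?_
  refine Fin.lastCases ?_ (fun i => ?_) l
  · simp only [curve', Fin.snoc_last]
    exact (norm_add_le _ _).trans (by linarith)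
  · simp only [curve', Fin.snoc_castSucc]
    linarith [e1 i]

variable (hη : Continuous η) (hK : ∀ x, ‖η x‖ ≤ K)

include hη hK

theorem PathBound.norm_shift_le {t : ℝ} (ht : t ∈ Icc (0 : ℝ) 1) (y : Fin (m + 1) → ℂ) :
    ‖D.shift γ η y t‖ ≤ K * (Real.exp (K₂ * K₁) * (K₁ + K₂ * K₁ + K₃ * (K₂ * K₁)) * ‖y‖) := by
  have hK0 : 0 ≤ K := (norm_nonneg _).trans (hK 0)
  have := intervalIntegral.norm_integral_le_of_norm_le_const (a := 0) (b := t)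
    (C := K * (Real.exp (K₂ * K₁) * (K₁ + K₂ * K₁ + K₃ * (K₂ * K₁)) * ‖y‖))
    (f := fun s => η (D.curve γ y s) (D.curve' γ y s)) fun s hs => by
      rw [uIoc_of_le ht.1] at hs
      have hs' : s ∈ Icc (0 : ℝ) 1 := ⟨hs.1.le, hs.2.trans ht.2⟩
      refine (ContinuousLinearMap.le_opNorm _ _).trans ?_
      exact mul_le_mul (hK _) (hb.norm_curve'_le h1 h2 h3 hs' y) (norm_nonneg _) hK0
  refine this.trans ?_
  rw [sub_zero, abs_of_nonneg ht.1]
  exact mul_le_of_le_one_right (by positivity) ht.2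

/-- Lifts are linear in y, so every bound is a multiple of ‖y‖. The constant depends on the path
only through K₁, K₂, K₃ and is thus uniform in families of paths. -/
theorem PathBound.transport :
    D.Transport η (γ.u 0) (γ.u 1) (D.mult γ 1) (liftConst K K₁ K₂ K₃)
      (fun y => D.shift γ η y 1) := by
  have hK0 : 0 ≤ K := (norm_nonneg _).trans (hK 0)
  set E := Real.exp (K₂ * K₁) with hE
  have hE0 : 0 < E := Real.exp_pos _
  have m1 : (1 : ℝ) ∈ Icc (0 : ℝ) 1 := by simp
  set Q := K₁ + K₂ * K₁ + K₃ * (K₂ * K₁) with hQ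
  have hQ0 : 0 ≤ Q := by positivity
  have hC : liftConst K K₁ K₂ K₃ = E * (1 + K₃) + K * (E * (1 + K₃)) + E * Q + K * (E * Q) + 1 := by
    simp only [liftConst, hQ, hE]; ring
  have p1 : 0 ≤ E * (1 + K₃) := by positivity
  have p2 : 0 ≤ K * (E * (1 + K₃)) := by positivity
  have p3 : 0 ≤ E * Q := by positivity
  have p4 : 0 ≤ K * (E * Q) := by positivity
  have c1 : ∀ y : Fin (m + 1) → ℂ, E * (1 + K₃) * ‖y‖ + ‖y‖ ≤ liftConst K K₁ K₂ K₃ * ‖y‖ := fun y => by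
    rw [hC]; nlinarith [norm_nonneg y]
  have c2 : ∀ y : Fin (m + 1) → ℂ, K * (E * Q * ‖y‖) + ‖y‖ ≤ liftConst K K₁ K₂ K₃ * ‖y‖ := fun y => by
    rw [hC]; nlinarith [norm_nonneg y]
  refine ⟨by linarith, D.mult_ne_zero γ 1, ?_, ?_, fun y => ?_, fun y hy z => ?_⟩
  · refine (hb.norm_mult_le h1 h2 m1).trans ?_
    rw [hC]; nlinarith
  · have h := D.continuous_shift (P := Unit) (Γ := fun _ => γ) η
      (γ.continuous_u.comp continuous_snd) (γ.continuous_u'.comp continuous_snd) hη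
    have h2 : Continuous fun y : Fin (m + 1) → ℂ =>
        (((((), y), 1) : (Unit × (Fin (m + 1) → ℂ)) × ℝ)) := by fun_prop
    exact Continuous.comp (g := fun q : (Unit × (Fin (m + 1) → ℂ)) × ℝ => D.shift γ η q.1.2 q.2) h h2
  · have := hb.norm_shift_le h1 h2 h3 hη hK m1 y
    linarith [c2 y, norm_nonneg y]
  · have hy0 := norm_pos_of_forall_ne_zero hy
    refine D.mem_leaf_lift γ hη hy z fun t ht => ⟨D.curve_notMem_S γ hy t, ?_, ?_⟩
    · have := hb.norm_curve_le h1 h2 h3 ht y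
      simp only
      linarith [c1 y]
    · have := hb.norm_shift_le h1 h2 h3 hη hK ht y
      simp only [add_sub_cancel_left]
      linarith [c2 y]

end Bounds

theorem exists_transport (γ : UPath D.c) (hη : Continuous η) {K : ℝ} (hK : ∀ x, ‖η x‖ ≤ K) :
    ∃ C, D.Transport η (γ.u 0) (γ.u 1) (D.mult γ 1) C (fun y => D.shift γ η y 1) := by
  obtain ⟨K₁, K₂, K₃, h1, h2, h3, hb⟩ := exists_pathBound γ
  exact ⟨_, hb.transport h1 h2 h3 hη hK⟩

variable (D η)

/-- The multipliers of the loops at the origin of the `u`-line. -/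
def Holonomy : Set (Fin (m + 1) → ℂ) := {e | ∃ C b, D.Transport η 0 0 e C b}

variable {D η}

theorem mul_mem_holonomy {e e' : Fin (m + 1) → ℂ} (h : e ∈ D.Holonomy η) (h' : e' ∈ D.Holonomy η) :
    e * e' ∈ D.Holonomy η := by
  obtain ⟨C, b, h⟩ := h
  obtain ⟨C', b', h'⟩ := h'
  exact ⟨_, _, h'.trans h⟩

theorem inv_mem_holonomy {e : Fin (m + 1) → ℂ} (h : e ∈ D.Holonomy η) : e⁻¹ ∈ D.Holonomy η := by
  obtain ⟨C, b, h⟩ := h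
  exact ⟨_, _, h.symm⟩

theorem one_mem_holonomy (h0 : ∀ j, (0 : ℂ) ≠ D.c j) : 1 ∈ D.Holonomy η :=
  ⟨_, _, Transport.refl h0⟩

section Density

/-- The powers of a contraction are realized with a uniform constant. -/
theorem exists_transport_pow (h0 : ∀ j, (0 : ℂ) ≠ D.c j) {a : Fin (m + 1) → ℂ} {C : ℝ}
    {b : (Fin (m + 1) → ℂ) → (Fin N → ℂ)} (h : D.Transport η 0 0 a C b) (ha : ‖a‖ ≤ 1 / 2) (k : ℕ) :
    ∃ b', D.Transport η 0 0 (a ^ k) (2 * C + 2) b' := by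
  induction k with
  | zero =>
    refine ⟨0, ?_⟩
    rw [pow_zero]
    refine (Transport.refl h0).mono ?_
    simp
    linarith [h.one_le]
  | succ k ih =>
    obtain ⟨b', hb'⟩ := ih
    refine ⟨fun y => b y + b' (a * y), ?_⟩
    rw [pow_succ]
    -- Geometric series: C + (2 C + 2) ‖a‖ ≤ 2 C + 1 because ‖a‖ ≤ 1 / 2, so the constant does not
    -- grow with k.
    refine (h.trans hb').mono ?_
    have h1 := h.one_le
    nlinarith

theorem norm_pow_le_half {a : Fin (m + 1) → ℂ} (ha : ‖a‖ ≤ 1 / 2) (k : ℕ) (y : Fin (m + 1) → ℂ) :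
    ‖a ^ k * y‖ ≤ (1 / 2) ^ k * ‖y‖ := by
  refine (norm_mul_le _ _).trans (mul_le_mul_of_nonneg_right ?_ (norm_nonneg _))
  exact (norm_pow_le a k).trans (pow_le_pow_left₀ (norm_nonneg _) ha k)

/-- Every holonomy multiplier is realized by an excursion that is bounded in terms of the end
points. -/
theorem exists_bounded_reach {a : Fin (m + 1) → ℂ} {C : ℝ} (ha : ‖a‖ ≤ 1 / 2)
    (hpow : ∀ k, ∃ b, D.Transport η 0 0 (a ^ k) C b) {e : Fin (m + 1) → ℂ} (he : e ∈ D.Holonomy η)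
    {y : Fin (m + 1) → ℂ} (hy : ∀ i, y i ≠ 0) :
    ∃ v, ∀ z, D.Reach η (2 * C * (‖y‖ + ‖e * y‖)) (pt 0 y, z) (pt 0 (e * y), z + v) := by
  obtain ⟨Ce, be, hE⟩ := he
  have hCe : 0 < Ce := zero_lt_one.trans_le hE.one_le
  -- The excursion for e may be expensive, but started at a^k y it costs at most ‖y‖ for large k. So
  -- the way goes in by a^k, around by e, and out by the inverse of a^k.
  obtain ⟨k, hk⟩ := exists_pow_lt_of_lt_one (show 0 < 1 / Ce by positivity)
    (show (1 / 2 : ℝ) < 1 by norm_num)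
  obtain ⟨b, hb⟩ := hpow k
  have hC := hb.one_le
  have hy1 : ∀ i, (a ^ k * y) i ≠ 0 := fun i => mul_ne_zero (hb.ne_zero i) (hy i)
  have hy2 : ∀ i, (e * y) i ≠ 0 := fun i => mul_ne_zero (hE.ne_zero i) (hy i)
  refine ⟨b y + be (a ^ k * y) - b (e * y), fun z => ?_⟩
  have r1 := hb.reach y hy z
  have r2 := hE.reach (a ^ k * y) hy1 (z + b y)
  have r3 := (hb.reach (e * y) hy2 (z + b y + be (a ^ k * y) - b (e * y))).symm
  rw [sub_add_cancel, mul_left_comm (a ^ k)] at r3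
  have r := (r1.trans r2).trans r3
  rw [show z + (b y + be (a ^ k * y) - b (e * y)) = z + b y + be (a ^ k * y) - b (e * y) by abel]
  refine r.mono ?_
  have h1 := norm_pow_le_half ha k y
  have h2 : Ce * ‖a ^ k * y‖ ≤ ‖y‖ := by
    have h3 : Ce * (1 / 2) ^ k ≤ 1 := by
      rw [lt_div_iff₀ hCe] at hk
      linarith
    calc Ce * ‖a ^ k * y‖ ≤ Ce * ((1 / 2) ^ k * ‖y‖) := by gcongr
      _ = Ce * (1 / 2) ^ k * ‖y‖ := by ring
      _ ≤ 1 * ‖y‖ := by gcongr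
      _ = ‖y‖ := one_mul _
  nlinarith [norm_nonneg y, norm_nonneg (e * y)]

/-- Translations of `z` by the conjugates of a loop with trivial multiplier. -/
theorem reach_conj_shift {a : Fin (m + 1) → ℂ} {C C' : ℝ} (ha : ‖a‖ ≤ 1 / 2)
    (hpow : ∀ k, ∃ b, D.Transport η 0 0 (a ^ k) C b) {c : (Fin (m + 1) → ℂ) → (Fin N → ℂ)}
    (hc : D.Transport η 0 0 1 C' c) {e : Fin (m + 1) → ℂ} (he : e ∈ D.Holonomy η) (he1 : ‖e‖ ≤ 1)
    {y : Fin (m + 1) → ℂ} (hy : ∀ i, y i ≠ 0) (z : Fin N → ℂ) :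
    D.Reach η (2 * (12 * C + C') * ‖y‖) (pt 0 y, z) (pt 0 y, z + c (e * y)) ∧
    D.Reach η (2 * (12 * C + C') * ‖y‖) (pt 0 y, z) (pt 0 y, z - c (e * y)) := by
  obtain ⟨v, hv⟩ := exists_bounded_reach ha hpow he hy
  obtain ⟨Ce, be, hE⟩ := he
  have hy2 : ∀ i, (e * y) i ≠ 0 := fun i => mul_ne_zero (hE.ne_zero i) (hy i)
  obtain ⟨b, hb⟩ := hpow 0
  have hC := hb.one_le
  have hC' := hc.one_le
  have hey : ‖e * y‖ ≤ ‖y‖ := (norm_mul_le e y).trans (mul_le_of_le_one_left (norm_nonneg _) he1)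
  -- Over to e y, around the loop with multiplier 1, and back. The way over costs 4 C ‖y‖, the loop
  -- C' ‖y‖, the way back twice 4 C ‖y‖.
  have key : ∀ z, D.Reach η ((12 * C + C') * ‖y‖) (pt 0 y, z) (pt 0 y, z + c (e * y)) := by
    intro z
    have r2 := hc.reach (e * y) hy2 (z + v)
    rw [one_mul] at r2
    have r3 := (hv (z + c (e * y))).symm
    rw [show z + c (e * y) + v = z + v + c (e * y) by abel] at r3
    refine (((hv z).trans r2).trans r3).mono ?_
    nlinarith [norm_nonneg y, norm_nonneg (e * y), mul_nonneg (zero_le_one.trans hC) (norm_nonneg y),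
      mul_le_mul_of_nonneg_left hey (zero_le_one.trans hC),
      mul_le_mul_of_nonneg_left hey (zero_le_one.trans hC')]
  refine ⟨(key z).mono ?_, ?_⟩
  · have : 0 ≤ (12 * C + C') * ‖y‖ := by positivity
    linarith
  · have := (key (z - c (e * y))).symm
    rw [sub_add_cancel] at this
    exact this.mono (by linarith)

end Density

end Arrangement
end SepVar

end

/-! ### Density of the leaves on the slice u = 0 -/

section

namespace SepVar
namespace Arrangement

variable {m N : ℕ} {ι : Type} [Fintype ι] [DecidableEq ι] {D : Arrangement m ι}
  {η : (Fin (m + 2) → ℂ) → (Fin (m + 2) → ℂ) →L[ℂ] (Fin N → ℂ)}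

theorem norm_pt_zero_sub (y y' : Fin (m + 1) → ℂ) : ‖pt 0 y - pt 0 y'‖ ≤ ‖y - y'‖ := by
  refine (pi_norm_le_iff_of_nonneg (norm_nonneg _)).mpr fun l => ?_
  refine Fin.lastCases ?_ (fun i => ?_) l
  · simp
  · simpa using norm_le_pi_norm (y - y') i

theorem norm_pt_zero_le (y : Fin (m + 1) → ℂ) : ‖pt 0 y‖ ≤ ‖y‖ := by
  simpa using norm_pt_le 0 y

/-- The holonomy multipliers move a point of the slice close to any other one. -/
theorem exists_mul_close {G : Set (Fin (m + 1) → ℂ)}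
    (hG : ∀ v : Fin (m + 1) → ℂ, (∀ i, v i ≠ 0) → ∀ ε > 0, ∃ e ∈ G, ‖e - v‖ < ε)
    {y y' : Fin (m + 1) → ℂ} (hy : ∀ i, y i ≠ 0) (hy' : ∀ i, y' i ≠ 0) {ε : ℝ} (hε : 0 < ε) :
    ∃ e ∈ G, ‖e * y - y'‖ < ε := by
  have hpos := norm_pos_of_forall_ne_zero hy
  obtain ⟨e, he, h⟩ := hG (fun i => y' i / y i) (fun i => div_ne_zero (hy' i) (hy i)) (ε / ‖y‖)
    (by positivity)
  refine ⟨e, he, ?_⟩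
  have : e * y - y' = (e - fun i => y' i / y i) * y := by
    funext i
    simp only [Pi.sub_apply, Pi.mul_apply]
    rw [sub_mul, div_mul_cancel₀ _ (hy i)]
  rw [this]
  refine (norm_mul_le _ _).trans_lt ?_
  rwa [← lt_div_iff₀ hpos]

/-- A vector of a real span is a real combination of few spanning vectors. -/
theorem exists_finset_sum_eq {V : Type*} [NormedAddCommGroup V] [NormedSpace ℝ V]
    [FiniteDimensional ℝ V] {A : Set V} {w : V} (hw : w ∈ Submodule.span ℝ A) :
    ∃ (s : Finset V) (t : V → ℝ), (s : Set V) ⊆ A ∧ s.card ≤ Module.finrank ℝ V ∧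
      ∑ v ∈ s, t v • v = w := by
  obtain ⟨b, hbA, hspan, hli⟩ := exists_linearIndependent ℝ A
  have hfin : b.Finite := hli.setFinite
  obtain ⟨s, rfl⟩ := hfin.exists_finset_coe
  rw [← hspan] at hw
  obtain ⟨t, -, ht⟩ := Submodule.mem_span_finset.mp hw
  refine ⟨s, t, hbA, ?_, ht⟩
  have := hli.fintype_card_le_finrank
  simpa using this

/-- The leaves through the slice `u = 0` are dense in the levels of the first integral on the
slice. -/
theorem exists_slice_subset_closure {a : Fin (m + 1) → ℂ} {C C' : ℝ} (ha : ‖a‖ ≤ 1 / 2)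
    (hpow : ∀ k, ∃ b, D.Transport η 0 0 (a ^ k) C b)
    (hG : ∀ v : Fin (m + 1) → ℂ, (∀ i, v i ≠ 0) → ∀ ε > 0, ∃ e ∈ D.Holonomy η, ‖e - v‖ < ε)
    {J : Type*} {c : J → (Fin (m + 1) → ℂ) → (Fin N → ℂ)}
    (hc : ∀ σ, D.Transport η 0 0 1 C' (c σ)) (hC'0 : 0 ≤ C') {W : Submodule ℂ (Fin N → ℂ)}
    (hspan : ∃ r > 0, ∀ y : Fin (m + 1) → ℂ, (∀ i, y i ≠ 0) → ‖y‖ < r → (W : Set (Fin N → ℂ)) ⊆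
      Submodule.span ℝ {v | ∃ σ, ∃ e ∈ D.Holonomy η, ‖e‖ ≤ 1 ∧ v = c σ (e * y)})
    {κ : ℕ} {T : (Fin N → ℂ) →ₗ[ℂ] (Fin κ → ℂ)} (hT : Function.Surjective T)
    (hker : LinearMap.ker T = W) {g : (Fin (m + 2) → ℂ) → (Fin κ → ℂ)} (hg : ContinuousAt g 0)
    {R : ℝ} (hR : 0 < R)
    (hH : ∀ p q, q ∈ leaf (D.lift η) (D.region R 0) p →
      firstIntegral T g q = firstIntegral T g p) :
    ∃ ε > 0, ∀ y₁ y₂ : Fin (m + 1) → ℂ, (∀ i, y₁ i ≠ 0) → (∀ i, y₂ i ≠ 0) → ‖y₁‖ < ε → ‖y₂‖ < ε →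
      ∀ z₁ z₂ : Fin N → ℂ, ‖z₁‖ < ε → ‖z₂‖ < ε →
      firstIntegral T g (pt 0 y₂, z₂) = firstIntegral T g (pt 0 y₁, z₁) →
      (pt 0 y₂, z₂) ∈ closure (leaf (D.lift η) (D.region R 0) (pt 0 y₁, z₁)) := by
  have hC : 1 ≤ C := (hpow 0).choose_spec.one_le
  obtain ⟨r, hr, hspan⟩ := hspan
  -- A linear section of T splits a displacement in z into a part in W and a part controlled by its
  -- image under T.
  obtain ⟨s', hs'⟩ := LinearMap.exists_rightInverse_of_surjective T (LinearMap.range_eq_top.mpr hT)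
  set s := LinearMap.toContinuousLinearMap s' with hs
  have hsT : ∀ τ, T (s τ) = τ := fun τ => LinearMap.congr_fun hs' τ
  obtain ⟨n, hn⟩ : ∃ n : ℝ, n = (Module.finrank ℝ (Fin N → ℂ) : ℕ) := ⟨_, rfl⟩
  have hn0 : 0 ≤ n := by rw [hn]; positivity
  -- All excursions below have size at most a fixed multiple of C ε; 40 leaves enough room for their
  -- sum inside R.
  set ε := R / (40 * C) with hε
  have hε0 : 0 < ε := by positivity
  have hRε : R = 40 * (C * ε) := by rw [hε]; field_simp
  have hεC : ε ≤ C * ε := le_mul_of_one_le_left hε0.le hC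
  refine ⟨ε, hε0, fun y₁ y₂ hy₁ hy₂ hn₁ hn₂ z₁ z₂ hz₁ hz₂ hHH => ?_⟩
  rw [Metric.mem_closure_iff]
  intro δ₀ hδ₀
  obtain ⟨δ, hδ, hδδ₀, hδε⟩ : ∃ δ > 0, δ ≤ δ₀ ∧ δ ≤ ε := ⟨min δ₀ ε, by positivity, min_le_left _ _,
    min_le_right _ _⟩
  -- the values of `T` that are small enough
  obtain ⟨τ₀, hτ₀, hτ⟩ : ∃ τ₀ > 0, ∀ τ, ‖τ‖ < τ₀ → ‖s τ‖ < δ / 4 := by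
    have := s.continuous.tendsto 0
    rw [map_zero, Metric.tendsto_nhds_nhds] at this
    obtain ⟨τ₀, h1, h2⟩ := this (δ / 4) (by positivity)
    exact ⟨τ₀, h1, fun τ h => by simpa using h2 (by simpa using h)⟩
  obtain ⟨ρ, hρ, hgρ⟩ : ∃ ρ > 0, ∀ x, ‖x‖ < ρ → ‖g x - g 0‖ < τ₀ / 4 := by
    rw [Metric.continuousAt_iff] at hg
    obtain ⟨ρ, h1, h2⟩ := hg (τ₀ / 4) (by positivity)
    exact ⟨ρ, h1, fun x h => by simpa [dist_eq_norm] using h2 (by simpa using h)⟩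
  -- the number of contractions
  set q := 2 * n * C' + 2 * (12 * C + C') + 1 with hq
  have hq1 : 1 ≤ q := by rw [hq]; nlinarith [mul_nonneg hn0 hC'0]
  -- After k contractions g is nearly constant, `hspan` applies, and the walk has small steps; q
  -- collects the constants of the walk.
  obtain ⟨k, hk⟩ : ∃ k : ℕ, (1 / 2 : ℝ) ^ k * ε < min (min ρ r) (δ / (4 * q)) := by
    obtain ⟨k, hk⟩ := exists_pow_lt_of_lt_one
      (show 0 < min (min ρ r) (δ / (4 * q)) / ε by positivity) (show (1 / 2 : ℝ) < 1 by norm_num)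
    exact ⟨k, by rwa [lt_div_iff₀ hε0] at hk⟩
  have hkρ := hk.trans_le ((min_le_left _ _).trans (min_le_left _ _))
  have hkr := hk.trans_le ((min_le_left _ _).trans (min_le_right _ _))
  have hkδ := hk.trans_le (min_le_right _ _)
  obtain ⟨b, hb⟩ := hpow k
  have hsmall : ∀ y : Fin (m + 1) → ℂ, ‖y‖ < ε → ‖a ^ k * y‖ ≤ (1 / 2) ^ k * ε := fun y hy =>
    (norm_pow_le_half ha k y).trans (mul_le_mul_of_nonneg_left hy.le (by positivity))
  -- the holonomy
  set Tc := LinearMap.toContinuousLinearMap T with hTc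
  obtain ⟨ξ, hξ, hbξ⟩ : ∃ ξ > 0, ∀ y, ‖y - y₂‖ < ξ → ‖T (b y - b y₂)‖ < τ₀ / 4 := by
    have h1 : ContinuousAt (fun y => Tc (b y)) y₂ := (Tc.continuous.comp hb.continuous).continuousAt
    rw [Metric.continuousAt_iff] at h1
    obtain ⟨ξ, h1, h2⟩ := h1 (τ₀ / 4) (by positivity)
    refine ⟨ξ, h1, fun y h => ?_⟩
    have := h2 (by simpa [dist_eq_norm] using h)
    rw [dist_eq_norm, ← map_sub] at this
    exact this
  -- The holonomy brings y₁ close to y₂. The translation of z that comes with it is corrected below.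
  obtain ⟨e, he, hclose⟩ := exists_mul_close hG hy₁ hy₂
    (show 0 < min (min ξ (δ / 2)) (ε - ‖y₂‖) from
      lt_min (lt_min hξ (by positivity)) (sub_pos.mpr hn₂))
  have hcξ := hclose.trans_le ((min_le_left _ _).trans (min_le_left _ _))
  have hcδ := hclose.trans_le ((min_le_left _ _).trans (min_le_right _ _))
  have hcε : ‖e * y₁‖ < ε := by
    have := hclose.trans_le (min_le_right _ _)
    have h2 := norm_sub_norm_le (e * y₁) y₂
    linarith
  have he0 : ∀ i, e i ≠ 0 := he.choose_spec.choose_spec.ne_zero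
  have hye : ∀ i, (e * y₁) i ≠ 0 := fun i => mul_ne_zero (he0 i) (hy₁ i)
  set x₁ := a ^ k * y₁ with hx₁
  have hx₁0 : ∀ i, x₁ i ≠ 0 := fun i => mul_ne_zero (hb.ne_zero i) (hy₁ i)
  have hx₁e : e * x₁ = a ^ k * (e * y₁) := by rw [hx₁, mul_left_comm]
  set y := a ^ k * (e * y₁) with hyd
  have hy0 : ∀ i, y i ≠ 0 := fun i => mul_ne_zero (hb.ne_zero i) (hye i)
  have hyk : ‖y‖ ≤ (1 / 2) ^ k * ε := hsmall _ hcε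
  have hyq : q * ‖y‖ ≤ δ / 4 := by
    have h := (hyk.trans_lt hkδ).le
    rw [le_div_iff₀ (by positivity)] at h
    linarith
  have hy1 : ‖y‖ ≤ ε := by
    have := norm_nonneg y
    nlinarith
  have hx₁ε : ‖x₁‖ ≤ ε := by
    refine (hsmall y₁ hn₁).trans ?_
    have : (1 / 2 : ℝ) ^ k ≤ 1 := pow_le_one₀ (by norm_num) (by norm_num)
    nlinarith
  obtain ⟨v, hv⟩ := exists_bounded_reach ha hpow he hx₁0
  rw [hx₁e] at hv
  set zc := z₁ + b y₁ + v with hzc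
  have C0 : 0 < C := by linarith
  have m1 : C * ‖y₁‖ ≤ C * ε := mul_le_mul_of_nonneg_left hn₁.le C0.le
  have m2 : C * ‖y₂‖ ≤ C * ε := mul_le_mul_of_nonneg_left hn₂.le C0.le
  have m3 : C * ‖e * y₁‖ ≤ C * ε := mul_le_mul_of_nonneg_left hcε.le C0.le
  have m4 : 2 * C * (‖x₁‖ + ‖y‖) ≤ 4 * (C * ε) := by
    have := mul_le_mul_of_nonneg_left (add_le_add hx₁ε hy1) C0.le
    linarith
  have reach1 : D.Reach η (5 * (C * ε)) (pt 0 y₁, z₁) (pt 0 y, zc) :=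
    ((hb.reach y₁ hy₁ z₁).trans (hv (z₁ + b y₁))).mono (by linarith)
  have hleaf1 : (pt 0 y, zc) ∈ leaf (D.lift η) (D.region R 0) (pt 0 y₁, z₁) :=
    reach1.mem_leaf (by rw [sub_zero]; simp only; linarith)
  have hzcn : ‖zc‖ < 6 * (C * ε) := by
    have := reach1.norm_lt
    simp only at this
    have h2 := norm_sub_norm_le zc z₁
    linarith
  have hleaf2 : (pt 0 (a ^ k * y₂), z₂ + b y₂) ∈ leaf (D.lift η) (D.region R 0) (pt 0 y₂, z₂) :=
    (hb.reach y₂ hy₂ z₂).mem_leaf (by rw [sub_zero]; simp only; linarith)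
  have H1 := hH _ _ hleaf1
  have H2 := hH _ _ hleaf2
  -- The displacement still missing in z is almost in W: the first integral takes the same value on
  -- both leaves, and g and b vary little between the points involved.
  have hTz : ‖T (z₂ + b (e * y₁) - zc)‖ < τ₀ := by
    have e1 : T (z₂ + b (e * y₁) - zc) = (g (pt 0 (a ^ k * y₂)) - g 0) - (g (pt 0 y) - g 0) +
        T (b (e * y₁) - b y₂) := by
      have h3 := (H2.trans hHH).trans H1.symm
      simp only [firstIntegral, map_add] at h3
      simp only [map_add, map_sub]
      have h4 : T z₂ = T zc - g (pt 0 y) - T (b y₂) + g (pt 0 (a ^ k * y₂)) := by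
        rw [← h3]; abel
      rw [h4]
      abel
    rw [e1]
    have n1 := hgρ (pt 0 (a ^ k * y₂))
      ((norm_pt_zero_le _).trans_lt ((hsmall _ hn₂).trans_lt hkρ))
    have n2 := hgρ (pt 0 y) ((norm_pt_zero_le _).trans_lt (hyk.trans_lt hkρ))
    have n3 := hbξ _ hcξ
    have n4 := norm_add_le (g (pt 0 (a ^ k * y₂)) - g 0 - (g (pt 0 y) - g 0)) (T (b (e * y₁) - b y₂))
    have n5 := norm_sub_le (g (pt 0 (a ^ k * y₂)) - g 0) (g (pt 0 y) - g 0)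
    linarith
  set Δz := z₂ + b (e * y₁) - zc with hΔ
  have hsΔ := hτ _ hTz
  set w := Δz - s (T Δz) with hw
  have hwW : w ∈ W := by
    rw [← hker, LinearMap.mem_ker, hw, map_sub, hsT, sub_self]
  have hbe : ‖b (e * y₁)‖ ≤ C * ε := (hb.norm_shift_le _).trans m3
  have hwn : ‖w‖ ≤ 9 * (C * ε) := by
    have n1 := norm_sub_le Δz (s (T Δz))
    have n2 := norm_sub_le (z₂ + b (e * y₁)) zc
    have n3 := norm_add_le z₂ (b (e * y₁))
    linarith
  have hwspan := hspan y hy0 (hyk.trans_lt hkr) hwW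
  obtain ⟨F, t, hFA, hFn, hFw⟩ := exists_finset_sum_eq hwspan
  have hFn' : (F.card : ℝ) ≤ n := by rw [hn]; exact_mod_cast hFn
  have hy0' := norm_nonneg y
  have hCy : 0 ≤ C' * ‖y‖ := by positivity
  have hFc : F.card * (C' * ‖y‖) ≤ n * (C' * ‖y‖) := mul_le_mul_of_nonneg_right hFn' hCy
  have hq2 : q * ‖y‖ = 2 * (n * (C' * ‖y‖)) + 2 * (12 * C + C') * ‖y‖ + ‖y‖ := by rw [hq]; ring
  have hp1 : 0 ≤ n * (C' * ‖y‖) := by positivity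
  have hp2 : 0 ≤ 2 * (12 * C + C') * ‖y‖ := by positivity
  -- At the small point y the conjugated commutators translate z by vectors of size at most C' ‖y‖
  -- whose real span contains W, so a walk with these steps comes close to w.
  obtain ⟨ζ, hζ, hζw⟩ := exists_walk F t (ε := C' * ‖y‖)
    (fun v hv => by
      obtain ⟨σ, e', -, he'1, rfl⟩ := hFA hv
      refine ((hc σ).norm_shift_le _).trans (mul_le_mul_of_nonneg_left ?_ hC'0)
      exact (norm_mul_le _ _).trans (mul_le_of_le_one_left (norm_nonneg _) he'1))
    (fun ζ => (pt 0 y, zc + ζ) ∈ leaf (D.lift η) (D.region R 0) (pt 0 y₁, z₁))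
    (by simpa using hleaf1)
    (fun ζ hQ hζ v hv => by
      obtain ⟨σ, e', he', he'1, rfl⟩ := hFA hv
      have hbd : ‖zc + ζ - 0‖ + 2 * (12 * C + C') * ‖y‖ ≤ R := by
        rw [hFw] at hζ
        rw [sub_zero]
        have := norm_add_le zc ζ
        linarith
      obtain ⟨r1, r2⟩ := reach_conj_shift ha hpow (hc σ) he' he'1 hy0 (zc + ζ)
      refine ⟨?_, ?_⟩
      · rw [← add_assoc]; exact leaf_trans hQ (r1.mem_leaf hbd)
      · rw [← add_sub_assoc]; exact leaf_trans hQ (r2.mem_leaf hbd))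
  rw [hFw] at hζw
  have hζn : ‖zc + ζ‖ ≤ 16 * (C * ε) := by
    have n1 := norm_add_le zc ζ
    have n2 := norm_sub_norm_le ζ w
    linarith
  -- The inverse of the contraction leads back to e y₁, which is close to y₂.
  have r3 := (hb.reach (e * y₁) hye (zc + ζ - b (e * y₁))).symm
  rw [sub_add_cancel] at r3
  refine ⟨_, leaf_trans hζ (r3.mem_leaf ?_), ?_⟩
  · rw [sub_zero]; simp only; linarith
  · rw [dist_eq_norm, Prod.mk_sub_mk]
    refine lt_of_lt_of_le (max_lt ?_ ?_) hδδ₀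
    · refine (norm_pt_zero_sub _ _).trans_lt ?_
      rw [norm_sub_rev]; linarith
    · have e2 : z₂ - (zc + ζ - b (e * y₁)) = -(ζ - w) + s (T Δz) := by
        rw [hw, hΔ]; abel
      rw [e2]
      have n1 := norm_add_le (-(ζ - w)) (s (T Δz))
      rw [norm_neg] at n1
      linarith

end Arrangement
end SepVar

end

/-! ### Stability of leaves and the saturation of the slice -/

section

namespace SepVar

/-- A path that avoids finitely many points by a fixed distance, with its starting point moved. -/
def UPath.perturb {ι : Type} {c : ι → ℂ} (γ : UPath c) {r : ℝ} (hr : ∀ t j, r ≤ ‖γ.u t - c j‖)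
    (δ : {δ : ℂ // ‖δ‖ < r}) : UPath c where
  u t := γ.u t + ((1 - smoothStep t : ℝ) : ℂ) * δ
  u' t := γ.u' t - ((Real.pi * Real.sin (Real.pi * t) / 2 : ℝ) : ℂ) * δ
  continuous_u' := by have := γ.continuous_u'; fun_prop
  hasDerivAt t := by
    have h := ((hasDerivAt_smoothStep t).const_sub 1).ofReal_comp.mul_const (δ : ℂ)
    refine ((γ.hasDerivAt t).add h).congr_deriv ?_
    push_cast
    ring
  avoid t j h := by
    have h1 := hr t j
    have h2 : γ.u t - c j = -(((1 - smoothStep t : ℝ) : ℂ) * δ) := by rw [← h]; ring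
    rw [h2, norm_neg, norm_mul, Complex.norm_real, Real.norm_eq_abs] at h1
    have h3 := smoothStep_mem t
    have h4 : |1 - smoothStep t| ≤ 1 := abs_le.mpr ⟨by linarith [h3.2], by linarith [h3.1]⟩
    have h5 := mul_le_mul_of_nonneg_right h4 (norm_nonneg (δ : ℂ))
    linarith [δ.2]

theorem UPath.continuous_perturb {ι : Type} {c : ι → ℂ} (γ : UPath c) {r : ℝ}
    (hr : ∀ t j, r ≤ ‖γ.u t - c j‖) :
    Continuous fun w : {δ : ℂ // ‖δ‖ < r} × ℝ => (γ.perturb hr w.1).u w.2 := by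
  have h1 := γ.continuous_u
  have h2 := continuous_smoothStep
  simp only [UPath.perturb]
  fun_prop

theorem UPath.continuous_perturb' {ι : Type} {c : ι → ℂ} (γ : UPath c) {r : ℝ}
    (hr : ∀ t j, r ≤ ‖γ.u t - c j‖) :
    Continuous fun w : {δ : ℂ // ‖δ‖ < r} × ℝ => (γ.perturb hr w.1).u' w.2 := by
  have h1 := γ.continuous_u'
  simp only [UPath.perturb]
  fun_prop

theorem UPath.perturb_zero {ι : Type} {c : ι → ℂ} (γ : UPath c) {r : ℝ}
    (hr : ∀ t j, r ≤ ‖γ.u t - c j‖) (h0 : ‖(0 : ℂ)‖ < r) : γ.perturb hr ⟨0, h0⟩ = γ := by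
  rcases γ with ⟨u, u', a1, a2, a3⟩
  simp [UPath.perturb]

namespace Arrangement

variable {m N : ℕ} {ι : Type} [Fintype ι] [DecidableEq ι] {D : Arrangement m ι}
  {η : (Fin (m + 2) → ℂ) → (Fin (m + 2) → ℂ) →L[ℂ] (Fin N → ℂ)}

/-- The leaves over the complement of the hyperplanes are lifts of paths. -/
theorem exists_path_of_mem_leaf (hη : Continuous η)
    {Ω : Set ((Fin (m + 2) → ℂ) × (Fin N → ℂ))} (hS : ∀ w ∈ Ω, w.1 ∉ D.S)
    {p q : (Fin (m + 2) → ℂ) × (Fin N → ℂ)} (h : q ∈ leaf (D.lift η) Ω p) :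
    ∃ γ : UPath D.c, (∃ r > 0, ∀ t j, r ≤ ‖γ.u t - D.c j‖) ∧
      γ.u 0 = p.1 (Fin.last (m + 1)) / p.1 0 ∧ γ.u 1 = q.1 (Fin.last (m + 1)) / q.1 0 ∧
      (∀ t, (D.curve γ (fun i => p.1 i.castSucc) t,
        p.2 + D.shift γ η (fun i => p.1 i.castSucc) t) ∈ Ω) ∧
      (D.curve γ (fun i => p.1 i.castSucc) 1, p.2 + D.shift γ η (fun i => p.1 i.castSucc) 1) = q := by
  obtain ⟨f, θ, h0, h1, hθ, -, -, himg, hf⟩ := exists_curve_of_mem_leaf h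
  have hfc : Continuous f := continuous_iff_continuousAt.mpr fun t => (hf t).2.continuousAt
  set x : ℝ → Fin (m + 2) → ℂ := fun t => (f t).1 with hx
  have hxc : Continuous x := continuous_fst.comp hfc
  have hxS : ∀ t, x t ∉ D.S := fun t => hS _ (hf t).1
  have hxi : ∀ t (i : Fin (m + 1)), x t i.castSucc ≠ 0 := fun t i hi => hxS t (Or.inl ⟨i, hi⟩)
  have hx0 : ∀ t, x t 0 ≠ 0 := fun t => hxi t 0
  have hxd : ∀ t, HasDerivAt x (θ t • D.field (x t)) t := fun t =>
    ((hf t).2.hasFDerivAt.fst).hasDerivAt.congr_deriv (by simp [lift, hx])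
  have hzd : ∀ t, HasDerivAt (fun t => (f t).2) (θ t • η (x t) (D.field (x t))) t := fun t =>
    ((hf t).2.hasFDerivAt.snd).hasDerivAt.congr_deriv (by simp [lift, hx])
  have hxl : ∀ t l, HasDerivAt (fun t => x t l) (θ t * D.field (x t) l) t := fun t l =>
    (hasDerivAt_pi.mp (hxd t) l).congr_deriv (by simp)
  have hprod : Continuous fun t => ∏ j, D.L j (x t) :=
    continuous_finsetProd _ fun j _ => (D.continuous_L j).comp hxc
  have hxpt : ∀ t, x t = pt (x t (Fin.last (m + 1)) / x t 0) (fun i => x t i.castSucc) := by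
    intro t
    funext l
    refine Fin.lastCases ?_ (fun i => ?_) l
    · rw [pt_last, Fin.castSucc_zero, div_mul_cancel₀ _ (hx0 t)]
    · rw [pt_castSucc]
  have hava : ∀ t j, x t (Fin.last (m + 1)) / x t 0 ≠ D.c j := by
    intro t j hj
    refine hxS t (Or.inr ⟨j, ?_⟩)
    rw [L, ← hj, div_mul_cancel₀ _ (hx0 t), sub_self]
  -- The projection of the leafwise path to the u-line.
  let γ : UPath D.c :=
    { u := fun t => x t (Fin.last (m + 1)) / x t 0
      u' := fun t => θ t * (∏ j, D.L j (x t)) / x t 0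
      continuous_u' := (hθ.mul hprod).div ((continuous_apply _).comp hxc) hx0
      hasDerivAt := fun t => by
        refine ((hxl t (Fin.last (m + 1))).div (hxl t 0) (hx0 t)).congr_deriv ?_
        rw [field_last, field_zero]
        have := hx0 t
        field_simp
        ring
      avoid := hava }
  have hrate : ∀ t i, θ t * D.cofactor i (x t) = D.rate i (γ.u t) * γ.u' t := by
    intro t i
    have h := D.cofactor_eq (u := γ.u t) (y := fun i => x t i.castSucc) (hx0 t) (hava t) i
    rw [← hxpt t] at h
    rw [h]
    change _ = _ * (θ t * (∏ j, D.L j (x t)) / x t 0)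
    simp only [Fin.castSucc_zero]
    ring
  set y₀ : Fin (m + 1) → ℂ := fun i => p.1 i.castSucc with hy₀
  -- Both sides solve the same linear equation, so their quotient is constant.
  have hmult : ∀ t i, x t i.castSucc = D.mult γ t i * y₀ i := by
    intro t i
    have hd : ∀ t, HasDerivAt (fun t => x t i.castSucc * (D.mult γ t i)⁻¹) 0 t := fun t => by
      refine ((hxl t i.castSucc).mul
        ((D.hasDerivAt_mult γ i t).inv (D.mult_ne_zero γ t i))).congr_deriv ?_
      have hm := D.mult_ne_zero γ t i
      rw [field_castSucc, ← hrate, Pi.inv_apply]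
      field_simp
      ring
    have := is_const_of_deriv_eq_zero (fun t => (hd t).differentiableAt) (fun t => (hd t).deriv) t 0
    simp only [mult_zero, Pi.one_apply, inv_one, mul_one] at this
    rw [← div_eq_mul_inv, div_eq_iff (D.mult_ne_zero γ t i)] at this
    rw [this, mul_comm]
    simp [hx, h0, hy₀]
  have hcurve : ∀ t, x t = D.curve γ y₀ t := by
    intro t
    rw [hxpt t, curve]
    congr 1
    funext i
    exact hmult t i
  have hshift : ∀ t, (f t).2 = p.2 + D.shift γ η y₀ t := by
    intro t
    have hd : ∀ t, HasDerivAt (fun t => (f t).2 - D.shift γ η y₀ t) 0 t := fun t => by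
      refine ((hzd t).sub (D.hasDerivAt_shift γ hη y₀ t)).congr_deriv ?_
      have h1 := (hxd t).unique (by
        have := D.hasDerivAt_curve γ y₀ t
        rwa [← (funext hcurve : x = D.curve γ y₀)] at this)
      rw [← h1, ← hcurve, map_smul, sub_self]
    have := is_const_of_deriv_eq_zero (fun t => (hd t).differentiableAt) (fun t => (hd t).deriv) t 0
    simp only [shift_zero, sub_zero, h0] at this
    rw [← this, sub_add_cancel]
  have hall : ∀ t, (D.curve γ y₀ t, p.2 + D.shift γ η y₀ t) = f t := fun t => by
    rw [← hcurve, ← hshift]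
  refine ⟨γ, ?_, by simp [γ, hx, h0], by simp [γ, hx, h1], fun t => by rw [hall]; exact (hf t).1,
    by rw [hall, h1]⟩
  -- The path lives on all of ℝ, but by `himg` it takes no values other than those on [0, 1], so
  -- compactness gives a gap.
  have hgap : ∀ j, ∃ r > 0, ∀ t, r ≤ ‖γ.u t - D.c j‖ := by
    intro j
    obtain ⟨t₀, -, ht₀⟩ := isCompact_Icc.exists_isMinOn (nonempty_Icc.mpr (zero_le_one' ℝ))
      (f := fun t => ‖γ.u t - D.c j‖) (γ.continuous_u.sub continuous_const).norm.continuousOn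
    refine ⟨_, norm_pos_iff.mpr (sub_ne_zero.mpr (γ.avoid t₀ j)), fun t => ?_⟩
    obtain ⟨s, hs, hst⟩ := himg t
    have : γ.u t = γ.u s := by simp only [γ, hx, hst]
    rw [this]
    exact ht₀ hs
  choose r hr hrt using hgap
  by_cases hne : Nonempty ι
  · refine ⟨Finset.univ.inf' Finset.univ_nonempty r, ?_, fun t j =>
      (Finset.inf'_le r (Finset.mem_univ j)).trans (hrt j t)⟩
    simpa using hr
  · exact ⟨1, one_pos, fun t j => (hne ⟨j⟩).elim⟩

theorem continuous_lift_curve (hη : Continuous η) {P : Type*} [TopologicalSpace P]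
    {Γ : P → UPath D.c} (hu : Continuous fun q : P × ℝ => (Γ q.1).u q.2)
    (hu' : Continuous fun q : P × ℝ => (Γ q.1).u' q.2) :
    Continuous fun w : (P × (Fin (m + 1) → ℂ) × (Fin N → ℂ)) × ℝ =>
      (D.curve (Γ w.1.1) w.1.2.1 w.2, w.1.2.2 + D.shift (Γ w.1.1) η w.1.2.1 w.2) := by
  have hq : Continuous fun w : (P × (Fin (m + 1) → ℂ) × (Fin N → ℂ)) × ℝ =>
      (((w.1.1, w.1.2.1), w.2) : (P × (Fin (m + 1) → ℂ)) × ℝ) := by fun_prop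
  have h1 := Continuous.comp (g := fun q : (P × (Fin (m + 1) → ℂ)) × ℝ =>
    D.curve (Γ q.1.1) q.1.2 q.2) (D.continuous_curve hu hu') hq
  have h2 := Continuous.comp (g := fun q : (P × (Fin (m + 1) → ℂ)) × ℝ =>
    D.shift (Γ q.1.1) η q.1.2 q.2) (D.continuous_shift η hu hu' hη) hq
  exact h1.prodMk (Continuous.add (by fun_prop) h2)

/-- Leaves through nearby points pass near a given point of the leaf, over the same `u`. -/
theorem eventually_exists_mem_leaf (hη : Continuous η)
    {Ω : Set ((Fin (m + 2) → ℂ) × (Fin N → ℂ))} (hΩ : IsOpen Ω) (hS : ∀ w ∈ Ω, w.1 ∉ D.S)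
    {p q : (Fin (m + 2) → ℂ) × (Fin N → ℂ)} (h : p ∈ leaf (D.lift η) Ω q)
    {A : Set ((Fin (m + 2) → ℂ) × (Fin N → ℂ))} (hA : A ∈ 𝓝 p) :
    ∀ᶠ q' in 𝓝 q, ∃ y z, (pt (p.1 (Fin.last (m + 1)) / p.1 0) y, z) ∈ A ∧
      (pt (p.1 (Fin.last (m + 1)) / p.1 0) y, z) ∈ leaf (D.lift η) Ω q' := by
  obtain ⟨γ, ⟨r, hr, hgap⟩, h0, h1, hmem, hend⟩ := exists_path_of_mem_leaf hη hS h
  set u₀ := q.1 (Fin.last (m + 1)) / q.1 0 with hu₀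
  set y₀ : Fin (m + 1) → ℂ := fun i => q.1 i.castSucc with hy₀
  have hr0 : ‖(0 : ℂ)‖ < r := by simpa using hr
  set Γ : {δ : ℂ // ‖δ‖ < r} → UPath D.c := γ.perturb hgap with hΓ
  have hu : Continuous fun w : {δ : ℂ // ‖δ‖ < r} × ℝ => (Γ w.1).u w.2 := γ.continuous_perturb hgap
  have hu' : Continuous fun w : {δ : ℂ // ‖δ‖ < r} × ℝ => (Γ w.1).u' w.2 :=
    γ.continuous_perturb' hgap
  obtain ⟨F, hFdef⟩ : ∃ F : ({δ : ℂ // ‖δ‖ < r} × (Fin (m + 1) → ℂ) × (Fin N → ℂ)) × ℝ →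
      (Fin (m + 2) → ℂ) × (Fin N → ℂ), F = fun w =>
      (D.curve (Γ w.1.1) w.1.2.1 w.2, w.1.2.2 + D.shift (Γ w.1.1) η w.1.2.1 w.2) := ⟨_, rfl⟩
  have hF : Continuous F := hFdef ▸ continuous_lift_curve hη hu hu'
  have hFo : ∀ t, F ((⟨0, hr0⟩, y₀, q.2), t) =
      (D.curve γ y₀ t, q.2 + D.shift γ η y₀ t) := fun t => by
    rw [hFdef, hΓ]
    simp only [UPath.perturb_zero]
  -- The perturbation moves only the start of γ and fades out at time 1, so the lifts end over the
  -- same u. By compactness of [0, 1] they stay in Ω for nearby data.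
  have ev1 : ∀ᶠ w in 𝓝 ((⟨0, hr0⟩, y₀, q.2) :
      {δ : ℂ // ‖δ‖ < r} × (Fin (m + 1) → ℂ) × (Fin N → ℂ)),
      ∀ t ∈ Icc (0 : ℝ) 1, F (w, t) ∈ Ω := by
    refine isCompact_Icc.eventually_forall_of_forall_eventually fun t _ => ?_
    refine hF.continuousAt.eventually (hΩ.mem_nhds ?_)
    rw [hFo]
    exact hmem t
  have ev2 : ∀ᶠ w in 𝓝 ((⟨0, hr0⟩, y₀, q.2) :
      {δ : ℂ // ‖δ‖ < r} × (Fin (m + 1) → ℂ) × (Fin N → ℂ)), F (w, 1) ∈ A := by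
    have hc : Continuous fun w : {δ : ℂ // ‖δ‖ < r} × (Fin (m + 1) → ℂ) × (Fin N → ℂ) =>
        F (w, 1) := by fun_prop
    refine hc.continuousAt.eventually ?_
    beta_reduce
    rw [hFo, hend]
    exact hA
  -- Near q, where x_0 ≠ 0, the data (u, y, z) depend continuously on the point. So good data near
  -- those of q give a neighbourhood of q.
  have hemb : IsOpenMap (Prod.map Subtype.val id :
      {δ : ℂ // ‖δ‖ < r} × (Fin (m + 1) → ℂ) × (Fin N → ℂ) → ℂ × (Fin (m + 1) → ℂ) × (Fin N → ℂ)) := by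
    refine IsOpenMap.prodMap (IsOpen.isOpenMap_subtype_val ?_) IsOpenMap.id
    exact isOpen_lt continuous_norm continuous_const
  have ev3 := hemb.image_mem_nhds (ev1.and ev2)
  have hq0 : q.1 0 ≠ 0 := fun hi => hS _ (source_mem_of_mem_leaf h) (Or.inl ⟨0, hi⟩)
  have hG : ContinuousAt (fun q' : (Fin (m + 2) → ℂ) × (Fin N → ℂ) =>
      ((q'.1 (Fin.last (m + 1)) / q'.1 0 - u₀, (fun i : Fin (m + 1) => q'.1 i.castSucc), q'.2) :
        ℂ × (Fin (m + 1) → ℂ) × (Fin N → ℂ))) q := by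
    have c1 : ∀ l, ContinuousAt (fun q' : (Fin (m + 2) → ℂ) × (Fin N → ℂ) => q'.1 l) q :=
      fun l => by fun_prop
    refine (((c1 _).div (c1 0) hq0).sub continuousAt_const).prodMk (ContinuousAt.prodMk ?_ ?_)
    · exact continuousAt_pi.mpr fun i => c1 _
    · exact continuousAt_snd
  have hΩ' : ∀ᶠ q' in 𝓝 q, q' ∈ Ω := hΩ.mem_nhds (source_mem_of_mem_leaf h)
  have hGq : Prod.map Subtype.val id ((⟨0, hr0⟩, y₀, q.2) :
      {δ : ℂ // ‖δ‖ < r} × (Fin (m + 1) → ℂ) × (Fin N → ℂ)) =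
      (q.1 (Fin.last (m + 1)) / q.1 0 - u₀, (fun i : Fin (m + 1) => q.1 i.castSucc), q.2) := by
    simp [hu₀, hy₀]
  rw [hGq] at ev3
  filter_upwards [hG.eventually ev3, hΩ'] with q' hq' hqΩ
  obtain ⟨⟨δ, y, z⟩, ⟨hw1, hw2⟩, hw3⟩ := hq'
  rw [hFdef] at hw1 hw2
  simp only [Prod.map_apply, id_eq, Prod.mk.injEq] at hw3
  obtain ⟨hδ, hy, hz⟩ := hw3
  have hqS := hS _ hqΩ
  have hyn : ∀ i, y i ≠ 0 := fun i hi => hqS (Or.inl ⟨i, by rw [hy] at hi; exact hi⟩)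
  have hq0' : q'.1 0 ≠ 0 := fun hi => hqS (Or.inl ⟨0, hi⟩)
  have hstart : (pt ((Γ δ).u 0) y, z) = q' := by
    refine Prod.ext ?_ hz
    have : (Γ δ).u 0 = q'.1 (Fin.last (m + 1)) / q'.1 0 := by
      simp only [hΓ, UPath.perturb, smoothStep_zero, hδ, h0]
      push_cast
      ring
    simp only [this]
    funext l
    refine Fin.lastCases ?_ (fun i => ?_) l
    · rw [pt_last, hy]; exact div_mul_cancel₀ _ hq0'
    · rw [pt_castSucc, hy]
  have hu1 : (Γ δ).u 1 = p.1 (Fin.last (m + 1)) / p.1 0 := by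
    simp only [hΓ, UPath.perturb, smoothStep_one, h1]
    push_cast
    ring
  have hleaf := D.mem_leaf_lift (Γ δ) hη hyn z (Ω := Ω) hw1
  rw [hstart, hu1] at hleaf
  refine ⟨_, _, ?_, hleaf⟩
  rw [← hu1]
  exact hw2

variable (D η)

theorem isOpen_region (R : ℝ) (z₀ : Fin N → ℂ) : IsOpen (D.region R z₀) := by
  have h1 : IsOpen {w : (Fin (m + 2) → ℂ) × (Fin N → ℂ) | w.1 ∉ D.S} :=
    D.isClosed_S.isOpen_compl.preimage continuous_fst
  have h2 : IsOpen {w : (Fin (m + 2) → ℂ) × (Fin N → ℂ) | ‖w.1‖ < R} :=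
    isOpen_lt (by fun_prop) continuous_const
  have h3 : IsOpen {w : (Fin (m + 2) → ℂ) × (Fin N → ℂ) | ‖w.2 - z₀‖ < R} :=
    isOpen_lt (by fun_prop) continuous_const
  exact h1.inter (h2.inter h3)

/-- The points of the region of size `R` whose leaves meet the slice `u = 0` at a point of size less
than `ε`. -/
def saturation (R ε : ℝ) : Set ((Fin (m + 2) → ℂ) × (Fin N → ℂ)) :=
  {q | ∃ y z, (∀ i, y i ≠ 0) ∧ ‖y‖ < ε ∧ ‖z‖ < ε ∧ (pt 0 y, z) ∈ leaf (D.lift η) (D.region R 0) q}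

variable {D η}

theorem saturation_subset {R ε : ℝ} : D.saturation η R ε ⊆ D.region R 0 := by
  rintro q ⟨y, z, -, -, -, h⟩
  exact source_mem_of_mem_leaf h

/-- Leaves near a given one meet the slice nearby, since `eventually_exists_mem_leaf` ends exactly
over u = 0. -/
theorem isOpen_saturation (hη : Continuous η) (R ε : ℝ) : IsOpen (D.saturation η R ε) := by
  rw [isOpen_iff_mem_nhds]
  rintro q ⟨y, z, hy, hyε, hzε, h⟩
  have hA : {w : (Fin (m + 2) → ℂ) × (Fin N → ℂ) | (∀ i : Fin (m + 1), ‖w.1 i.castSucc‖ < ε) ∧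
      ‖w.2‖ < ε} ∈ 𝓝 ((pt 0 y, z) : (Fin (m + 2) → ℂ) × (Fin N → ℂ)) := by
    have o1 : IsOpen {w : (Fin (m + 2) → ℂ) × (Fin N → ℂ) |
        ∀ i : Fin (m + 1), ‖w.1 i.castSucc‖ < ε} := by
      rw [ofPred_forall]
      exact isOpen_iInter_of_finite fun i => isOpen_lt (by fun_prop) continuous_const
    have o2 : IsOpen {w : (Fin (m + 2) → ℂ) × (Fin N → ℂ) | ‖w.2‖ < ε} :=
      isOpen_lt (by fun_prop) continuous_const
    refine (o1.inter o2).mem_nhds ⟨fun i => ?_, hzε⟩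
    simp only [pt_castSucc]
    exact (norm_le_pi_norm y i).trans_lt hyε
  have h0 : ((pt 0 y, z) : (Fin (m + 2) → ℂ) × (Fin N → ℂ)).1 (Fin.last (m + 1)) /
      ((pt 0 y, z) : (Fin (m + 2) → ℂ) × (Fin N → ℂ)).1 0 = 0 := by simp
  have hε : 0 < ε := (norm_nonneg _).trans_lt hzε
  filter_upwards [eventually_exists_mem_leaf hη (D.isOpen_region R 0) (fun w hw => hw.1) h hA]
    with q' hq'
  rw [h0] at hq'
  obtain ⟨y', z', ⟨hy', hz'⟩, hl⟩ := hq'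
  simp only [pt_castSucc] at hy'
  refine ⟨y', z', fun i hi => (leaf_subset hl).1 (Or.inl ⟨i, by simpa using hi⟩), ?_, hz', hl⟩
  exact (pi_norm_lt_iff hε).mpr hy'

theorem saturation_saturated {R ε : ℝ} {p q : (Fin (m + 2) → ℂ) × (Fin N → ℂ)}
    (hp : p ∈ D.saturation η R ε) (hq : q ∈ leaf (D.lift η) (D.region R 0) p) :
    q ∈ D.saturation η R ε := by
  obtain ⟨y, z, hy, hyε, hzε, h⟩ := hp
  exact ⟨y, z, hy, hyε, hzε, leaf_trans (leaf_symm hq) h⟩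

/-- Density on the slice spreads to the saturation of the slice. -/
theorem leavesDenseInLevels_saturation (hη : Continuous η) {F : Type*} {R ε : ℝ}
    {H : (Fin (m + 2) → ℂ) × (Fin N → ℂ) → F}
    (hH : ∀ p q, q ∈ leaf (D.lift η) (D.region R 0) p → H q = H p)
    (hd : ∀ y₁ y₂ : Fin (m + 1) → ℂ, (∀ i, y₁ i ≠ 0) → (∀ i, y₂ i ≠ 0) → ‖y₁‖ < ε → ‖y₂‖ < ε →
      ∀ z₁ z₂ : Fin N → ℂ, ‖z₁‖ < ε → ‖z₂‖ < ε → H (pt 0 y₂, z₂) = H (pt 0 y₁, z₁) →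
      (pt 0 y₂, z₂) ∈ closure (leaf (D.lift η) (D.region R 0) (pt 0 y₁, z₁))) :
    LeavesDenseInLevels (D.lift η) H (D.saturation η R ε) := by
  intro p hp
  refine ⟨fun q hq => ⟨leaf_subset hq, hH _ _ (leaf_mono saturation_subset hq)⟩, ?_⟩
  rintro q ⟨hq, hHq⟩
  have hl : leaf (D.lift η) (D.region R 0) p ⊆ leaf (D.lift η) (D.saturation η R ε) p :=
    leaf_subset_leaf_of_saturated fun x hx => saturation_saturated hp hx
  refine closure_mono hl ?_
  obtain ⟨y₁, z₁, hy₁, hyε₁, hzε₁, h₁⟩ := hp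
  obtain ⟨y₂, z₂, hy₂, hyε₂, hzε₂, h₂⟩ := hq
  have hcl := hd y₁ y₂ hy₁ hy₂ hyε₁ hyε₂ z₁ z₂ hzε₁ hzε₂
    ((hH _ _ h₂).trans (hHq.trans (hH _ _ h₁).symm))
  rw [leaf_eq_of_mem h₁] at hcl
  rw [mem_closure_iff_nhds]
  intro A hA
  -- The leaf of p comes close to the point where the leaf of q meets the slice. Followed from there
  -- along the leaf of q, it comes close to q as well.
  have hev := eventually_exists_mem_leaf hη (D.isOpen_region R 0) (fun w hw => hw.1) (leaf_symm h₂) hA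
  obtain ⟨p', ⟨y, z, hpA, hp1⟩, hp2⟩ := mem_closure_iff_nhds.mp hcl _ hev
  exact ⟨_, hpA, leaf_trans hp2 hp1⟩

end Arrangement
end SepVar

end

/-! ### Circular loops and weighted residue integrals -/

section

namespace SepVar

/-- The loop at the origin that runs once around the circle with centre `q`. -/
def loopFun (q : ℂ) (t : ℝ) : ℂ := q * (1 - Complex.exp (2 * Real.pi * Complex.I * t))

/-- The velocity of the loop. -/
def loopFun' (q : ℂ) (t : ℝ) : ℂ :=
  -q * (2 * Real.pi * Complex.I) * Complex.exp (2 * Real.pi * Complex.I * t)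

@[simp] theorem loopFun_zero (q : ℂ) : loopFun q 0 = 0 := by simp [loopFun]

@[simp] theorem loopFun_one (q : ℂ) : loopFun q 1 = 0 := by
  simp [loopFun, Complex.exp_two_pi_mul_I]

theorem hasDerivAt_loopFun (q : ℂ) (t : ℝ) : HasDerivAt (loopFun q) (loopFun' q t) t := by
  have h : HasDerivAt (fun t : ℝ => 2 * Real.pi * Complex.I * (t : ℂ)) (2 * Real.pi * Complex.I) t := by
    simpa using (Complex.ofRealCLM.hasDerivAt (x := t)).const_mul (2 * Real.pi * Complex.I)
  refine ((h.cexp.const_sub 1).const_mul q).congr_deriv ?_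
  rw [loopFun']
  ring

theorem norm_loopFun_sub (q : ℂ) (t : ℝ) : ‖loopFun q t - q‖ = ‖q‖ := by
  have h : loopFun q t - q = -(q * Complex.exp ((2 * Real.pi * t : ℝ) * Complex.I)) := by
    rw [loopFun]; push_cast; ring_nf
  rw [h, norm_neg, norm_mul, Complex.norm_exp_ofReal_mul_I, mul_one]

/-- The loop is the circle about q through 0, started at the angle of -q; by periodicity the
starting angle does not matter. -/
theorem integral_loopFun (q : ℂ) (f : ℂ → ℂ) :
    ∫ t in (0 : ℝ)..1, f (loopFun q t) * loopFun' q t = ∮ z in C(q, ‖q‖), f z := by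
  set φ := Complex.arg (-q) with hφ
  have hq : -q = ‖q‖ * Complex.exp (φ * Complex.I) := by
    rw [hφ, ← norm_neg q]; exact (Complex.norm_mul_exp_arg_mul_I _).symm
  set h : ℝ → ℂ := fun θ => deriv (circleMap q ‖q‖) θ • f (circleMap q ‖q‖ θ) with hh
  have hexp : ∀ t : ℝ, -q * Complex.exp (2 * Real.pi * Complex.I * t) =
      circleMap 0 ‖q‖ (2 * Real.pi * t + φ) := by
    intro t
    rw [hq, circleMap, zero_add, mul_assoc, ← Complex.exp_add]
    congr 2
    push_cast
    ring
  have hu : ∀ t, loopFun q t = circleMap q ‖q‖ (2 * Real.pi * t + φ) := by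
    intro t
    have := hexp t
    rw [circleMap, zero_add] at this
    rw [loopFun, circleMap, ← this]
    ring
  have e1 : ∀ t : ℝ, f (loopFun q t) * loopFun' q t =
      (2 * Real.pi) • h (2 * Real.pi * t + φ) := by
    intro t
    simp only [hh, deriv_circleMap, ← hu, ← hexp, loopFun', smul_eq_mul, Complex.real_smul]
    push_cast
    ring
  simp only [e1]
  rw [intervalIntegral.integral_smul,
    intervalIntegral.smul_integral_comp_mul_add]
  have hper : Function.Periodic h (2 * Real.pi) := by
    intro θ
    simp only [hh, deriv_circleMap, periodic_circleMap _ _ θ]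
  have := hper.intervalIntegral_add_eq φ 0
  rw [zero_add] at this
  rw [circleIntegral, ← this]
  congr 1 <;> ring

theorem integral_loopFun_div {q w : ℂ} (hw : ‖w - q‖ ≠ ‖q‖) (P : Polynomial ℂ) :
    ∫ t in (0 : ℝ)..1, P.eval (loopFun q t) / (loopFun q t - w) * loopFun' q t =
      if ‖w - q‖ < ‖q‖ then 2 * Real.pi * Complex.I * P.eval w else 0 := by
  rw [integral_loopFun q fun z => P.eval z / (z - w)]
  split_ifs with h
  · have h1 : w ∈ Metric.ball q ‖q‖ := by rwa [Metric.mem_ball, dist_eq_norm]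
    have := Complex.circleIntegral_sub_inv_smul_of_differentiable_on_off_countable countable_empty h1
      (f := fun z => P.eval z) P.continuous.continuousOn fun x _ => P.differentiableAt
    simp only [smul_eq_mul] at this
    rw [← this]
    simp only [div_eq_inv_mul]
  · have hlt : ‖q‖ < ‖w - q‖ := lt_of_le_of_ne (not_lt.mp h) (Ne.symm hw)
    have hd : ∀ z ∈ Metric.closedBall q ‖q‖, DifferentiableAt ℂ (fun z => P.eval z / (z - w)) z := by
      intro z hz
      refine P.differentiableAt.div (by fun_prop) (sub_ne_zero.mpr ?_)
      rintro rfl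
      rw [Metric.mem_closedBall, dist_eq_norm] at hz
      linarith
    exact Complex.circleIntegral_eq_zero_of_differentiable_on_off_countable (norm_nonneg q)
      countable_empty (fun z hz => (hd z hz).continuousAt.continuousWithinAt)
      fun z hz => hd z (Metric.ball_subset_closedBall hz.1)

namespace Arrangement

variable {m : ℕ} {ι : Type} [Fintype ι] [DecidableEq ι] (D : Arrangement m ι)
  (γ : UPath D.c) (k : Fin (m + 1) → ℂ)

/-- The logarithm of the monomial with exponents `k` along a lift. -/
def wlog (t : ℝ) : ℂ := ∑ i, k i * D.logCoord γ i t

/-- The weighted integral of a tuple of polynomials. -/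
def wint (G : Fin (m + 1) → Polynomial ℂ) : ℂ :=
  ∫ t in (0 : ℝ)..1, Complex.exp (D.wlog γ k t) *
    (∑ i, D.rate i (γ.u t) * (G i).eval (γ.u t)) * γ.u' t

theorem hasDerivAt_wlog (t : ℝ) :
    HasDerivAt (D.wlog γ k) (∑ i, k i * (D.rate i (γ.u t) * γ.u' t)) t :=
  HasDerivAt.fun_sum fun i _ => (D.hasDerivAt_logCoord γ i t).const_mul (k i)

@[simp] theorem wlog_zero : D.wlog γ k 0 = 0 := by simp [wlog]

theorem continuous_wlog : Continuous (D.wlog γ k) :=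
  continuous_iff_continuousAt.mpr fun t => (D.hasDerivAt_wlog γ k t).continuousAt

theorem continuous_sum_rate_eval (G : Fin (m + 1) → Polynomial ℂ) :
    Continuous fun t => ∑ i, D.rate i (γ.u t) * (G i).eval (γ.u t) :=
  continuous_finsetSum _ fun i _ =>
    (D.continuous_rate_path γ i).mul ((G i).continuous.comp γ.continuous_u)

theorem continuous_wint_integrand (G : Fin (m + 1) → Polynomial ℂ) :
    Continuous fun t => Complex.exp (D.wlog γ k t) *
      (∑ i, D.rate i (γ.u t) * (G i).eval (γ.u t)) * γ.u' t :=
  ((D.continuous_wlog γ k).cexp.mul (D.continuous_sum_rate_eval γ G)).mul γ.continuous_u'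

/-- Integration by parts: exp(wlog) p has derivative exp(wlog) (p' + ∑ k_i rate_i p) u'. So p' is
removed at the price of boundary terms and of subtracting k_i p from P_i. -/
theorem integral_exp_wlog_eq (P G : Fin (m + 1) → Polynomial ℂ) (p : Polynomial ℂ)
    (hG : ∀ i, G i = P i - Polynomial.C (k i) * p) :
    ∫ t in (0 : ℝ)..1, Complex.exp (D.wlog γ k t) * (p.derivative.eval (γ.u t) +
      ∑ i, D.rate i (γ.u t) * (P i).eval (γ.u t)) * γ.u' t =
    Complex.exp (D.wlog γ k 1) * p.eval (γ.u 1) - p.eval (γ.u 0) + D.wint γ k G := by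
  have hw := (D.continuous_wlog γ k).cexp
  have hu := γ.continuous_u
  have hu' := γ.continuous_u'
  have hp := fun p : Polynomial ℂ => p.continuous.comp γ.continuous_u
  have hd : ∀ t ∈ uIcc (0 : ℝ) 1, HasDerivAt (fun t => Complex.exp (D.wlog γ k t) * p.eval (γ.u t))
      (Complex.exp (D.wlog γ k t) * (∑ i, k i * (D.rate i (γ.u t) * γ.u' t)) * p.eval (γ.u t) +
        Complex.exp (D.wlog γ k t) * (p.derivative.eval (γ.u t) * γ.u' t)) t := fun t _ =>
    (D.hasDerivAt_wlog γ k t).cexp.mul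
      ((p.hasDerivAt (γ.u t)).comp_of_eq t (γ.hasDerivAt t) rfl)
  have hrk : ∀ i, Continuous fun t => D.rate i (γ.u t) := D.continuous_rate_path γ
  have hcont : Continuous fun t => Complex.exp (D.wlog γ k t) *
      (∑ i, k i * (D.rate i (γ.u t) * γ.u' t)) * p.eval (γ.u t) +
        Complex.exp (D.wlog γ k t) * (p.derivative.eval (γ.u t) * γ.u' t) := by
    have h1 := hp p
    have h2 := hp p.derivative
    simp only [Function.comp_def] at h1 h2
    fun_prop
  have hftc := intervalIntegral.integral_eq_sub_of_hasDerivAt hd (hcont.intervalIntegrable _ _)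
  rw [wlog_zero, Complex.exp_zero, one_mul] at hftc
  rw [← hftc, wint, ← intervalIntegral.integral_add (hcont.intervalIntegrable _ _)
    ((D.continuous_wint_integrand γ k G).intervalIntegrable _ _)]
  refine intervalIntegral.integral_congr fun t _ => ?_
  have hs : ∑ i, D.rate i (γ.u t) * (P i).eval (γ.u t) = ∑ i, D.rate i (γ.u t) * (G i).eval (γ.u t) +
      (∑ i, k i * D.rate i (γ.u t)) * p.eval (γ.u t) := by
    rw [Finset.sum_mul, ← Finset.sum_add_distrib]
    refine Finset.sum_congr rfl fun i _ => ?_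
    rw [hG]
    simp only [Polynomial.eval_sub, Polynomial.eval_mul, Polynomial.eval_C]
    ring
  have hs2 : ∑ i, k i * (D.rate i (γ.u t) * γ.u' t) = (∑ i, k i * D.rate i (γ.u t)) * γ.u' t := by
    rw [Finset.sum_mul]
    exact Finset.sum_congr rfl fun i _ => by ring
  rw [hs, hs2]
  ring

/-- The tuple k_i f is exact, its integrand being f times the derivative of exp(wlog). Such tuples
are the ones that commutators of loops cannot detect. -/
theorem wint_const (f : ℂ) :
    D.wint γ k (fun i => Polynomial.C (k i * f)) = f * (Complex.exp (D.wlog γ k 1) - 1) := by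
  have h := D.integral_exp_wlog_eq γ k 0 (fun i => Polynomial.C (k i * f)) (Polynomial.C (-f))
    fun i => by simp
  simp only [Polynomial.derivative_C, Polynomial.eval_zero, Pi.zero_apply, mul_zero,
    Finset.sum_const_zero, add_zero, zero_mul, intervalIntegral.integral_zero,
    Polynomial.eval_C] at h
  linear_combination -h

/-- The arrangement with all residues multiplied by `τ`. -/
def scale (τ : ℂ) : Arrangement m ι where
  c := D.c
  lam j := τ * D.lam j
  blk := D.blk

/-- The paths of the scaled arrangement are those of the arrangement. -/
def scalePath (τ : ℂ) : UPath (D.scale τ).c := γ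

theorem rate_scale (τ : ℂ) (i : Fin (m + 1)) (u : ℂ) : (D.scale τ).rate i u = τ * D.rate i u := by
  rw [rate, rate, Finset.mul_sum]
  exact Finset.sum_congr rfl fun j _ => mul_div_assoc _ _ _

theorem logCoord_scale (τ : ℂ) (i : Fin (m + 1)) (t : ℝ) :
    (D.scale τ).logCoord (D.scalePath γ τ) i t = τ * D.logCoord γ i t := by
  rw [logCoord, logCoord, ← intervalIntegral.integral_const_mul]
  refine intervalIntegral.integral_congr fun s _ => ?_
  simp only [rate_scale, mul_assoc, scalePath]

theorem wlog_scale (τ : ℂ) (t : ℝ) :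
    (D.scale τ).wlog (D.scalePath γ τ) k t = τ * D.wlog γ k t := by
  rw [wlog, wlog, Finset.mul_sum]
  refine Finset.sum_congr rfl fun i _ => ?_
  rw [logCoord_scale]
  ring

/-- The weighted integral of the scaled arrangement, divided by the scale. -/
def wintDiv (τ : ℂ) (G : Fin (m + 1) → Polynomial ℂ) : ℂ :=
  ∫ t in (0 : ℝ)..1, Complex.exp (τ * D.wlog γ k t) *
    (∑ i, D.rate i (γ.u t) * (G i).eval (γ.u t)) * γ.u' t

theorem wint_scale (τ : ℂ) (G : Fin (m + 1) → Polynomial ℂ) :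
    (D.scale τ).wint (D.scalePath γ τ) k G = τ * D.wintDiv γ k τ G := by
  rw [wint, wintDiv, ← intervalIntegral.integral_const_mul]
  refine intervalIntegral.integral_congr fun t _ => ?_
  simp only [wlog_scale]
  simp only [rate_scale, mul_assoc, ← Finset.mul_sum, scalePath]
  ring

theorem wintDiv_add_smul (τ : ℂ) (G G' : Fin (m + 1) → Polynomial ℂ) (r : ℂ) :
    D.wintDiv γ k τ (G + r • G') = D.wintDiv γ k τ G + r * D.wintDiv γ k τ G' := by
  have hc : ∀ G : Fin (m + 1) → Polynomial ℂ, Continuous fun t => Complex.exp (τ * D.wlog γ k t) *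
      (∑ i, D.rate i (γ.u t) * (G i).eval (γ.u t)) * γ.u' t := fun G =>
    ((continuous_const.mul (D.continuous_wlog γ k)).cexp.mul (D.continuous_sum_rate_eval γ G)).mul
      γ.continuous_u'
  rw [wintDiv, wintDiv, wintDiv, ← intervalIntegral.integral_const_mul,
    ← intervalIntegral.integral_add ((hc G).intervalIntegrable _ _)
    (Continuous.intervalIntegrable (by have := hc G'; fun_prop) _ _)]
  refine intervalIntegral.integral_congr fun t _ => ?_
  simp only [Pi.add_apply, Pi.smul_apply, Polynomial.eval_add, Polynomial.eval_smul, smul_eq_mul,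
    mul_add, Finset.sum_add_distrib]
  have : ∑ i, D.rate i (γ.u t) * (r * (G' i).eval (γ.u t)) =
      r * ∑ i, D.rate i (γ.u t) * (G' i).eval (γ.u t) := by
    rw [Finset.mul_sum]; exact Finset.sum_congr rfl fun i _ => by ring
  rw [this]
  ring

theorem wintDiv_smul (τ : ℂ) (G : Fin (m + 1) → Polynomial ℂ) (r : ℂ) :
    D.wintDiv γ k τ (r • G) = r * D.wintDiv γ k τ G := by
  have h0 := D.wintDiv_add_smul γ k τ 0 0 1
  simp only [smul_zero, add_zero, one_mul, left_eq_add] at h0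
  have h := D.wintDiv_add_smul γ k τ 0 G r
  rwa [h0, zero_add, zero_add] at h

theorem continuous_wintDiv (G : Fin (m + 1) → Polynomial ℂ) :
    Continuous fun τ => D.wintDiv γ k τ G := by
  have h1 := D.continuous_wlog γ k
  have h2 := D.continuous_sum_rate_eval γ G
  have h3 := γ.continuous_u'
  refine intervalIntegral.continuous_parametric_intervalIntegral_of_continuous' ?_ 0 1
  simp only [Function.uncurry_def]
  have h1' : Continuous fun w : ℂ × ℝ => D.wlog γ k w.2 := h1.comp continuous_snd
  have h2' : Continuous fun w : ℂ × ℝ => ∑ i, D.rate i (γ.u w.2) * (G i).eval (γ.u w.2) :=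
    Continuous.comp (g := fun t => ∑ i, D.rate i (γ.u t) * (G i).eval (γ.u t)) h2 continuous_snd
  have h3' : Continuous fun w : ℂ × ℝ => γ.u' w.2 := h3.comp continuous_snd
  fun_prop

end Arrangement

/-- A circular loop that winds once around exactly one of the points. -/
structure IsSimpleLoop {ι : Type} (c : ι → ℂ) (q : ℂ) (a : ι) : Prop where
  inside : ‖c a - q‖ < ‖q‖
  outside : ∀ j, j ≠ a → ‖q‖ < ‖c j - q‖

/-- The simple loop as a path. -/
def IsSimpleLoop.path {ι : Type} {c : ι → ℂ} {q : ℂ} {a : ι} (h : IsSimpleLoop c q a) : UPath c where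
  u := loopFun q
  u' := loopFun' q
  continuous_u' := by unfold loopFun'; fun_prop
  hasDerivAt := hasDerivAt_loopFun q
  avoid t j hj := by
    have h1 := norm_loopFun_sub q t
    rw [hj] at h1
    by_cases hja : j = a
    · subst hja; exact h.inside.ne h1
    · exact (h.outside j hja).ne' h1

namespace Arrangement

variable {m : ℕ} {ι : Type} [Fintype ι] [DecidableEq ι] (D : Arrangement m ι) {q : ℂ} {a : ι}
  (h : IsSimpleLoop D.c q a)

/-- Only the pole c_a lies inside the loop, and it is a pole of `rate i` only if it belongs to the
block i. -/
theorem integral_rate_loop (i : Fin (m + 1)) (P : Polynomial ℂ) :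
    ∫ t in (0 : ℝ)..1, D.rate i (h.path.u t) * P.eval (h.path.u t) * h.path.u' t =
      if D.blk a = i then 2 * Real.pi * Complex.I * (D.lam a * P.eval (D.c a)) else 0 := by
  have hne : ∀ j, ‖D.c j - q‖ ≠ ‖q‖ := fun j => by
    by_cases hja : j = a
    · subst hja; exact h.inside.ne
    · exact (h.outside j hja).ne'
  have hav := h.path.avoid
  have hu := h.path.continuous_u
  have hu' := h.path.continuous_u'
  have e1 : ∀ t, D.rate i (h.path.u t) * P.eval (h.path.u t) * h.path.u' t =
      ∑ j ∈ Finset.univ.filter (fun j => D.blk j = i), D.lam j *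
        (P.eval (h.path.u t) / (h.path.u t - D.c j) * h.path.u' t) := by
    intro t
    rw [rate, Finset.sum_mul, Finset.sum_mul]
    exact Finset.sum_congr rfl fun j _ => by ring
  simp only [e1]
  rw [intervalIntegral.integral_finsetSum]
  · simp only [intervalIntegral.integral_const_mul]
    have e2 : ∀ j, ∫ t in (0 : ℝ)..1, P.eval (h.path.u t) / (h.path.u t - D.c j) * h.path.u' t =
        if j = a then 2 * Real.pi * Complex.I * P.eval (D.c a) else 0 := by
      intro j
      refine (integral_loopFun_div (hne j) P).trans ?_
      by_cases hja : j = a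
      · subst hja; rw [if_pos h.inside, if_pos rfl]
      · rw [if_neg (h.outside j hja).not_gt, if_neg hja]
    simp only [e2, mul_ite, mul_zero]
    rw [Finset.sum_ite_eq']
    simp only [Finset.mem_filter, Finset.mem_univ, true_and]
    congr 1
    ring
  · intro j _
    refine Continuous.intervalIntegrable ?_ _ _
    refine continuous_const.mul (((P.continuous.comp hu).div (hu.sub continuous_const) fun t =>
      sub_ne_zero.mpr (hav t j)).mul hu')

theorem logCoord_loop (i : Fin (m + 1)) :
    D.logCoord h.path i 1 = if D.blk a = i then 2 * Real.pi * Complex.I * D.lam a else 0 := by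
  have := D.integral_rate_loop h i 1
  simp only [Polynomial.eval_one, mul_one] at this
  exact this

/-- At τ = 0 the weight is 1 and a residue remains, that is, an evaluation at c_a. Nondegeneracy is
checked in this limit. -/
theorem wintDiv_loop_zero (k : Fin (m + 1) → ℂ) (G : Fin (m + 1) → Polynomial ℂ) :
    D.wintDiv h.path k 0 G =
      2 * Real.pi * Complex.I * (D.lam a * (G (D.blk a)).eval (D.c a)) := by
  rw [wintDiv]
  simp only [zero_mul, Complex.exp_zero, one_mul, Finset.sum_mul]
  rw [intervalIntegral.integral_finsetSum]
  · simp only [integral_rate_loop]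
    rw [Finset.sum_ite_eq, if_pos (Finset.mem_univ _)]
  · intro i _
    exact (((D.continuous_rate_path _ i).mul
      ((G i).continuous.comp h.path.continuous_u)).mul h.path.continuous_u').intervalIntegrable _ _

end Arrangement
end SepVar

end

/-! ### Construction of good arrangements -/

section

namespace SepVar

/-- The kernel of a linear map does not grow under small perturbations. -/
theorem eventually_ker_le {X V F : Type*} [TopologicalSpace X] [AddCommGroup V] [Module ℂ V]
    [FiniteDimensional ℂ V] [NormedAddCommGroup F] [NormedSpace ℂ F] (A : X → V →ₗ[ℂ] F) (x₀ : X)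
    (hA : ∀ v, ContinuousAt (fun x => A x v) x₀)
    (hker : ∀ x, LinearMap.ker (A x₀) ≤ LinearMap.ker (A x)) :
    ∀ᶠ x in 𝓝 x₀, LinearMap.ker (A x) ≤ LinearMap.ker (A x₀) := by
  -- On a complement E of the kernel the map A x₀ is injective. Linear independence of the images of
  -- a basis of E is an open condition, so A x stays injective on E, and by `hker` its kernel lies
  -- in that of A x₀.
  obtain ⟨E, hE⟩ := Submodule.exists_isCompl (LinearMap.ker (A x₀))
  set v := Module.finBasis ℂ E with hv
  have hli : LinearIndependent ℂ fun i => A x₀ (v i) := by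
    exact v.linearIndependent.map' (A x₀ ∘ₗ E.subtype) (LinearMap.ker_eq_bot'.mpr fun x hx =>
      Subtype.ext (Submodule.disjoint_def.mp hE.disjoint x hx x.2))
  have hc : ContinuousAt (fun x => fun i => A x (v i)) x₀ := continuousAt_pi.mpr fun i => hA _
  filter_upwards [hc.eventually (isOpen_setOfPred_linearIndependent.mem_nhds hli)] with x hx
  intro w hw
  obtain ⟨e, he, e', he', rfl⟩ := Submodule.mem_sup.mp (hE.sup_eq_top ▸ Submodule.mem_top (x := w))
  have h1 : A x e' = 0 := by
    have h2 := hker x he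
    rw [LinearMap.mem_ker] at hw h2
    rwa [map_add, h2, zero_add] at hw
  have h3 : e' = 0 := by
    have h4 := v.sum_repr ⟨e', he'⟩
    have h5 : ∑ i, v.repr ⟨e', he'⟩ i • A x (v i) = 0 := by
      have h7 := congrArg (A x ∘ₗ E.subtype) h4
      simp only [map_sum, map_smul, LinearMap.comp_apply, Submodule.subtype_apply] at h7
      rw [h7, h1]
    have h6 := Fintype.linearIndependent_iff.mp hx _ h5
    simp only [h6, zero_smul, Finset.sum_const_zero] at h4
    exact (congrArg Subtype.val h4).symm
  rw [h3, add_zero]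
  exact he

/-- Circles through the origin that separate a point of the unit circle from finitely many others. -/
theorem exists_isSimpleLoop {ι : Type} [Finite ι] {c : ι → ℂ} (hinj : Function.Injective c)
    (hc : ∀ j, ‖c j‖ = 1) (a : ι) : ∃ q, IsSimpleLoop c q a := by
  -- For s = 1/2 the circle about s c_a through 0 touches the unit circle from inside, at c_a alone,
  -- so the other points are strictly outside. A slightly larger s takes c_a inside.
  have h1 : ∀ j, j ≠ a → ∀ᶠ s : ℝ in 𝓝 (1 / 2), ‖(s : ℂ) * c a‖ < ‖c j - s * c a‖ := by
    intro j hj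
    refine ContinuousAt.eventually_lt (by fun_prop) (by fun_prop) ?_
    have hne : c j - c a ≠ 0 := sub_ne_zero.mpr fun h => hj (hinj h)
    have e1 := Complex.sq_norm (c j)
    have e2 := Complex.sq_norm (c a)
    have e3 : 0 < ‖c j - c a‖ ^ 2 := by positivity
    rw [Complex.sq_norm] at e3
    rw [hc] at e1 e2
    refine lt_of_pow_lt_pow_left₀ 2 (norm_nonneg _) ?_
    rw [Complex.sq_norm, Complex.sq_norm]
    simp only [Complex.normSq_apply, Complex.sub_re, Complex.sub_im, Complex.mul_re, Complex.mul_im,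
      Complex.ofReal_re, Complex.ofReal_im] at *
    nlinarith
  have h2 : ∀ᶠ s : ℝ in 𝓝 (1 / 2), ∀ j, j ≠ a → ‖(s : ℂ) * c a‖ < ‖c j - s * c a‖ := by
    rw [eventually_all]
    intro j
    by_cases hj : j = a
    · exact Eventually.of_forall fun s h => (h hj).elim
    · filter_upwards [h1 j hj] with s hs _ using hs
  have h3 : ∀ᶠ s : ℝ in 𝓝[>] (1 / 2), s < 1 :=
    (eventually_lt_nhds (by norm_num)).filter_mono nhdsWithin_le_nhds
  obtain ⟨s, hs, hs1, hs2⟩ := ((h2.filter_mono (nhdsWithin_le_nhds (s := Ioi (1 / 2 : ℝ)))).and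
    (h3.and eventually_mem_nhdsWithin)).exists
  refine ⟨s * c a, ?_, hs⟩
  have hs2 : 1 / 2 < s := hs2
  have e : c a - s * c a = ((1 - s : ℝ) : ℂ) * c a := by push_cast; ring
  rw [e, norm_mul, norm_mul, hc, Complex.norm_real, Complex.norm_real, Real.norm_eq_abs,
    Real.norm_eq_abs, abs_of_pos (by linarith), abs_of_pos (by linarith)]
  linarith

/-- Four residues with negative real part that generate a dense subgroup. -/
theorem dense_closure_residues {s : Set ℂ} (h1 : -1 ∈ s) (h2 : -(√2 : ℂ) ∈ s)
    (h3 : -1 + Complex.I ∈ s) (h4 : (√2 : ℂ) * (-1 + Complex.I) ∈ s) :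
    Dense (AddSubgroup.closure s : Set ℂ) := by
  -- The pair -1, -√2 generates a dense subgroup of ℝ because √2 is irrational. The other two
  -- residues are the same pair times 1 - i, a second real direction.
  have hd : Dense (AddSubgroup.closure {(-1 : ℝ), -√2} : Set ℝ) := by
    rw [dense_addSubgroupClosure_pair_iff, neg_div_neg_eq, one_div, irrational_inv_iff]
    exact irrational_sqrt_two
  have hr : ∀ x ∈ AddSubgroup.closure {(-1 : ℝ), -√2}, (x : ℂ) ∈ AddSubgroup.closure s := by
    intro x hx
    induction hx using AddSubgroup.closure_induction with
    | mem x hx =>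
      rcases hx with rfl | rfl
      · exact AddSubgroup.subset_closure (by push_cast; exact h1)
      · exact AddSubgroup.subset_closure (by push_cast; exact h2)
    | zero => simp
    | add x y _ _ hx hy => push_cast; exact add_mem hx hy
    | neg x _ hx => push_cast; exact neg_mem hx
  have hi : ∀ x ∈ AddSubgroup.closure {(-1 : ℝ), -√2},
      (x : ℂ) * (1 - Complex.I) ∈ AddSubgroup.closure s := by
    intro x hx
    induction hx using AddSubgroup.closure_induction with
    | mem x hx =>
      rcases hx with rfl | rfl
      · exact AddSubgroup.subset_closure (by push_cast; convert h3 using 1; ring)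
      · exact AddSubgroup.subset_closure (by push_cast; convert h4 using 1; ring)
    | zero => simp
    | add x y _ _ hx hy => push_cast; rw [add_mul]; exact add_mem hx hy
    | neg x _ hx => push_cast; rw [neg_mul]; exact neg_mem hx
  have hf : Continuous fun w : ℝ × ℝ => (w.1 : ℂ) + w.2 * (1 - Complex.I) := by fun_prop
  have hsurj : Function.Surjective fun w : ℝ × ℝ => (w.1 : ℂ) + w.2 * (1 - Complex.I) := by
    intro z
    refine ⟨(z.re + z.im, -z.im), ?_⟩
    apply Complex.ext <;> simp
  refine (hsurj.denseRange.dense_image hf (hd.prod hd)).mono ?_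
  rintro _ ⟨⟨x, y⟩, ⟨hx, hy⟩, rfl⟩
  exact add_mem (hr x hx) (hi y hy)

namespace Arrangement

variable {m : ℕ} {ι : Type} [Fintype ι] [DecidableEq ι] (D : Arrangement m ι) {q : ι → ℂ}
  (h : ∀ a, IsSimpleLoop D.c (q a) a)

/-- The exponential maps ℂ^(m+1) continuously and homomorphically onto (ℂ*)^(m+1). The preimage of G
is an additive group containing the residues in their coordinates, hence a dense product of
subgroups. -/
theorem exists_mem_holonomy_close {τ : ℂ} (hτ : τ ≠ 0)
    (hd : ∀ i, Dense (AddSubgroup.closure {z | ∃ a, D.blk a = i ∧ z = D.lam a} : Set ℂ))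
    {G : Set (Fin (m + 1) → ℂ)} (h1 : 1 ∈ G) (hmul : ∀ e ∈ G, ∀ e' ∈ G, e * e' ∈ G)
    (hinv : ∀ e ∈ G, e⁻¹ ∈ G)
    (hG : ∀ a, (D.scale τ).mult (D.scalePath (h a).path τ) 1 ∈ G)
    (v : Fin (m + 1) → ℂ) (hv : ∀ i, v i ≠ 0) {ε : ℝ} (hε : 0 < ε) : ∃ e ∈ G, ‖e - v‖ < ε := by
  have hpi : (2 * Real.pi * Complex.I * τ : ℂ) ≠ 0 := by
    simp [Real.pi_ne_zero, hτ]
  set E : (Fin (m + 1) → ℂ) → Fin (m + 1) → ℂ :=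
    fun g i => Complex.exp (2 * Real.pi * Complex.I * τ * g i) with hE
  have hEc : Continuous E := by fun_prop
  let A : AddSubgroup (Fin (m + 1) → ℂ) :=
    { carrier := {g | E g ∈ G}
      zero_mem' := by
        have : E 0 = 1 := by funext i; simp [hE]
        rwa [mem_ofPred_eq, this]
      add_mem' := by
        intro g g' hg hg'
        have : E (g + g') = E g * E g' := by
          funext i; simp [hE, mul_add, Complex.exp_add]
        rw [mem_ofPred_eq, this]
        exact hmul _ hg _ hg'
      neg_mem' := by
        intro g hg
        have : E (-g) = (E g)⁻¹ := by
          funext i; simp [hE, Complex.exp_neg]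
        rw [mem_ofPred_eq, this]
        exact hinv _ hg }
  have hgen : ∀ a, Pi.single (D.blk a) (D.lam a) ∈ A := by
    intro a
    have : E (Pi.single (D.blk a) (D.lam a)) =
        (D.scale τ).mult (D.scalePath (h a).path τ) 1 := by
      funext i
      rw [mult, logCoord_scale, logCoord_loop]
      by_cases hi : D.blk a = i
      · subst hi
        simp only [hE, Pi.single_eq_same, if_true]
        congr 1
        ring
      · simp [hE, hi]
    change E _ ∈ G
    rw [this]
    exact hG a
  have hsingle : ∀ i, ∀ x ∈ AddSubgroup.closure {z | ∃ a, D.blk a = i ∧ z = D.lam a},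
      Pi.single i x ∈ A := by
    intro i x hx
    have : AddSubgroup.closure {z | ∃ a, D.blk a = i ∧ z = D.lam a} ≤
        A.comap (AddMonoidHom.single (fun _ : Fin (m + 1) => ℂ) i) := by
      rw [AddSubgroup.closure_le]
      rintro z ⟨a, rfl, rfl⟩
      exact hgen a
    exact this hx
  have hdense : Dense (univ.pi fun i =>
      (AddSubgroup.closure {z | ∃ a, D.blk a = i ∧ z = D.lam a} : Set ℂ)) :=
    dense_pi _ fun i _ => hd i
  set w : Fin (m + 1) → ℂ := fun i => Complex.log (v i) / (2 * Real.pi * Complex.I * τ) with hw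
  have hEw : E w = v := by
    funext i
    simp only [hE, hw]
    rw [mul_div_cancel₀ _ hpi, Complex.exp_log (hv i)]
  have hopen : IsOpen (E ⁻¹' Metric.ball v ε) := Metric.isOpen_ball.preimage hEc
  obtain ⟨x, hx, hxm⟩ := hdense.inter_open_nonempty _ hopen ⟨w, by
    rw [mem_preimage, hEw]; exact Metric.mem_ball_self hε⟩
  refine ⟨E x, ?_, by rw [← dist_eq_norm]; exact hx⟩
  have hxA : x ∈ A := by
    rw [← Finset.univ_sum_single x]
    exact sum_mem fun i _ => hsingle i _ (hxm i (mem_univ i))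
  exact hxA

include h in
/-- For residues that are small compared with the exponents and the degrees, the integrals over
commutators of simple loops detect all tuples of polynomials that are not exact. -/
theorem eventually_exists_eq_const (hinj : Function.Injective D.c) (hlam : ∀ j, D.lam j ≠ 0) {n : ℕ}
    (hn : ∀ i, n ≤ (Finset.univ.filter fun j => D.blk j = i).card) (hblk : ∀ i, ∃ j, D.blk j = i)
    {k : Fin (m + 1) → ℂ} (hk : k ≠ 0) :
    ∀ᶠ τ in 𝓝 (0 : ℂ), ∀ G : Fin (m + 1) → Polynomial ℂ, (∀ i, G i ∈ Polynomial.degreeLT ℂ n) →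
      (∀ a a', D.wintDiv (h a).path k τ G *
          D.wintDiv (h a').path k τ (fun i => Polynomial.C (k i)) =
        D.wintDiv (h a').path k τ G * D.wintDiv (h a).path k τ (fun i => Polynomial.C (k i))) →
      ∃ f, ∀ i, G i = Polynomial.C (k i * f) := by
  set K : Fin (m + 1) → Polynomial ℂ := fun i => Polynomial.C (k i) with hK
  let v : (Fin (m + 1) → Polynomial.degreeLT ℂ n) → Fin (m + 1) → Polynomial ℂ := fun G i => G i
  -- The condition on all pairs of loops, as a linear map depending on τ, so that semicontinuity of
  -- the kernel applies.
  let A : ℂ → (Fin (m + 1) → Polynomial.degreeLT ℂ n) →ₗ[ℂ] (ι × ι → ℂ) := fun τ =>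
    { toFun := fun G w => D.wintDiv (h w.1).path k τ (v G) * D.wintDiv (h w.2).path k τ K -
        D.wintDiv (h w.2).path k τ (v G) * D.wintDiv (h w.1).path k τ K
      map_add' := fun G G' => by
        have : v (G + G') = v G + (1 : ℂ) • v G' := by funext i; simp [v]
        funext w
        simp only [this, wintDiv_add_smul, Pi.add_apply]
        ring
      map_smul' := fun r G => by
        have : v (r • G) = r • v G := by funext i; simp [v]
        funext w
        simp only [this, wintDiv_smul, Pi.smul_apply, RingHom.id_apply, smul_eq_mul]
        ring }
  have hA : ∀ τ G w, A τ G w = D.wintDiv (h w.1).path k τ (v G) * D.wintDiv (h w.2).path k τ K -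
        D.wintDiv (h w.2).path k τ (v G) * D.wintDiv (h w.1).path k τ K := fun _ _ _ => rfl
  -- At τ = 0 the condition compares values at the points, so that G_i equals k_i f at all points of
  -- its block. There are at least n of them and deg G_i < n.
  have hker0 : ∀ G, A 0 G = 0 → ∃ f, ∀ i, v G i = Polynomial.C (k i * f) := by
    intro G hG
    obtain ⟨i', hi'⟩ := Function.ne_iff.mp hk
    obtain ⟨a', ha'⟩ := hblk i'
    have hval : ∀ a, (v G (D.blk a)).eval (D.c a) = k (D.blk a) * ((v G i').eval (D.c a') / k i') := by
      intro a
      have h1 := congrFun hG (a, a')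
      rw [hA] at h1
      simp only [wintDiv_loop_zero, Pi.zero_apply, ha', hK, Polynomial.eval_C] at h1
      have h2 : (2 * Real.pi * Complex.I : ℂ) ≠ 0 := Complex.two_pi_I_ne_zero
      have h3 := hlam a
      have h4 := hlam a'
      rw [Pi.zero_apply] at hi'
      have h5 : (2 * Real.pi * Complex.I) ^ 2 * D.lam a * D.lam a' *
          ((v G (D.blk a)).eval (D.c a) * k i' - (v G i').eval (D.c a') * k (D.blk a)) = 0 := by
        linear_combination h1
      have h6 := (mul_eq_zero.mp h5).resolve_left (by simp [h3, h4, Real.pi_ne_zero])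
      field_simp
      linear_combination h6
    refine ⟨(v G i').eval (D.c a') / k i', fun i => ?_⟩
    refine sub_eq_zero.mp ?_
    refine Polynomial.eq_zero_of_degree_lt_of_eval_index_eq_zero
      (Finset.univ.filter fun j => D.blk j = i) (v := D.c) hinj.injOn ?_ ?_
    · have hle : n ≤ (Finset.univ.filter fun j => D.blk j = i).card := hn i
      have h1 : (v G i).degree < n := Polynomial.mem_degreeLT.mp (G i).2
      have h2 : ((Finset.univ.filter fun j => D.blk j = i).card : WithBot ℕ) ≥ n := by
        exact_mod_cast hle
      obtain ⟨j, hj⟩ := hblk i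
      have h3 : 0 < (Finset.univ.filter fun j => D.blk j = i).card :=
        Finset.card_pos.mpr ⟨j, by simp [hj]⟩
      refine (Polynomial.degree_sub_le _ _).trans_lt (max_lt (h1.trans_le h2) ?_)
      exact Polynomial.degree_C_le.trans_lt (by exact_mod_cast h3)
    · intro j hj
      have hj' : D.blk j = i := by simpa using hj
      subst hj'
      rw [Polynomial.eval_sub, Polynomial.eval_C, hval j, sub_self]
  -- Multiples of the tuple k satisfy the condition for every τ.
  have hE : ∀ τ, LinearMap.ker (A 0) ≤ LinearMap.ker (A τ) := by
    intro τ G hG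
    obtain ⟨f, hf⟩ := hker0 G hG
    have hvG : v G = f • K := by
      funext i
      rw [hf, hK, Pi.smul_apply, Polynomial.smul_C, smul_eq_mul, mul_comm]
    rw [LinearMap.mem_ker]
    funext w
    rw [hA, hvG, wintDiv_smul, wintDiv_smul, Pi.zero_apply]
    ring
  have hcont : ∀ G, ContinuousAt (fun τ => A τ G) 0 := by
    intro G
    refine (continuous_pi fun w => ?_).continuousAt
    simp only [hA]
    exact ((D.continuous_wintDiv _ _ _).mul (D.continuous_wintDiv _ _ _)).sub
      ((D.continuous_wintDiv _ _ _).mul (D.continuous_wintDiv _ _ _))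
  filter_upwards [eventually_ker_le A 0 hcont hE] with τ hτ G hG hcond
  have hmem : (fun i => ⟨G i, hG i⟩ : Fin (m + 1) → Polynomial.degreeLT ℂ n) ∈
      LinearMap.ker (A τ) := by
    rw [LinearMap.mem_ker]
    funext w
    rw [hA]
    exact sub_eq_zero.mpr (hcond w.1 w.2)
  exact hker0 _ (hτ hmem)

/-- An arrangement with loops at the origin whose multipliers generate a dense group and whose
commutators detect all tuples of polynomials of bounded degree that are not exact. -/
structure IsGood {ι : Type} [Fintype ι] [DecidableEq ι] (D : Arrangement m ι)
    (ℓ : ι → UPath D.c) (n : ℕ) : Prop where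
  norm_c : ∀ j, ‖D.c j‖ = 1
  re_lam_neg : ∀ j, (D.lam j).re < 0
  sum_lam_lt : ∑ j, ‖D.lam j‖ < 1
  injective_c : Function.Injective D.c
  loop_zero : ∀ a, (ℓ a).u 0 = 0
  loop_one : ∀ a, (ℓ a).u 1 = 0
  dense : ∀ G : Set (Fin (m + 1) → ℂ), 1 ∈ G → (∀ e ∈ G, ∀ e' ∈ G, e * e' ∈ G) →
    (∀ e ∈ G, e⁻¹ ∈ G) → (∀ a, D.mult (ℓ a) 1 ∈ G) →
    ∀ v : Fin (m + 1) → ℂ, (∀ i, v i ≠ 0) → ∀ ε > 0, ∃ e ∈ G, ‖e - v‖ < ε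
  exists_eq_const : ∀ k : Fin (m + 1) → ℕ, k ≠ 0 → (∀ i, k i ≤ n) →
    ∀ G : Fin (m + 1) → Polynomial ℂ, (∀ i, G i ∈ Polynomial.degreeLT ℂ n) →
      (∀ a a', D.wint (ℓ a) (fun i => k i) G * (Complex.exp (D.wlog (ℓ a') (fun i => k i) 1) - 1) =
        D.wint (ℓ a') (fun i => k i) G * (Complex.exp (D.wlog (ℓ a) (fun i => k i) 1) - 1)) →
      ∃ f : ℂ, ∀ i, G i = Polynomial.C (k i * f)

/-- The points are roots of unity, n + 4 per coordinate: at least n, to determine polynomials of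
degree below n, and at least four, to carry residues that generate a dense subgroup. Scaling all
residues by a small τ > 0 makes their sum small and the commutator condition effective; it keeps the
signs of the real parts. -/
theorem exists_isGood (m n : ℕ) : ∃ (D : Arrangement m (Fin (m + 1) × Fin (n + 4)))
    (ℓ : Fin (m + 1) × Fin (n + 4) → UPath D.c), D.IsGood ℓ n := by
  obtain ⟨c, hinj, hc⟩ : ∃ c : Fin (m + 1) × Fin (n + 4) → ℂ,
      Function.Injective c ∧ ∀ j, ‖c j‖ = 1 := by
    have hN : Fintype.card (Fin (m + 1) × Fin (n + 4)) ≠ 0 := Fintype.card_ne_zero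
    have hζ := Complex.isPrimitiveRoot_exp _ hN
    set ζ := Complex.exp (2 * Real.pi * Complex.I / Fintype.card (Fin (m + 1) × Fin (n + 4)))
    refine ⟨fun j => ζ ^ (Fintype.equivFin _ j : ℕ), fun j j' h => ?_, fun j => ?_⟩
    · exact (Fintype.equivFin _).injective (Fin.ext (hζ.pow_inj (Fin.is_lt _) (Fin.is_lt _) h))
    · rw [norm_pow, hζ.norm'_eq_one hN, one_pow]
  let α : Fin (n + 4) → ℂ := fun b => if b.val = 1 then -(√2 : ℂ) else
    if b.val = 2 then -1 + Complex.I else if b.val = 3 then (√2 : ℂ) * (-1 + Complex.I) else -1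
  have hα : ∀ b, (α b).re < 0 := by
    intro b
    simp only [α]
    split_ifs <;> simp
  let D : Arrangement m (Fin (m + 1) × Fin (n + 4)) := ⟨c, fun j => α j.2, fun j => j.1⟩
  have hsl := fun a => exists_isSimpleLoop (c := D.c) hinj hc a
  choose q hq using hsl
  have hlam : ∀ j, D.lam j ≠ 0 := fun j hj => by
    have := hα j.2
    simp only [D] at hj
    rw [hj] at this
    simp at this
  have hcard : ∀ i, n ≤ (Finset.univ.filter fun j => D.blk j = i).card := by
    intro i
    have h1 : (Finset.univ.map (Function.Embedding.sectR i (Fin (n + 4)))) ⊆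
        Finset.univ.filter fun j => D.blk j = i := by
      intro j hj
      obtain ⟨b, -, rfl⟩ := Finset.mem_map.mp hj
      simp [D]
    have := Finset.card_le_card h1
    rw [Finset.card_map, Finset.card_univ, Fintype.card_fin] at this
    omega
  have hblk : ∀ i, ∃ j, D.blk j = i := fun i => ⟨(i, 0), rfl⟩
  -- The weights k are bounded by n, so they are finite in number and one τ serves all.
  have hkey : ∀ᶠ τ in 𝓝 (0 : ℂ), ∀ k ∈ {k : Fin (m + 1) → ℕ | ∀ i, k i ≤ n}, k ≠ 0 →
      ∀ G : Fin (m + 1) → Polynomial ℂ, (∀ i, G i ∈ Polynomial.degreeLT ℂ n) →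
      (∀ a a', D.wintDiv (hq a).path (fun i => k i) τ G *
          D.wintDiv (hq a').path (fun i => k i) τ (fun i => Polynomial.C (k i : ℂ)) =
        D.wintDiv (hq a').path (fun i => k i) τ G *
          D.wintDiv (hq a).path (fun i => k i) τ (fun i => Polynomial.C (k i : ℂ))) →
      ∃ f : ℂ, ∀ i, G i = Polynomial.C (k i * f) := by
    have hfin : {k : Fin (m + 1) → ℕ | ∀ i, k i ≤ n}.Finite := Set.finite_Iic (fun _ => n)
    rw [eventually_all_finite hfin]
    intro k _
    by_cases hk : k = 0
    · exact Eventually.of_forall fun τ h => (h hk).elim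
    · have hk' : (fun i => (k i : ℂ)) ≠ 0 := fun h => hk (funext fun i => by
        have := congrFun h i
        simpa using this)
      filter_upwards [D.eventually_exists_eq_const hq hinj hlam hcard hblk hk'] with τ hτ _ using hτ
  have hsum : ∀ᶠ τ in 𝓝 (0 : ℂ), ∑ j, ‖τ * D.lam j‖ < 1 := by
    have : ContinuousAt (fun τ : ℂ => ∑ j, ‖τ * D.lam j‖) 0 := by fun_prop
    exact this.eventually_lt continuousAt_const (by simp)
  have hτ0 : Tendsto (fun τ : ℝ => (τ : ℂ)) (𝓝[>] 0) (𝓝 0) := by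
    have : Tendsto (fun τ : ℝ => (τ : ℂ)) (𝓝 0) (𝓝 0) := by
      simpa using (Complex.continuous_ofReal.tendsto 0)
    exact this.mono_left nhdsWithin_le_nhds
  obtain ⟨τ, ⟨hτk, hτs⟩, hτp⟩ := ((hτ0.eventually (hkey.and hsum)).and
    eventually_mem_nhdsWithin).exists
  have hτp : 0 < τ := hτp
  have hτne : (τ : ℂ) ≠ 0 := by exact_mod_cast hτp.ne'
  refine ⟨D.scale τ, fun a => D.scalePath (hq a).path τ, hc, fun j => ?_, hτs, hinj,
    fun a => loopFun_zero _, fun a => loopFun_one _, ?_, ?_⟩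
  · simp only [scale, Complex.mul_re, Complex.ofReal_re, Complex.ofReal_im, zero_mul, sub_zero]
    exact mul_neg_of_pos_of_neg hτp (hα j.2)
  · intro G h1 hmul hinv hG v hv ε hε
    refine D.exists_mem_holonomy_close hq hτne (fun i => ?_) h1 hmul hinv hG v hv hε
    refine dense_closure_residues ⟨(i, ⟨0, by omega⟩), rfl, ?_⟩ ⟨(i, ⟨1, by omega⟩), rfl, ?_⟩
      ⟨(i, ⟨2, by omega⟩), rfl, ?_⟩ ⟨(i, ⟨3, by omega⟩), rfl, ?_⟩ <;> simp [D, α]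
  · intro k hk hkn G hG hcond
    refine hτk k hkn hk G hG fun a a' => ?_
    have h := hcond a a'
    rw [← mul_one (Complex.exp _ - 1), ← mul_one (Complex.exp _ - 1)] at h
    -- The factors exp - 1 are weighted integrals of the tuple k. This brings the condition into the
    -- form of `hτk`, up to a factor τ².
    have hw := fun a => (D.scale τ).wint_const (D.scalePath (hq a).path τ) (fun i => k i) 1
    simp only [mul_one, one_mul] at hw h
    rw [← hw, ← hw] at h
    simp only [wint_scale] at h
    have h2 : (τ : ℂ) * τ ≠ 0 := mul_ne_zero hτne hτne
    refine mul_left_cancel₀ h2 ?_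
    linear_combination h

end Arrangement
end SepVar

end

/-! ### Polynomial forms under the substitution x_last = u y_0 -/

section

namespace SepVar

variable {m : ℕ}

/-- The substitution `x_i = y_i`, `x_(m+1) = u * y_0`, with `u` as the variable of the
coefficients. -/
def subst (m : ℕ) : MvPolynomial (Fin (m + 2)) ℂ →ₐ[ℂ] MvPolynomial (Fin (m + 1)) (Polynomial ℂ) :=
  MvPolynomial.aeval fun l => Fin.lastCases (motive := fun _ => MvPolynomial (Fin (m + 1)) _)
    (MvPolynomial.C Polynomial.X * MvPolynomial.X 0) (fun i => MvPolynomial.X i) l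

theorem subst_X_castSucc (i : Fin (m + 1)) :
    subst m (MvPolynomial.X i.castSucc) = MvPolynomial.X i := by
  rw [subst, MvPolynomial.aeval_X, Fin.lastCases_castSucc]

theorem subst_X_last : subst m (MvPolynomial.X (Fin.last (m + 1))) =
    MvPolynomial.C Polynomial.X * MvPolynomial.X 0 := by
  rw [subst, MvPolynomial.aeval_X, Fin.lastCases_last]

theorem subst_C (a : ℂ) : subst m (MvPolynomial.C a) = MvPolynomial.C (Polynomial.C a) := by
  rw [subst, MvPolynomial.aeval_C]
  rfl

/-- The exponents of `y` in a monomial after the substitution. -/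
def weight (K : Fin (m + 2) →₀ ℕ) : Fin (m + 1) →₀ ℕ :=
  Finsupp.equivFunOnFinite.symm (fun i => K i.castSucc) + Finsupp.single 0 (K (Fin.last (m + 1)))

theorem weight_apply (K : Fin (m + 2) →₀ ℕ) (i : Fin (m + 1)) :
    weight K i = K i.castSucc + if i = 0 then K (Fin.last (m + 1)) else 0 := by
  rw [weight, Finsupp.add_apply, Finsupp.single_apply]
  simp [eq_comm]

theorem weight_add (K K' : Fin (m + 2) →₀ ℕ) : weight (K + K') = weight K + weight K' := by
  ext i
  simp only [weight_apply, Finsupp.add_apply]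
  split_ifs <;> ring

theorem weight_single_castSucc (i : Fin (m + 1)) :
    weight (Finsupp.single i.castSucc 1) = Finsupp.single i 1 := by
  ext j
  simp only [weight_apply, Finsupp.single_apply, Fin.castSucc_inj]
  simp [(Fin.castSucc_lt_last i).ne]

theorem weight_single_last :
    weight (Finsupp.single (Fin.last (m + 1)) 1) = Finsupp.single 0 1 := by
  ext j
  simp only [weight_apply, Finsupp.single_apply]
  simp [(Fin.castSucc_lt_last j).ne', eq_comm]

theorem degree_weight (K : Fin (m + 2) →₀ ℕ) : (weight K).degree = K.degree := by
  rw [Finsupp.degree_eq_sum, Finsupp.degree_eq_sum, Fin.sum_univ_castSucc (n := m + 1)]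
  simp only [weight_apply, Finset.sum_add_distrib]
  simp

theorem eq_of_weight_eq {K K' : Fin (m + 2) →₀ ℕ} (h : weight K = weight K')
    (h' : K (Fin.last (m + 1)) = K' (Fin.last (m + 1))) : K = K' := by
  ext l
  refine Fin.lastCases h' (fun i => ?_) l
  have := DFunLike.congr_fun h i
  rw [weight_apply, weight_apply, h'] at this
  omega

theorem subst_monomial (K : Fin (m + 2) →₀ ℕ) (a : ℂ) :
    subst m (MvPolynomial.monomial K a) =
      MvPolynomial.monomial (weight K) (Polynomial.monomial (K (Fin.last (m + 1))) a) := by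
  rw [subst, MvPolynomial.aeval_monomial, MvPolynomial.monomial_eq (s := weight K),
    Finsupp.prod_fintype _ _ (fun _ => pow_zero _), Finsupp.prod_fintype _ _ (fun _ => pow_zero _),
    Fin.prod_univ_castSucc]
  simp only [Fin.lastCases_castSucc, Fin.lastCases_last, weight_apply, pow_add,
    Finset.prod_mul_distrib, pow_ite, pow_zero, Finset.prod_ite_eq', Finset.mem_univ, if_true]
  rw [MvPolynomial.algebraMap_apply, ← Polynomial.C_mul_X_pow_eq_monomial, map_mul, map_pow,
    Polynomial.algebraMap_eq, mul_pow]
  ring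

/-- A monomial is determined by its weight and its exponent of u, so the substitution merges no
coefficients. -/
theorem coeff_subst (P : MvPolynomial (Fin (m + 2)) ℂ) (K : Fin (m + 2) →₀ ℕ) :
    ((subst m P).coeff (weight K)).coeff (K (Fin.last (m + 1))) = P.coeff K := by
  induction P using MvPolynomial.induction_on' with
  | monomial K' a =>
    rw [subst_monomial, MvPolynomial.coeff_monomial, MvPolynomial.coeff_monomial]
    by_cases h : K' = K
    · subst h; simp
    · rw [if_neg h]
      by_cases hw : weight K' = weight K
      · rw [if_pos hw, Polynomial.coeff_monomial, if_neg fun hl => h (eq_of_weight_eq hw hl)]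
      · rw [if_neg hw, Polynomial.coeff_zero]
  | add p q hp hq => simp [hp, hq]

/-- Each factor u arrives with a factor y_0. -/
theorem natDegree_coeff_subst (P : MvPolynomial (Fin (m + 2)) ℂ) (k : Fin (m + 1) →₀ ℕ) :
    ((subst m P).coeff k).natDegree ≤ k 0 := by
  induction P using MvPolynomial.induction_on' with
  | monomial K' a =>
    rw [subst_monomial, MvPolynomial.coeff_monomial]
    split_ifs with h
    · refine (Polynomial.natDegree_monomial_le _).trans ?_
      rw [← h, weight_apply]
      simp
    · simp
  | add p q hp hq =>
    rw [map_add, MvPolynomial.coeff_add]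
    exact (Polynomial.natDegree_add_le _ _).trans (max_le hp hq)

theorem eval_subst (P : MvPolynomial (Fin (m + 2)) ℂ) (u : ℂ) (y : Fin (m + 1) → ℂ) :
    MvPolynomial.eval y (MvPolynomial.map (Polynomial.evalRingHom u) (subst m P)) =
      MvPolynomial.eval (pt u y) P := by
  induction P using MvPolynomial.induction_on with
  | C a =>
    rw [subst_C, MvPolynomial.map_C, MvPolynomial.eval_C, MvPolynomial.eval_C,
      Polynomial.coe_evalRingHom, Polynomial.eval_C]
  | add p q hp hq => rw [map_add, map_add, map_add, map_add, hp, hq]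
  | mul_X p l hp =>
    have hl : MvPolynomial.eval y (MvPolynomial.map (Polynomial.evalRingHom u)
        (subst m (MvPolynomial.X l))) = pt u y l := by
      induction l using Fin.lastCases with
      | last => rw [subst_X_last, map_mul, map_mul, MvPolynomial.map_C, MvPolynomial.map_X,
        MvPolynomial.eval_C, MvPolynomial.eval_X, Polynomial.coe_evalRingHom, Polynomial.eval_X,
        pt_last]
      | cast i => rw [subst_X_castSucc, MvPolynomial.map_X, MvPolynomial.eval_X, pt_castSucc]
    rw [map_mul, map_mul, map_mul, map_mul, hp, MvPolynomial.eval_X, hl]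

theorem exists_polynomial_primitive (A : Polynomial ℂ) :
    ∃ p : Polynomial ℂ, p.derivative = A ∧ p.eval 0 = 0 ∧ p.natDegree ≤ A.natDegree + 1 := by
  refine ⟨∑ j ∈ Finset.range (A.natDegree + 1), Polynomial.monomial (j + 1) (A.coeff j / (j + 1)),
    ?_, ?_, ?_⟩
  · conv_rhs => rw [A.as_sum_range]
    rw [Polynomial.derivative_sum]
    refine Finset.sum_congr rfl fun j _ => ?_
    rw [Polynomial.derivative_monomial]
    have : (j : ℂ) + 1 ≠ 0 := Nat.cast_add_one_ne_zero j
    congr 1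
    push_cast
    field_simp
  · simp [Polynomial.eval_finsetSum]
  · refine Polynomial.natDegree_sum_le_of_forall_le _ _ fun j hj => ?_
    refine (Polynomial.natDegree_monomial_le _).trans ?_
    have := Finset.mem_range.mp hj
    omega

/-- The primitive that vanishes at the origin. -/
def primitive (A : Polynomial ℂ) : Polynomial ℂ := (exists_polynomial_primitive A).choose

theorem derivative_primitive (A : Polynomial ℂ) : (primitive A).derivative = A :=
  (exists_polynomial_primitive A).choose_spec.1

theorem eval_zero_primitive (A : Polynomial ℂ) : (primitive A).eval 0 = 0 :=
  (exists_polynomial_primitive A).choose_spec.2.1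

theorem natDegree_primitive_le (A : Polynomial ℂ) : (primitive A).natDegree ≤ A.natDegree + 1 :=
  (exists_polynomial_primitive A).choose_spec.2.2

theorem primitive_zero : primitive 0 = 0 := by
  have h := derivative_primitive 0
  rw [Polynomial.eq_C_of_derivative_eq_zero h]
  have h0 := eval_zero_primitive 0
  rw [Polynomial.eq_C_of_derivative_eq_zero h, Polynomial.eval_C] at h0
  rw [h0, map_zero]

section Rows

variable (P : Fin (m + 2) → MvPolynomial (Fin (m + 2)) ℂ)

/-- The coefficient of `du` in the form `∑ P_l dx_l` after the substitution. -/
def rowBase : MvPolynomial (Fin (m + 1)) (Polynomial ℂ) :=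
  subst m (P (Fin.last (m + 1))) * MvPolynomial.X 0

/-- The coefficient of `dy_i / y_i` in the form `∑ P_l dx_l` after the substitution. -/
def rowFibre (i : Fin (m + 1)) : MvPolynomial (Fin (m + 1)) (Polynomial ℂ) :=
  (subst m (P i.castSucc) + if i = 0 then
    MvPolynomial.C Polynomial.X * subst m (P (Fin.last (m + 1))) else 0) * MvPolynomial.X i

/-- The tuple of polynomials that is left of the part of weight `k` of the form after an
integration by parts. -/
def reduced (k : Fin (m + 1) →₀ ℕ) (i : Fin (m + 1)) : Polynomial ℂ :=
  (rowFibre P i).coeff k - Polynomial.C (k i : ℂ) * primitive ((rowBase P).coeff k)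

theorem natDegree_coeff_mul_X_le {A : MvPolynomial (Fin (m + 1)) (Polynomial ℂ)} {r : ℕ}
    (hA : ∀ k, (A.coeff k).natDegree ≤ k 0 + r) (i : Fin (m + 1)) (k : Fin (m + 1) →₀ ℕ) :
    ((A * MvPolynomial.X i).coeff k).natDegree ≤ k 0 + r := by
  rw [MvPolynomial.coeff_mul_X']
  split_ifs
  · refine (hA _).trans ?_
    rw [Finsupp.tsub_apply]
    omega
  · simp

/-- The degree in u is at most k 0 + 1, where the extra 1 comes from the term u dy_0 of dx_last and
from the primitive. Because of this bound finitely many points c_j suffice. -/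
theorem reduced_mem_degreeLT (k : Fin (m + 1) →₀ ℕ) {n : ℕ} (hn : k 0 + 1 < n) (i : Fin (m + 1)) :
    reduced P k i ∈ Polynomial.degreeLT ℂ n := by
  have hsub : ∀ Q : MvPolynomial (Fin (m + 2)) ℂ, ∀ k : Fin (m + 1) →₀ ℕ,
      ((subst m Q).coeff k).natDegree ≤ k 0 + 0 := fun Q k => natDegree_coeff_subst Q k
  have h1 : ((rowBase P).coeff k).natDegree ≤ k 0 + 0 := natDegree_coeff_mul_X_le (hsub _) 0 k
  have h2 : ((rowFibre P i).coeff k).natDegree ≤ k 0 + 1 := by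
    refine natDegree_coeff_mul_X_le (fun k => ?_) i k
    rw [MvPolynomial.coeff_add]
    refine (Polynomial.natDegree_add_le _ _).trans
      (max_le ((hsub _ k).trans (by omega)) ?_)
    split_ifs
    · rw [MvPolynomial.coeff_C_mul]
      refine Polynomial.natDegree_mul_le.trans ?_
      have := hsub (P (Fin.last (m + 1))) k
      rw [Polynomial.natDegree_X]
      omega
    · simp
  have h3 : (reduced P k i).natDegree ≤ k 0 + 1 := by
    refine (Polynomial.natDegree_sub_le _ _).trans (max_le h2 ?_)
    refine (Polynomial.natDegree_C_mul_le _ _).trans ((natDegree_primitive_le _).trans ?_)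
    omega
  rw [Polynomial.mem_degreeLT]
  exact (Polynomial.degree_le_of_natDegree_le h3).trans_lt (by exact_mod_cast hn)

/-- Forms with trivial reductions are exact up to the given order. -/
theorem exists_potential {d : ℕ} (h : ∀ k : Fin (m + 1) →₀ ℕ, k ≠ 0 → k.degree ≤ d + 1 →
      ∃ f : ℂ, ∀ i, reduced P k i = Polynomial.C (k i * f)) :
    ∃ f : (Fin (m + 2) →₀ ℕ) → ℂ, ∀ K l, K.degree ≤ d →
      (P l).coeff K = (K l + 1) * f (K + Finsupp.single l 1) := by
  have h' : ∀ k : Fin (m + 1) →₀ ℕ, ∃ F : Polynomial ℂ, k ≠ 0 → k.degree ≤ d + 1 →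
      F.derivative = (rowBase P).coeff k ∧ ∀ i, (rowFibre P i).coeff k = Polynomial.C (k i : ℂ) * F := by
    intro k
    by_cases hk : k ≠ 0 ∧ k.degree ≤ d + 1
    · obtain ⟨f, hf⟩ := h k hk.1 hk.2
      -- The part of weight k of the form is then d(y^k F(u)), with coefficient F' at du and k_i F
      -- at dy_i / y_i.
      refine ⟨primitive ((rowBase P).coeff k) + Polynomial.C f, fun _ _ => ⟨?_, fun i => ?_⟩⟩
      · rw [Polynomial.derivative_add, derivative_primitive, Polynomial.derivative_C, add_zero]
      · have := hf i
        rw [reduced, sub_eq_iff_eq_add] at this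
        rw [this, map_mul]
        ring
    · exact ⟨0, fun h1 h2 => (hk ⟨h1, h2⟩).elim⟩
  choose F hF using h'
  refine ⟨fun N => (F (weight N)).coeff (N (Fin.last (m + 1))), fun K l hK => ?_⟩
  have hw : ∀ i : Fin (m + 1), (weight K + Finsupp.single i 1) ≠ 0 ∧
      (weight K + Finsupp.single i 1).degree ≤ d + 1 := by
    intro i
    refine ⟨fun h => ?_, ?_⟩
    · have := DFunLike.congr_fun h i
      simp at this
    · rw [map_add, degree_weight, Finsupp.degree_single]
      omega
  have hbase : (F (weight K + Finsupp.single 0 1)).derivative =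
      (subst m (P (Fin.last (m + 1)))).coeff (weight K) := by
    rw [(hF _ (hw 0).1 (hw 0).2).1, rowBase, MvPolynomial.coeff_mul_X]
  refine Fin.lastCases ?_ (fun i => ?_) l
  · have e1 := congrArg (fun A => A.coeff (K (Fin.last (m + 1)))) hbase
    simp only [Polynomial.coeff_derivative, coeff_subst] at e1
    simp only [weight_add, weight_single_last, Finsupp.add_apply, Finsupp.single_eq_same]
    rw [← e1]
    ring
  · have hf := (hF _ (hw i).1 (hw i).2).2 i
    rw [rowFibre, MvPolynomial.coeff_mul_X, MvPolynomial.coeff_add] at hf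
    have e2 := congrArg (fun A => A.coeff (K (Fin.last (m + 1)))) hf
    simp only [Polynomial.coeff_add, coeff_subst, Polynomial.coeff_C_mul, Finsupp.add_apply,
      Finsupp.single_eq_same, weight_apply] at e2
    simp only [weight_add, weight_single_castSucc, Finsupp.add_apply,
      Finsupp.single_eq_of_ne (Fin.castSucc_lt_last i).ne', add_zero]
    by_cases hi : i = 0
    · subst hi
      simp only [if_true, MvPolynomial.coeff_C_mul] at e2
      -- In coordinate 0 the weight counts x_0 and x_last together. The surplus, K_last times the
      -- coefficient of the potential, is cancelled by the term u P_last.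
      rcases Nat.eq_zero_or_pos (K (Fin.last (m + 1))) with h0 | h0
      · rw [h0] at e2 ⊢
        simp only [Polynomial.coeff_X_mul_zero, add_zero] at e2
        rw [e2]
        push_cast
        ring
      · obtain ⟨j, hj⟩ : ∃ j, K (Fin.last (m + 1)) = j + 1 := ⟨_, (Nat.succ_pred_eq_of_pos h0).symm⟩
        rw [hj] at e2 ⊢
        have e1 := congrArg (fun A => A.coeff j) hbase
        simp only [Polynomial.coeff_derivative] at e1
        rw [Polynomial.coeff_X_mul, ← e1] at e2
        push_cast at e2 ⊢
        linear_combination e2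
    · simp only [if_neg hi, MvPolynomial.coeff_zero, Polynomial.coeff_zero, add_zero] at e2
      rw [e2]
      push_cast
      ring

end Rows
end SepVar

end

/-! ### The translation of z along a loop up to higher order -/

section

namespace SepVar

variable {m : ℕ}

/-- The weights that occur in the form `∑ P_l dx_l`. -/
def rowSupport (P : Fin (m + 2) → MvPolynomial (Fin (m + 2)) ℂ) : Finset (Fin (m + 1) →₀ ℕ) :=
  (rowBase P).support ∪ Finset.univ.biUnion fun i => (rowFibre P i).support

theorem reduced_eq_zero {P : Fin (m + 2) → MvPolynomial (Fin (m + 2)) ℂ} {k : Fin (m + 1) →₀ ℕ}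
    (hk : k ∉ rowSupport P) : reduced P k = 0 := by
  simp only [rowSupport, Finset.mem_union, Finset.mem_biUnion, Finset.mem_univ, true_and, not_or,
    not_exists, MvPolynomial.notMem_support_iff] at hk
  funext i
  rw [reduced, hk.1, hk.2, primitive_zero, mul_zero, sub_zero, Pi.zero_apply]

theorem eval_map_eval_mul {A : MvPolynomial (Fin (m + 1)) (Polynomial ℂ)}
    {S : Finset (Fin (m + 1) →₀ ℕ)} (hS : A.support ⊆ S) (u : ℂ) (e y : Fin (m + 1) → ℂ) :
    MvPolynomial.eval (e * y) (MvPolynomial.map (Polynomial.evalRingHom u) A) =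
      ∑ k ∈ S, (∏ i, y i ^ k i) * ((∏ i, e i ^ k i) * (A.coeff k).eval u) := by
  rw [MvPolynomial.eval_map, MvPolynomial.eval₂_eq']
  rw [Finset.sum_subset hS fun k _ hk => by
    rw [MvPolynomial.notMem_support_iff.mp hk, map_zero, zero_mul]]
  refine Finset.sum_congr rfl fun k _ => ?_
  simp only [Pi.mul_apply, mul_pow, Finset.prod_mul_distrib, Polynomial.coe_evalRingHom]
  ring

namespace Arrangement

variable {N : ℕ} {ι : Type} [Fintype ι] [DecidableEq ι] (D : Arrangement m ι) (γ : UPath D.c)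
  (P : Fin (m + 2) → MvPolynomial (Fin (m + 2)) ℂ)

theorem exp_wlog (k : Fin (m + 1) → ℕ) (t : ℝ) :
    Complex.exp (D.wlog γ (fun i => k i) t) = ∏ i, D.mult γ t i ^ k i := by
  rw [wlog, Complex.exp_sum]
  exact Finset.prod_congr rfl fun i _ => Complex.exp_nat_mul _ _

/-- The polynomial in `y` that results from the integration of the form `∑ P_l dx_l` along a lift of
a loop at the origin. -/
def shiftPoly : MvPolynomial (Fin (m + 1)) ℂ :=
  ∑ k ∈ rowSupport P, MvPolynomial.monomial k (D.wint γ (fun i => k i) (reduced P k))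

theorem coeff_shiftPoly (k : Fin (m + 1) →₀ ℕ) :
    (D.shiftPoly γ P).coeff k = D.wint γ (fun i => k i) (reduced P k) := by
  rw [shiftPoly, MvPolynomial.coeff_sum]
  simp only [MvPolynomial.coeff_monomial]
  rw [Finset.sum_ite_eq']
  split_ifs with h
  · rfl
  · rw [reduced_eq_zero h]
    simp [wint]

theorem row_apply_curve' (y : Fin (m + 1) → ℂ) (t : ℝ) :
    ∑ l, D.curve' γ y t l * MvPolynomial.eval (D.curve γ y t) (P l) =
      (MvPolynomial.eval (D.mult γ t * y)
        (MvPolynomial.map (Polynomial.evalRingHom (γ.u t)) (rowBase P)) +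
      ∑ i, D.rate i (γ.u t) * MvPolynomial.eval (D.mult γ t * y)
        (MvPolynomial.map (Polynomial.evalRingHom (γ.u t)) (rowFibre P i))) * γ.u' t := by
  have h1 : MvPolynomial.eval (D.mult γ t * y)
        (MvPolynomial.map (Polynomial.evalRingHom (γ.u t)) (rowBase P)) =
      MvPolynomial.eval (D.curve γ y t) (P (Fin.last (m + 1))) * (D.mult γ t 0 * y 0) := by
    rw [rowBase, map_mul, map_mul, eval_subst, MvPolynomial.map_X, MvPolynomial.eval_X]
    rfl
  have h2 : ∀ i, MvPolynomial.eval (D.mult γ t * y)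
        (MvPolynomial.map (Polynomial.evalRingHom (γ.u t)) (rowFibre P i)) =
      (MvPolynomial.eval (D.curve γ y t) (P i.castSucc) + if i = 0 then
        γ.u t * MvPolynomial.eval (D.curve γ y t) (P (Fin.last (m + 1))) else 0) *
        (D.mult γ t i * y i) := by
    intro i
    rw [rowFibre, map_mul, map_mul, map_add, map_add, eval_subst, MvPolynomial.map_X,
      MvPolynomial.eval_X]
    congr 2
    split_ifs
    · rw [map_mul, map_mul, eval_subst, MvPolynomial.map_C, MvPolynomial.eval_C,
        Polynomial.coe_evalRingHom, Polynomial.eval_X]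
      rfl
    · simp
  rw [h1, Fin.sum_univ_castSucc (n := m + 1)]
  simp only [h2, curve', Fin.snoc_castSucc, Fin.snoc_last, add_mul, mul_add, ite_mul, zero_mul,
    mul_ite, mul_zero, Finset.sum_add_distrib, Finset.sum_ite_eq', Finset.mem_univ, if_true]
  rw [Finset.sum_mul]
  have h3 : ∀ i : Fin (m + 1), D.rate i (γ.u t) * γ.u' t * (D.mult γ t i * y i) *
      MvPolynomial.eval (D.curve γ y t) (P i.castSucc) =
      D.rate i (γ.u t) * (MvPolynomial.eval (D.curve γ y t) (P i.castSucc) *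
        (D.mult γ t i * y i)) * γ.u' t := fun i => by ring
  simp only [h3]
  ring

/-- Sorted by weights in y, the pulled back form becomes a sum of weighted integrals. Integration by
parts reduces each of them to `wint` of the reduced tuple, without boundary terms because the
primitives vanish at u = 0. -/
theorem integral_row_eq (h0 : γ.u 0 = 0) (h1 : γ.u 1 = 0) (y : Fin (m + 1) → ℂ) :
    ∫ t in (0 : ℝ)..1, ∑ l, D.curve' γ y t l * MvPolynomial.eval (D.curve γ y t) (P l) =
      MvPolynomial.eval y (D.shiftPoly γ P) := by
  have hS0 : (rowBase P).support ⊆ rowSupport P := Finset.subset_union_left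
  have hSi : ∀ i, (rowFibre P i).support ⊆ rowSupport P := fun i =>
    (Finset.subset_biUnion_of_mem (fun i => (rowFibre P i).support) (Finset.mem_univ i)).trans
      Finset.subset_union_right
  have e1 : ∀ t : ℝ, ∑ l, D.curve' γ y t l * MvPolynomial.eval (D.curve γ y t) (P l) =
      ∑ k ∈ rowSupport P, (∏ i, y i ^ k i) * (Complex.exp (D.wlog γ (fun i => k i) t) *
        ((primitive ((rowBase P).coeff k)).derivative.eval (γ.u t) +
          ∑ i, D.rate i (γ.u t) * ((rowFibre P i).coeff k).eval (γ.u t)) * γ.u' t) := by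
    intro t
    rw [row_apply_curve', eval_map_eval_mul hS0]
    simp only [eval_map_eval_mul (hSi _), Finset.mul_sum]
    rw [Finset.sum_comm, ← Finset.sum_add_distrib, Finset.sum_mul]
    refine Finset.sum_congr rfl fun k _ => ?_
    rw [exp_wlog, derivative_primitive]
    have : ∑ i, D.rate i (γ.u t) * ((∏ i, y i ^ k i) * ((∏ i, D.mult γ t i ^ k i) *
        ((rowFibre P i).coeff k).eval (γ.u t))) = (∏ i, y i ^ k i) * (∏ i, D.mult γ t i ^ k i) *
        ∑ i, D.rate i (γ.u t) * ((rowFibre P i).coeff k).eval (γ.u t) := by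
      rw [Finset.mul_sum]
      exact Finset.sum_congr rfl fun i _ => by ring
    rw [this]
    ring
  simp only [e1]
  have hcont : ∀ k : Fin (m + 1) →₀ ℕ, Continuous fun t =>
      Complex.exp (D.wlog γ (fun i => k i) t) *
        ((primitive ((rowBase P).coeff k)).derivative.eval (γ.u t) +
          ∑ i, D.rate i (γ.u t) * ((rowFibre P i).coeff k).eval (γ.u t)) * γ.u' t := fun k =>
    ((D.continuous_wlog γ _).cexp.mul (((Polynomial.continuous _).comp γ.continuous_u).add
      (D.continuous_sum_rate_eval γ fun i => (rowFibre P i).coeff k))).mul γ.continuous_u'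
  have hcont' : ∀ k : Fin (m + 1) →₀ ℕ, Continuous fun t => (∏ i, y i ^ k i) *
      (Complex.exp (D.wlog γ (fun i => k i) t) *
        ((primitive ((rowBase P).coeff k)).derivative.eval (γ.u t) +
          ∑ i, D.rate i (γ.u t) * ((rowFibre P i).coeff k).eval (γ.u t)) * γ.u' t) := fun k =>
    continuous_const.mul (hcont k)
  rw [intervalIntegral.integral_finsetSum fun k _ => (hcont' k).intervalIntegrable _ _]
  simp only [intervalIntegral.integral_const_mul]
  have e2 := fun k : Fin (m + 1) →₀ ℕ => D.integral_exp_wlog_eq γ (fun i => (k i : ℂ))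
    (fun i => (rowFibre P i).coeff k) (reduced P k) (primitive ((rowBase P).coeff k)) fun i => rfl
  simp only [e2, h0, h1, eval_zero_primitive, mul_zero, sub_zero, zero_add]
  rw [shiftPoly, map_sum]
  refine Finset.sum_congr rfl fun k _ => ?_
  rw [MvPolynomial.eval_monomial, Finsupp.prod_fintype _ _ (fun _ => pow_zero _), mul_comm]

variable {η : (Fin (m + 2) → ℂ) → (Fin (m + 2) → ℂ) →L[ℂ] (Fin N → ℂ)} (hη : Continuous η)
  (Λ : (Fin N → ℂ) →L[ℂ] ℂ)

-- Lifts of a fixed loop have position and velocity O(‖y‖), so an error ‖x‖^n in the form integrates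
-- to ‖y‖^(n + 1).
include hη in
theorem shift_sub_shiftPoly_isBigO {n : ℕ} (h0 : γ.u 0 = 0) (h1 : γ.u 1 = 0)
    (hP : ∀ l, (fun x => Λ (η x (Pi.single l 1)) - MvPolynomial.eval x (P l)) =O[𝓝 0]
      fun x => ‖x‖ ^ n) :
    (fun y => Λ (D.shift γ η y 1) - MvPolynomial.eval y (D.shiftPoly γ P)) =O[𝓝 0]
      fun y => ‖y‖ ^ (n + 1) := by
  obtain ⟨K₁, K₂, K₃, k1, k2, k3, hb⟩ := exists_pathBound γ
  set C₁ := Real.exp (K₂ * K₁) * (1 + K₃) with hC₁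
  set C₂ := Real.exp (K₂ * K₁) * (K₁ + K₂ * K₁ + K₃ * (K₂ * K₁)) with hC₂
  have hC₁0 : 0 < C₁ := by positivity
  have hC₂0 : 0 ≤ C₂ := by positivity
  have hsum := Asymptotics.IsBigO.fun_sum (s := Finset.univ) fun l _ => (hP l).norm_left
  obtain ⟨c, hc0, hc⟩ := hsum.exists_nonneg
  rw [Asymptotics.isBigOWith_iff] at hc
  obtain ⟨ρ, hρ, hball⟩ := Metric.eventually_nhds_iff.mp hc
  refine Asymptotics.IsBigO.of_bound (C₂ * (c * C₁ ^ n)) ?_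
  filter_upwards [Metric.ball_mem_nhds (0 : Fin (m + 1) → ℂ) (show 0 < ρ / C₁ by positivity)]
    with y hy
  rw [Metric.mem_ball, dist_zero_right, lt_div_iff₀ hC₁0] at hy
  have hcurve := D.continuous_curve_path γ y
  have hcurve' := D.continuous_curve'_path γ y
  have hci : Continuous fun t => η (D.curve γ y t) (D.curve' γ y t) :=
    (hη.comp hcurve).clm_apply hcurve'
  have hΛi : Continuous fun t => Λ (η (D.curve γ y t) (D.curve' γ y t)) := Λ.continuous.comp hci
  have e1 : Λ (D.shift γ η y 1) =
      ∫ t in (0 : ℝ)..1, Λ (η (D.curve γ y t) (D.curve' γ y t)) :=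
    (Λ.intervalIntegral_comp_comm (hci.intervalIntegrable _ _)).symm
  have hpi : Continuous fun t => ∑ l, D.curve' γ y t l * MvPolynomial.eval (D.curve γ y t) (P l) :=
    continuous_finsetSum _ fun l _ => ((continuous_apply l).comp hcurve').mul
      ((MvPolynomial.continuous_eval _).comp hcurve)
  rw [e1, ← D.integral_row_eq γ P h0 h1, ← intervalIntegral.integral_sub
    (hΛi.intervalIntegrable _ _) (hpi.intervalIntegrable _ _)]
  have hbd := intervalIntegral.norm_integral_le_of_norm_le_const (a := 0) (b := 1)
    (C := C₂ * (c * C₁ ^ n) * ‖y‖ ^ (n + 1))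
    (f := fun t => Λ (η (D.curve γ y t) (D.curve' γ y t)) -
      ∑ l, D.curve' γ y t l * MvPolynomial.eval (D.curve γ y t) (P l)) fun t ht => by
    rw [uIoc_of_le zero_le_one] at ht
    have ht' : t ∈ Icc (0 : ℝ) 1 := ⟨ht.1.le, ht.2⟩
    have b1 := hb.norm_curve_le k1 k2 k3 ht' y
    have b2 := hb.norm_curve'_le k1 k2 k3 ht' y
    rw [← hC₁] at b1
    rw [← hC₂] at b2
    have e2 : Λ (η (D.curve γ y t) (D.curve' γ y t)) -
        ∑ l, D.curve' γ y t l * MvPolynomial.eval (D.curve γ y t) (P l) =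
        ∑ l, D.curve' γ y t l * (Λ (η (D.curve γ y t) (Pi.single l 1)) -
          MvPolynomial.eval (D.curve γ y t) (P l)) := by
      rw [clm_apply_eq_sum (η (D.curve γ y t)), map_sum, ← Finset.sum_sub_distrib]
      refine Finset.sum_congr rfl fun l _ => ?_
      rw [map_smul, smul_eq_mul, mul_sub]
    have b3 : dist (D.curve γ y t) 0 < ρ := by
      rw [dist_zero_right]; linarith
    have b4 := hball b3
    rw [Real.norm_of_nonneg (Finset.sum_nonneg fun _ _ => norm_nonneg _),
      Real.norm_of_nonneg (by positivity)] at b4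
    rw [e2]
    calc ‖∑ l, D.curve' γ y t l * (Λ (η (D.curve γ y t) (Pi.single l 1)) -
          MvPolynomial.eval (D.curve γ y t) (P l))‖
        ≤ ∑ l, ‖D.curve' γ y t‖ * ‖Λ (η (D.curve γ y t) (Pi.single l 1)) -
          MvPolynomial.eval (D.curve γ y t) (P l)‖ := by
          refine norm_sum_le_of_le _ fun l _ => ?_
          rw [norm_mul]
          exact mul_le_mul_of_nonneg_right (norm_le_pi_norm _ l) (norm_nonneg _)
      _ = ‖D.curve' γ y t‖ * ∑ l, ‖Λ (η (D.curve γ y t) (Pi.single l 1)) -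
          MvPolynomial.eval (D.curve γ y t) (P l)‖ := (Finset.mul_sum _ _ _).symm
      _ ≤ (C₂ * ‖y‖) * (c * (C₁ * ‖y‖) ^ n) := by
          refine mul_le_mul b2 (b4.trans ?_) (Finset.sum_nonneg fun _ _ => norm_nonneg _)
            (by positivity)
          gcongr
      _ = C₂ * (c * C₁ ^ n) * ‖y‖ ^ (n + 1) := by rw [mul_pow]; ring
  refine hbd.trans ?_
  rw [sub_zero, abs_one, mul_one, Real.norm_of_nonneg (by positivity)]

end Arrangement
end SepVar

end

/-! ### Commutators of loops, and coefficients read off from real parts -/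

section

namespace SepVar

variable {m : ℕ}

/-- The constant term vanishes in the limit r → 0, and division by r lowers n by one. -/
theorem coeff_eq_zero_of_abs_eval_le {n : ℕ} : ∀ {R : Polynomial ℝ} {K r₀ : ℝ}, 0 < r₀ →
    (∀ r, 0 < r → r < r₀ → |R.eval r| ≤ K * r ^ n) → ∀ e < n, R.coeff e = 0 := by
  induction n with
  | zero => intro R K r₀ _ _ e he; omega
  | succ n ih =>
    intro R K r₀ hr₀ h
    have h0 : R.coeff 0 = 0 := by
      have t1 : Tendsto (fun r => |R.eval r|) (𝓝[>] 0) (𝓝 |R.eval 0|) :=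
        (R.continuous.abs.tendsto 0).mono_left nhdsWithin_le_nhds
      have t2 : Tendsto (fun r : ℝ => K * r ^ (n + 1)) (𝓝[>] 0) (𝓝 0) := by
        have : Continuous fun r : ℝ => K * r ^ (n + 1) := by fun_prop
        simpa using (this.tendsto 0).mono_left (nhdsWithin_le_nhds (s := Ioi 0))
      have hle : ∀ᶠ r in 𝓝[>] (0 : ℝ), |R.eval r| ≤ K * r ^ (n + 1) := by
        filter_upwards [self_mem_nhdsWithin, nhdsWithin_le_nhds (Iio_mem_nhds hr₀)] with r h1 h2
        exact h r h1 h2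
      have := le_of_tendsto_of_tendsto t1 t2 hle
      rw [Polynomial.coeff_zero_eq_eval_zero]
      exact abs_nonpos_iff.mp this
    intro e he
    rcases e with _ | e
    · exact h0
    · rw [← Polynomial.coeff_divX]
      refine ih (R := R.divX) (K := K) hr₀ (fun r h1 h2 => ?_) e (by omega)
      have h3 := h r h1 h2
      have h4 : R.eval r = R.divX.eval r * r := by
        conv_lhs => rw [← R.divX_mul_X_add, h0]
        simp
      rw [h4, abs_mul, abs_of_pos h1, pow_succ, ← mul_assoc] at h3
      exact le_of_mul_le_mul_right h3 h1

/-- A polynomial vanishes if it vanishes off the coordinate hyperplanes. -/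
theorem eq_zero_of_eval_eq_zero {Q : MvPolynomial (Fin (m + 1)) ℂ}
    (h : ∀ y : Fin (m + 1) → ℂ, (∀ i, y i ≠ 0) → MvPolynomial.eval y Q = 0) : Q = 0 := by
  have h1 : Q * ∏ i, MvPolynomial.X i = 0 := by
    refine MvPolynomial.funext fun y => ?_
    rw [map_mul, map_prod, map_zero]
    by_cases hy : ∀ i, y i ≠ 0
    · rw [h y hy, zero_mul]
    · push Not at hy
      obtain ⟨i, hi⟩ := hy
      rw [Finset.prod_eq_zero (Finset.mem_univ i) (by simpa using hi), mul_zero]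
  refine (mul_eq_zero.mp h1).resolve_right ?_
  exact Finset.prod_ne_zero_iff.mpr fun i _ => MvPolynomial.X_ne_zero i

/-- The coefficients of low positive degree of a polynomial with small real part vanish. -/
theorem coeff_eq_zero_of_abs_re_le {n : ℕ} {Q : MvPolynomial (Fin (m + 1)) ℂ} {K r₀ : ℝ}
    (hr₀ : 0 < r₀) (h : ∀ y : Fin (m + 1) → ℂ, (∀ i, y i ≠ 0) → ‖y‖ < r₀ →
      |(MvPolynomial.eval y Q).re| ≤ K * ‖y‖ ^ (n + 1)) {k : Fin (m + 1) →₀ ℕ} (hk : k ≠ 0)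
    (hkn : k.degree ≤ n) : Q.coeff k = 0 := by
  have hk1 : k.degree ≠ 0 := fun h => hk ((Finsupp.degree_eq_zero_iff k).mp h)
  have main : MvPolynomial.homogeneousComponent k.degree Q = 0 := by
    refine eq_zero_of_eval_eq_zero fun y hy => ?_
    set H := MvPolynomial.eval y (MvPolynomial.homogeneousComponent k.degree Q) with hH
    -- Along the ray r ζ y the real part of Q is a real polynomial in r, whose coefficient in degree
    -- |k| is the real part of ζ^|k| H.
    have hζ : ∀ ζ : ℂ, ‖ζ‖ = 1 → (ζ ^ k.degree * H).re = 0 := by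
      intro ζ hζ
      set R : Polynomial ℝ := ∑ K ∈ Q.support,
        Polynomial.monomial K.degree (ζ ^ K.degree * (Q.coeff K * ∏ i, y i ^ K i)).re with hR
      have hev : ∀ r : ℝ, R.eval r = (MvPolynomial.eval (fun i => r * ζ * y i) Q).re := by
        intro r
        rw [hR, Polynomial.eval_finsetSum, MvPolynomial.eval_eq', Complex.re_sum]
        refine Finset.sum_congr rfl fun K _ => ?_
        have : ∏ i, ((r : ℂ) * ζ * y i) ^ K i =
            ((r ^ K.degree : ℝ) : ℂ) * (ζ ^ K.degree * ∏ i, y i ^ K i) := by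
          simp only [mul_pow, Finset.prod_mul_distrib, Finset.prod_pow_eq_pow_sum]
          rw [Finsupp.degree_eq_sum]
          push_cast
          ring
        have e : Q.coeff K * (((r ^ K.degree : ℝ) : ℂ) * (ζ ^ K.degree * ∏ i, y i ^ K i)) =
            ((r ^ K.degree : ℝ) : ℂ) * (ζ ^ K.degree * (Q.coeff K * ∏ i, y i ^ K i)) := by ring
        rw [this, e, Polynomial.eval_monomial, Complex.re_ofReal_mul, mul_comm]
      have hypos := norm_pos_iff.mpr fun h : y = 0 => hy 0 (by simp [h])
      have hcoef := coeff_eq_zero_of_abs_eval_le (R := R) (K := K * ‖y‖ ^ (n + 1))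
        (r₀ := r₀ / ‖y‖) (n := n + 1) (by positivity) (fun r h1 h2 => by
          have hnorm : ‖(fun i => (r : ℂ) * ζ * y i)‖ = r * ‖y‖ := by
            have : (fun i => (r : ℂ) * ζ * y i) = ((r : ℂ) * ζ) • y := by
              funext i; simp
            rw [this, norm_smul, norm_mul, hζ, Complex.norm_real, Real.norm_of_nonneg h1.le, mul_one]
          have hne : (r : ℂ) ≠ 0 := by exact_mod_cast h1.ne'
          have hζ0 : ζ ≠ 0 := norm_ne_zero_iff.mp (by rw [hζ]; exact one_ne_zero)
          have := h (fun i => r * ζ * y i) (fun i => mul_ne_zero (mul_ne_zero hne hζ0) (hy i))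
            (by rw [hnorm]; exact (lt_div_iff₀ hypos).mp h2)
          rw [hev]
          rw [hnorm, mul_pow] at this
          linarith) k.degree (by omega)
      rw [hR, Polynomial.finsetSum_coeff] at hcoef
      simp only [Polynomial.coeff_monomial] at hcoef
      rw [← hcoef, hH, MvPolynomial.homogeneousComponent_apply, map_sum, Finset.mul_sum,
        Complex.re_sum, Finset.sum_filter]
      refine Finset.sum_congr rfl fun K _ => ?_
      split_ifs with hKk
      · rw [MvPolynomial.eval_monomial, Finsupp.prod_fintype _ _ (fun _ => pow_zero _), hKk]
      · rfl
    by_contra hne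
    have hn : (‖H‖ : ℂ) ≠ 0 := by exact_mod_cast norm_ne_zero_iff.mpr hne
    -- A rotation ζ with ζ^|k| H = |H| turns the real part into the modulus. This requires |k| > 0:
    -- the imaginary part of the constant term stays invisible.
    obtain ⟨ζ, hζe⟩ := IsAlgClosed.exists_pow_nat_eq ((starRingEnd ℂ) H / ‖H‖)
      (Nat.pos_of_ne_zero hk1)
    have hζ1 : ‖ζ‖ = 1 := by
      have : ‖ζ‖ ^ k.degree = 1 := by
        rw [← norm_pow, hζe, norm_div, RCLike.norm_conj, Complex.norm_real, norm_norm]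
        exact div_self (norm_ne_zero_iff.mpr hne)
      exact (pow_eq_one_iff_of_nonneg (norm_nonneg _) hk1).mp this
    have := hζ ζ hζ1
    rw [hζe, div_mul_eq_mul_div, mul_comm, Complex.mul_conj, Complex.normSq_eq_norm_sq] at this
    have e : (((‖H‖ ^ 2 : ℝ) : ℂ) / (‖H‖ : ℂ)) = ((‖H‖ : ℝ) : ℂ) := by
      push_cast; field_simp
    rw [e, Complex.ofReal_re] at this
    exact hne (norm_eq_zero.mp this)
  have := congrArg (MvPolynomial.coeff k) main
  rwa [MvPolynomial.coeff_homogeneousComponent, if_pos rfl, MvPolynomial.coeff_zero] at this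

/-- The polynomial `Q (μ * y)`. -/
def dilate (μ : Fin (m + 1) → ℂ) (Q : MvPolynomial (Fin (m + 1)) ℂ) :
    MvPolynomial (Fin (m + 1)) ℂ :=
  ∑ k ∈ Q.support, MvPolynomial.monomial k ((∏ i, μ i ^ k i) * Q.coeff k)

theorem coeff_dilate (μ : Fin (m + 1) → ℂ) (Q : MvPolynomial (Fin (m + 1)) ℂ)
    (k : Fin (m + 1) →₀ ℕ) : (dilate μ Q).coeff k = (∏ i, μ i ^ k i) * Q.coeff k := by
  rw [dilate, MvPolynomial.coeff_sum]
  simp only [MvPolynomial.coeff_monomial]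
  rw [Finset.sum_ite_eq']
  split_ifs with h
  · rfl
  · rw [MvPolynomial.notMem_support_iff.mp h, mul_zero]

theorem eval_dilate (μ y : Fin (m + 1) → ℂ) (Q : MvPolynomial (Fin (m + 1)) ℂ) :
    MvPolynomial.eval y (dilate μ Q) = MvPolynomial.eval (μ * y) Q := by
  rw [dilate, map_sum, MvPolynomial.eval_eq']
  refine Finset.sum_congr rfl fun k _ => ?_
  rw [MvPolynomial.eval_monomial, Finsupp.prod_fintype _ _ (fun _ => pow_zero _)]
  simp only [Pi.mul_apply, mul_pow, Finset.prod_mul_distrib]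
  ring

namespace Arrangement

variable {N : ℕ} {ι : Type} [Fintype ι] [DecidableEq ι] (D : Arrangement m ι) (γ γ' : UPath D.c)
  (η : (Fin (m + 2) → ℂ) → (Fin (m + 2) → ℂ) →L[ℂ] (Fin N → ℂ))

/-- The translation of `z` that results from the commutator of two loops. -/
def commShift (y : Fin (m + 1) → ℂ) : Fin N → ℂ :=
  D.shift γ η y 1 + D.shift γ' η (D.mult γ 1 * y) 1 -
    (D.shift γ' η y 1 + D.shift γ η (D.mult γ' 1 * y) 1)

variable {γ γ' η}

/-- Multipliers commute, so traversing the loops in one order and undoing them in the other returns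
to the same y and moves only z. -/
theorem exists_transport_commShift (h0 : γ.u 0 = 0) (h1 : γ.u 1 = 0) (h0' : γ'.u 0 = 0)
    (h1' : γ'.u 1 = 0) (hη : Continuous η) {K : ℝ} (hK : ∀ x, ‖η x‖ ≤ K) :
    ∃ C, D.Transport η 0 0 1 C (D.commShift γ γ' η) := by
  obtain ⟨C, T⟩ := exists_transport γ hη hK
  obtain ⟨C', T'⟩ := exists_transport γ' hη hK
  rw [h0, h1] at T
  rw [h0', h1'] at T'
  have h := (T.trans T').trans (T'.trans T).symm
  have e1 : (D.mult γ 1 * D.mult γ' 1)⁻¹ * (D.mult γ' 1 * D.mult γ 1) = 1 := by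
    funext i
    have := D.mult_ne_zero γ 1 i
    have := D.mult_ne_zero γ' 1 i
    simp only [Pi.mul_apply, Pi.inv_apply, Pi.one_apply]
    field_simp
  rw [e1] at h
  have e2 : (fun y => D.shift γ η y 1 + D.shift γ' η (D.mult γ 1 * y) 1 +
      -(D.shift γ' η ((D.mult γ 1 * D.mult γ' 1)⁻¹ * (D.mult γ' 1 * D.mult γ 1 * y)) 1 +
        D.shift γ η (D.mult γ' 1 * ((D.mult γ 1 * D.mult γ' 1)⁻¹ *
          (D.mult γ' 1 * D.mult γ 1 * y))) 1)) = D.commShift γ γ' η := by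
    funext y
    rw [← mul_assoc ((D.mult γ 1 * D.mult γ' 1)⁻¹), e1, one_mul, ← sub_eq_add_neg]
    rfl
  exact ⟨_, e2 ▸ h⟩

variable (γ γ') (P : Fin (m + 2) → MvPolynomial (Fin (m + 2)) ℂ)

/-- The polynomial in `y` that results from the integration of the form `∑ P_l dx_l` along the
commutator of two loops. -/
def commPoly : MvPolynomial (Fin (m + 1)) ℂ :=
  D.shiftPoly γ P + dilate (D.mult γ 1) (D.shiftPoly γ' P) -
    (D.shiftPoly γ' P + dilate (D.mult γ' 1) (D.shiftPoly γ P))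

/-- A dilation by multipliers acts on the coefficient of weight k as exp(wlog). Vanishing of these
coefficients is the condition in `IsGood.exists_eq_const`. -/
theorem coeff_commPoly (k : Fin (m + 1) →₀ ℕ) : (D.commPoly γ γ' P).coeff k =
    D.wint γ' (fun i => k i) (reduced P k) * (Complex.exp (D.wlog γ (fun i => k i) 1) - 1) -
    D.wint γ (fun i => k i) (reduced P k) * (Complex.exp (D.wlog γ' (fun i => k i) 1) - 1) := by
  simp only [commPoly, MvPolynomial.coeff_sub, MvPolynomial.coeff_add, coeff_dilate, coeff_shiftPoly,
    exp_wlog]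
  ring

variable {γ γ'} (Λ : (Fin N → ℂ) →L[ℂ] ℂ)

theorem commShift_sub_commPoly_isBigO {n : ℕ} (h0 : γ.u 0 = 0) (h1 : γ.u 1 = 0) (h0' : γ'.u 0 = 0)
    (h1' : γ'.u 1 = 0) (hη : Continuous η)
    (hP : ∀ l, (fun x => Λ (η x (Pi.single l 1)) - MvPolynomial.eval x (P l)) =O[𝓝 0]
      fun x => ‖x‖ ^ n) :
    (fun y => Λ (D.commShift γ γ' η y) - MvPolynomial.eval y (D.commPoly γ γ' P)) =O[𝓝 0]
      fun y => ‖y‖ ^ (n + 1) := by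
  have a := D.shift_sub_shiftPoly_isBigO γ P hη Λ h0 h1 hP
  have b := D.shift_sub_shiftPoly_isBigO γ' P hη Λ h0' h1' hP
  have hdil : ∀ (μ : Fin (m + 1) → ℂ) {f : (Fin (m + 1) → ℂ) → ℂ},
      f =O[𝓝 0] (fun y => ‖y‖ ^ (n + 1)) → (fun y => f (μ * y)) =O[𝓝 0] fun y => ‖y‖ ^ (n + 1) := by
    intro μ f hf
    have ht : Tendsto (fun y : Fin (m + 1) → ℂ => μ * y) (𝓝 0) (𝓝 0) := by
      have : Continuous fun y : Fin (m + 1) → ℂ => μ * y := by fun_prop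
      simpa using this.tendsto 0
    refine (hf.comp_tendsto ht).trans ?_
    refine Asymptotics.IsBigO.of_bound (‖μ‖ ^ (n + 1)) (Eventually.of_forall fun y => ?_)
    simp only [Function.comp_apply]
    rw [Real.norm_of_nonneg (by positivity), Real.norm_of_nonneg (by positivity), ← mul_pow]
    exact pow_le_pow_left₀ (norm_nonneg _) (norm_mul_le _ _) _
  refine ((a.add (hdil (D.mult γ 1) b)).sub (b.add (hdil (D.mult γ' 1) a))).congr_left fun y => ?_
  simp only [commShift, commPoly, map_add, map_sub, eval_dilate]
  ring

end Arrangement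
end SepVar

end

/-! ### The commutator translations span W -/

section

namespace SepVar
namespace Arrangement

variable {m N : ℕ} {ι : Type} [Fintype ι] [DecidableEq ι] {D : Arrangement m ι} {ℓ : ι → UPath D.c}
  {n : ℕ} {η : (Fin (m + 2) → ℂ) → (Fin (m + 2) → ℂ) →L[ℂ] (Fin N → ℂ)}

theorem IsGood.exists_mem_holonomy (h : D.IsGood ℓ n) (hη : Continuous η) {K : ℝ}
    (hK : ∀ x, ‖η x‖ ≤ K) (v : Fin (m + 1) → ℂ) (hv : ∀ i, v i ≠ 0) {ε : ℝ} (hε : 0 < ε) :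
    ∃ e ∈ D.Holonomy η, ‖e - v‖ < ε := by
  refine h.dense _ (one_mem_holonomy fun j hj => ?_) (fun e he e' he' => mul_mem_holonomy he he')
    (fun e he => inv_mem_holonomy he) (fun a => ?_) v hv ε hε
  · have := h.norm_c j
    rw [← hj, norm_zero] at this
    exact zero_ne_one this
  · obtain ⟨C, T⟩ := exists_transport (ℓ a) hη hK
    rw [h.loop_zero, h.loop_one] at T
    exact ⟨_, _, T⟩

/-- A linear functional that annihilates, up to its real part, the small commutator translations
annihilates the coefficients of low order of `dω`. -/
theorem IsGood.map_dCoeff_eq_zero {d : ℕ} (h : D.IsGood ℓ n) (hn : d + 3 < n) (hη : Continuous η)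
    {ω : FormTuple (m + 2) N} (hω : FormHolNearZero ω) (hηω : ∀ᶠ x in 𝓝 0, η x = formCLM ω x)
    (Λ : (Fin N → ℂ) →L[ℂ] ℂ) {r₀ : ℝ} (hr₀ : 0 < r₀)
    (hΛ : ∀ a a', ∀ y : Fin (m + 1) → ℂ, (∀ i, y i ≠ 0) → ‖y‖ < r₀ →
      (Λ (D.commShift (ℓ a) (ℓ a') η y)).re = 0)
    (K : Fin (m + 2) → ℕ) (hK : ∑ l, K l ≤ d) {i j : Fin (m + 2)} (hij : i < j) :
    Λ (dCoeff ω K i j) = 0 := by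
  -- Order d + 2, because coefficients of dω up to degree d involve those of ω up to degree d + 1.
  have hp := fun l => (hω.comp l).exists_hasTaylor (d + 1 + 1)
  choose p hp using hp
  have hΛs : ∀ v : Fin N → ℂ, Λ v = ∑ s, v s * Λ (Pi.single s 1) := fun v => by
    rw [clm_apply_eq_sum Λ v]
    rfl
  set P : Fin (m + 2) → MvPolynomial (Fin (m + 2)) ℂ :=
    fun l => ∑ s, MvPolynomial.C (Λ (Pi.single s 1)) * p l s with hP
  have hPO : ∀ l, (fun x => Λ (η x (Pi.single l 1)) - MvPolynomial.eval x (P l)) =O[𝓝 0]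
      fun x => ‖x‖ ^ (d + 2) := by
    intro l
    have h1 : (fun x => Λ (comp ω l x - evalTuple (p l) x)) =O[𝓝 0] fun x => ‖x‖ ^ (d + 2) :=
      (Λ.isBigO_comp (fun x => comp ω l x - evalTuple (p l) x) (𝓝 0)).trans (hp l)
    refine h1.congr' ?_ EventuallyEq.rfl
    filter_upwards [hηω] with x hx
    have e : MvPolynomial.eval x (P l) = Λ (evalTuple (p l) x) := by
      rw [hΛs, hP, map_sum]
      refine Finset.sum_congr rfl fun s _ => ?_
      rw [map_mul, MvPolynomial.eval_C, mul_comm]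
      rfl
    rw [map_sub, hx, e, formCLM_apply]
    rfl
  -- The commutator polynomial differs by O(‖y‖^(d + 3)) from a function with vanishing real part,
  -- so its coefficients of positive degree up to d + 2 are zero.
  have hcomm : ∀ a a' (k : Fin (m + 1) →₀ ℕ), k ≠ 0 → k.degree ≤ d + 2 →
      (D.commPoly (ℓ a) (ℓ a') P).coeff k = 0 := by
    intro a a' k hk hkd
    have hO := D.commShift_sub_commPoly_isBigO P Λ (h.loop_zero a) (h.loop_one a) (h.loop_zero a')
      (h.loop_one a') hη hPO
    obtain ⟨C, hC⟩ := hO.bound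
    obtain ⟨ρ, hρ, hball⟩ := Metric.eventually_nhds_iff.mp hC
    refine coeff_eq_zero_of_abs_re_le (K := C) (n := d + 2) (lt_min hρ hr₀) (fun y hy hyr => ?_) hk hkd
    have h1 := hball (show dist y 0 < ρ by rw [dist_zero_right]; exact hyr.trans_le (min_le_left _ _))
    rw [Real.norm_of_nonneg (by positivity)] at h1
    have h2 := hΛ a a' y hy (hyr.trans_le (min_le_right _ _))
    have h3 := (Complex.abs_re_le_norm _).trans h1
    rwa [Complex.sub_re, h2, zero_sub, abs_neg] at h3
  obtain ⟨f, hf⟩ := exists_potential P (d := d + 1) fun k hk hkd => by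
    have hle : ∀ i, k i ≤ d + 2 := fun i => (Finsupp.le_degree i k).trans hkd
    refine h.exists_eq_const k (fun h0 => hk (DFunLike.coe_injective h0))
      (fun i => (hle i).trans (by omega)) (reduced P k)
      (reduced_mem_degreeLT P k (by have := hle 0; omega)) fun a a' => ?_
    have := hcomm a a' k hk hkd
    rw [coeff_commPoly, sub_eq_zero] at this
    exact this.symm
  set K' : Fin (m + 2) →₀ ℕ := Finsupp.equivFunOnFinite.symm K with hK'
  have hKd : K'.degree ≤ d := by rw [Finsupp.degree_eq_sum]; exact hK
  have hdc := fun s => dCoeff_eq hω hp K' (by omega) i j s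
  have hcoe : ∀ l (L : Fin (m + 2) →₀ ℕ), (P l).coeff L = ∑ s, Λ (Pi.single s 1) * (p l s).coeff L := by
    intro l L
    rw [hP, MvPolynomial.coeff_sum]
    exact Finset.sum_congr rfl fun s _ => MvPolynomial.coeff_C_mul _ _ _
  have e1 : Λ (dCoeff ω K i j) = (P j).coeff (K' + Finsupp.single i 1) * (K' i + 1) -
      (P i).coeff (K' + Finsupp.single j 1) * (K' j + 1) := by
    rw [hΛs, hcoe, hcoe, Finset.sum_mul, Finset.sum_mul, ← Finset.sum_sub_distrib]
    refine Finset.sum_congr rfl fun s _ => ?_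
    have := hdc s
    simp only [hK', Finsupp.coe_equivFunOnFinite_symm] at this ⊢
    rw [this]
    ring
  have hdeg : ∀ l, (K' + Finsupp.single l 1).degree ≤ d + 1 := fun l => by
    rw [map_add, Finsupp.degree_single]; omega
  -- Both terms are the same mixed second derivative of the potential.
  rw [e1, hf _ _ (hdeg i), hf _ _ (hdeg j), add_right_comm K' (Finsupp.single j 1)]
  simp only [Finsupp.add_apply, Finsupp.single_eq_of_ne hij.ne, Finsupp.single_eq_of_ne hij.ne',
    add_zero]
  ring

/-- The conjugates of the commutator translations span `W`. -/
theorem IsGood.subset_span_commShift {d : ℕ} (h : D.IsGood ℓ n) (hn : d + 3 < n) (hη : Continuous η)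
    {B : ℝ} (hB : ∀ x, ‖η x‖ ≤ B) {ω : FormTuple (m + 2) N} (hω : FormHolNearZero ω)
    (hηω : ∀ᶠ x in 𝓝 0, η x = formCLM ω x) (hd : jetSpan (jet d ω) = W ω) {y : Fin (m + 1) → ℂ}
    (hy : ∀ i, y i ≠ 0) : (W ω : Set (Fin N → ℂ)) ⊆
      Submodule.span ℝ {v | ∃ σ : ι × ι, ∃ e ∈ D.Holonomy η, ‖e‖ ≤ 1 ∧
        v = D.commShift (ℓ σ.1) (ℓ σ.2) η (e * y)} := by
  intro w hw
  by_contra hcon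
  -- Duality: a real functional that is zero on the span but not at w is the real part of a complex
  -- functional Λ, which will turn out to kill W.
  obtain ⟨φ, hφw, hφ⟩ := Submodule.exists_le_ker_of_notMem hcon
  set Λ₀ : Module.Dual ℂ (Fin N → ℂ) := Module.Dual.extendRCLike (𝕜 := ℂ) φ with hΛ₀
  set Λ : (Fin N → ℂ) →L[ℂ] ℂ := LinearMap.toContinuousLinearMap Λ₀ with hΛ
  have hre : ∀ v, (Λ v).re = φ v := fun v =>
    Module.Dual.re_extendRCLike_apply (𝕜 := ℂ) φ v
  have hypos := norm_pos_iff.mpr fun h : y = 0 => hy 0 (by simp [h])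
  -- A point y' smaller than every |y_i| is v y with ‖v‖ < 1, hence a limit of points e y with e in
  -- the holonomy and ‖e‖ ≤ 1.
  set r₀ := Finset.univ.inf' Finset.univ_nonempty (fun i => ‖y i‖) with hr₀
  have hr₀pos : 0 < r₀ := by
    rw [hr₀, Finset.lt_inf'_iff]
    exact fun i _ => norm_pos_iff.mpr (hy i)
  have hzero : ∀ a a', ∀ y' : Fin (m + 1) → ℂ, (∀ i, y' i ≠ 0) → ‖y'‖ < r₀ →
      (Λ (D.commShift (ℓ a) (ℓ a') η y')).re = 0 := by
    intro a a' y' hy' hy'r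
    obtain ⟨C, T⟩ := exists_transport_commShift D (h.loop_zero a) (h.loop_one a) (h.loop_zero a')
      (h.loop_one a') hη hB
    set v : Fin (m + 1) → ℂ := fun i => y' i / y i with hv
    have hv1 : ‖v‖ < 1 := by
      rw [pi_norm_lt_iff one_pos]
      intro i
      rw [hv, norm_div, div_lt_one (norm_pos_iff.mpr (hy i))]
      exact ((norm_le_pi_norm y' i).trans_lt hy'r).trans_le (Finset.inf'_le _ (Finset.mem_univ i))
    have hvy : v * y = y' := by
      funext i
      exact div_mul_cancel₀ _ (hy i)
    have hcl : Continuous fun e : Fin (m + 1) → ℂ =>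
        (Λ (D.commShift (ℓ a) (ℓ a') η (e * y))).re :=
      Complex.continuous_re.comp (Λ.continuous.comp
        (T.continuous.comp (continuous_id.mul continuous_const)))
    by_contra hne
    have hopen : ∀ᶠ e in 𝓝 v, (Λ (D.commShift (ℓ a) (ℓ a') η (e * y))).re ≠ 0 ∧ ‖e‖ < 1 := by
      refine (hcl.continuousAt.eventually_ne ?_).and
        (continuous_norm.continuousAt.eventually (gt_mem_nhds hv1))
      rwa [hvy]
    obtain ⟨δ, hδ, hball⟩ := Metric.eventually_nhds_iff.mp hopen
    obtain ⟨e, he, hev⟩ := h.exists_mem_holonomy hη hB v (fun i => div_ne_zero (hy' i) (hy i)) hδ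
    obtain ⟨h1, h2⟩ := hball (by rwa [dist_eq_norm] : dist e v < δ)
    refine h1 ?_
    rw [hre]
    exact hφ (Submodule.subset_span ⟨(a, a'), e, he, h2.le, rfl⟩)
  have hW : W ω ≤ LinearMap.ker Λ₀ := by
    rw [← hd, jetSpan, Submodule.span_le]
    rintro _ ⟨K, i, j, rfl⟩
    simp only [jet]
    split_ifs with hc
    · exact h.map_dCoeff_eq_zero hn hη hω hηω Λ hr₀pos hzero K hc.2 hc.1
    · exact zero_mem _
  have hw0 : Λ w = 0 := hW hw
  refine hφw ?_
  rw [← hre, hw0, Complex.zero_re]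

end Arrangement
end SepVar

end

/-! ### Transport between arbitrary points of the u-line -/

section

namespace SepVar

/-- The straight segment between two points of a convex set without any of the points `c`. -/
def segmentPath {ι : Type} {c : ι → ℂ} {s : Set ℂ} (hs : Convex ℝ s) (hc : ∀ j, c j ∉ s) {v w : ℂ}
    (hv : v ∈ s) (hw : w ∈ s) : UPath c where
  u t := v + (smoothStep t : ℂ) * (w - v)
  u' t := ((Real.pi * Real.sin (Real.pi * t) / 2 : ℝ) : ℂ) * (w - v)
  continuous_u' := by fun_prop
  hasDerivAt t := ((hasDerivAt_smoothStep t).ofReal_comp.mul_const (w - v)).const_add v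
  avoid t j hj := by
    refine hc j (hj ▸ ?_)
    have h := hs.add_smul_sub_mem hv hw (smoothStep_mem t)
    rwa [Complex.real_smul] at h

namespace Arrangement

variable {m N : ℕ} {ι : Type} [Fintype ι] [DecidableEq ι] {D : Arrangement m ι}
  {η : (Fin (m + 2) → ℂ) → (Fin (m + 2) → ℂ) →L[ℂ] (Fin N → ℂ)} {K : ℝ}

/-- Nearby points of the `u`-line are connected with a uniform constant. -/
theorem exists_local_transport (hη : Continuous η) (hK : ∀ x, ‖η x‖ ≤ K) {u₀ : ℂ}
    (hu₀ : ∀ j, u₀ ≠ D.c j) : ∃ δ > 0, ∃ C, ∀ v ∈ Metric.ball u₀ δ, ∀ w ∈ Metric.ball u₀ δ,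
      (∀ j, v ≠ D.c j) ∧ ∃ e b, D.Transport η v w e C b := by
  obtain ⟨δ, hδ, hball⟩ : ∃ δ > 0, Metric.closedBall u₀ δ ⊆ (range D.c)ᶜ :=
    Metric.nhds_basis_closedBall.mem_iff.mp ((Set.finite_range D.c).isClosed.isOpen_compl.mem_nhds (by
      rintro ⟨j, hj⟩; exact hu₀ j hj.symm))
  have hav : ∀ j, D.c j ∉ Metric.closedBall u₀ δ := fun j hj => hball hj ⟨j, rfl⟩
  have hrc : ContinuousOn (fun u i => D.rate i u) (Metric.closedBall u₀ δ) := by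
    unfold rate
    refine continuousOn_pi.mpr fun i => continuousOn_finsetSum _ fun j _ => ?_
    refine continuousOn_const.div (by fun_prop) fun u hu => sub_ne_zero.mpr ?_
    rintro rfl
    exact hav j hu
  obtain ⟨K₂, hK₂⟩ := (isCompact_closedBall u₀ δ).exists_bound_of_continuousOn hrc
  have h2 : 0 ≤ K₂ := (norm_nonneg _).trans (hK₂ u₀ (Metric.mem_closedBall_self hδ.le))
  set K₁ := Real.pi * (2 * δ) with hK₁
  have h1 : 0 ≤ K₁ := by positivity
  refine ⟨δ, hδ, liftConst K K₁ K₂ (‖u₀‖ + δ), fun v hv w hw => ⟨fun j hj => ?_, ?_⟩⟩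
  · exact hav j (hj ▸ Metric.ball_subset_closedBall hv)
  · set γ := segmentPath (convex_closedBall u₀ δ) hav (Metric.ball_subset_closedBall hv)
      (Metric.ball_subset_closedBall hw) with hγ
    have hmem : ∀ t, γ.u t ∈ Metric.closedBall u₀ δ := fun t => by
      have h := (convex_closedBall u₀ δ).add_smul_sub_mem (Metric.ball_subset_closedBall hv)
        (Metric.ball_subset_closedBall hw) (smoothStep_mem t)
      rwa [Complex.real_smul] at h
    have hb : D.PathBound γ K₁ K₂ (‖u₀‖ + δ) := by
      refine ⟨fun t _ => ?_, fun t _ i => (norm_le_pi_norm _ i).trans (hK₂ _ (hmem t)), fun t _ => ?_⟩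
      · have e1 : ‖w - v‖ ≤ 2 * δ := by
          rw [← dist_eq_norm]
          have := dist_triangle_right w v u₀
          linarith [Metric.mem_ball.mp hv, Metric.mem_ball.mp hw]
        have e2 : ‖((Real.pi * Real.sin (Real.pi * t) / 2 : ℝ) : ℂ)‖ ≤ Real.pi := by
          rw [Complex.norm_real, Real.norm_eq_abs, abs_div, abs_mul, abs_of_pos Real.pi_pos, abs_two]
          have := Real.abs_sin_le_one (Real.pi * t)
          nlinarith [Real.pi_pos]
        change ‖((Real.pi * Real.sin (Real.pi * t) / 2 : ℝ) : ℂ) * (w - v)‖ ≤ K₁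
        rw [norm_mul]
        exact mul_le_mul e2 e1 (norm_nonneg _) Real.pi_pos.le
      · have h3 := hmem t
        rw [Metric.mem_closedBall, dist_eq_norm] at h3
        have := norm_le_norm_add_norm_sub u₀ (γ.u t)
        rw [norm_sub_rev] at this
        linarith
    have T := hb.transport h1 h2 (by positivity) hη hK
    have e0 : γ.u 0 = v := by
      change v + (smoothStep 0 : ℂ) * (w - v) = v
      rw [smoothStep_zero]; simp
    have e1 : γ.u 1 = w := by
      change v + (smoothStep 1 : ℂ) * (w - v) = w
      rw [smoothStep_one]; simp
    rw [e0, e1] at T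
    exact ⟨_, _, T⟩

/-- Any two points of the `u`-line are connected. -/
theorem exists_transport_of_ne (hη : Continuous η) (hK : ∀ x, ‖η x‖ ≤ K) {u u' : ℂ}
    (hu : ∀ j, u ≠ D.c j) (hu' : ∀ j, u' ≠ D.c j) : ∃ e C b, D.Transport η u u' e C b := by
  -- The complement of the points c_j is connected, and by `exists_local_transport` the set of
  -- points reached from u is open and relatively closed in it.
  have hconn : IsPreconnected (range D.c)ᶜ :=
    ((Set.finite_range D.c).countable.isConnected_compl_of_one_lt_rank (by
      rw [Complex.rank_real_complex]; exact Nat.one_lt_ofNat)).isPreconnected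
  set A : Set ℂ := {w | w ∈ (range D.c)ᶜ ∧ ∃ e C b, D.Transport η u w e C b} with hA
  have hsub : (range D.c)ᶜ ⊆ A := by
    have hloc : ∀ w ∈ (range D.c)ᶜ, ∃ δ > 0, ∃ C, ∀ v ∈ Metric.ball w δ, ∀ v' ∈ Metric.ball w δ,
      (∀ j, v ≠ D.c j) ∧ ∃ e b, D.Transport η v v' e C b := fun w hw =>
      exists_local_transport hη hK fun j hj => hw ⟨j, hj.symm⟩
    refine hconn.subset_of_closure_inter_subset ?_ ⟨u, ?_, ?_⟩ ?_
    · refine Metric.isOpen_iff.mpr fun w ⟨hw, e, C', b, T⟩ => ?_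
      obtain ⟨δ, hδ, C, hl⟩ := hloc w hw
      refine ⟨δ, hδ, fun v hv => ⟨fun ⟨j, hj⟩ => (hl v hv v hv).1 j hj.symm, ?_⟩⟩
      obtain ⟨e', b', T'⟩ := (hl w (Metric.mem_ball_self hδ) v hv).2
      exact ⟨_, _, _, T.trans T'⟩
    · rintro ⟨j, hj⟩; exact hu j hj.symm
    · exact ⟨fun ⟨j, hj⟩ => hu j hj.symm, _, _, _, Transport.refl hu⟩
    · rintro w ⟨hw, hwc⟩
      obtain ⟨δ, hδ, C, hl⟩ := hloc w hwc
      obtain ⟨v, ⟨-, e, C', b, T⟩, hv⟩ := Metric.mem_closure_iff.mp hw δ hδ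
      obtain ⟨e', b', T'⟩ := (hl v (by rwa [Metric.mem_ball, dist_comm]) w
        (Metric.mem_ball_self hδ)).2
      exact ⟨hwc, _, _, _, T.trans T'⟩
  exact (hsub fun ⟨j, hj⟩ => hu' j hj.symm).2

end Arrangement
end SepVar

end

/-! ### Radial paths and the decay of lifts in the plane -/

section

namespace SepVar

/-- The path along a ray from `c₀`, on which the distance to `c₀` varies exponentially. -/
def radialPath {ι : Type} (c : ι → ℂ) (c₀ v : ℂ) (κ : ℝ)
    (h : ∀ s ∈ Icc (0 : ℝ) 1, ∀ j, c₀ + v * (Real.exp (κ * s) : ℝ) ≠ c j) : UPath c where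
  u t := c₀ + v * (Real.exp (κ * smoothStep t) : ℝ)
  u' t := v * (Real.exp (κ * smoothStep t) * (κ * (Real.pi * Real.sin (Real.pi * t) / 2)) : ℝ)
  continuous_u' := by
    have := continuous_smoothStep
    fun_prop
  hasDerivAt t :=
    ((((hasDerivAt_smoothStep t).const_mul κ).exp.ofReal_comp).const_mul v).const_add c₀
  avoid t j := h _ (smoothStep_mem t) j

theorem smoothStep_deriv_nonneg {t : ℝ} (ht : t ∈ Icc (0 : ℝ) 1) :
    0 ≤ Real.pi * Real.sin (Real.pi * t) / 2 := by
  have := Real.sin_nonneg_of_nonneg_of_le_pi (mul_nonneg Real.pi_pos.le ht.1)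
    (mul_le_of_le_one_right Real.pi_pos.le ht.2)
  have := Real.pi_pos
  positivity

namespace Arrangement

variable {m N : ℕ} {ι : Type} [Fintype ι] [DecidableEq ι] {D : Arrangement m ι}
  {η : (Fin (m + 2) → ℂ) → (Fin (m + 2) → ℂ) →L[ℂ] (Fin N → ℂ)} {K : ℝ}

/-- A lift that decays exponentially stays within a region of the size of its origin. -/
theorem reach_of_decay (hη : Continuous η) (hK : ∀ x, ‖η x‖ ≤ K) (γ : UPath D.c)
    {y : Fin (m + 1) → ℂ} (hy : ∀ i, y i ≠ 0) {A B X b β κ : ℝ} (hb : 0 < b) (hβ : b * κ = β)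
    (hκ : 0 ≤ κ) (hA : 0 ≤ A) (hB : 0 ≤ B) (hX : 0 < X)
    (h : ∀ t ∈ Icc (0 : ℝ) 1, ‖D.curve γ y t‖ ≤ A * (Real.exp (-(β * smoothStep t)) * X))
    (h' : ∀ t ∈ Icc (0 : ℝ) 1, ‖D.curve' γ y t‖ ≤ B * (κ * (Real.pi * Real.sin (Real.pi * t) / 2)) *
      (Real.exp (-(β * smoothStep t)) * X)) (z : Fin N → ℂ) :
    D.Reach η ((A + K * B / b + 1) * X) (pt (γ.u 0) y, z)
      (pt (γ.u 1) (D.mult γ 1 * y), z + D.shift γ η y 1) := by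
  have hK0 : 0 ≤ K := (norm_nonneg _).trans (hK 0)
  have hβ0 : 0 ≤ β := hβ ▸ mul_nonneg hb.le hκ
  have hexp : ∀ t, Real.exp (-(β * smoothStep t)) ≤ 1 := fun t =>
    Real.exp_le_one_iff.mpr (neg_nonpos.mpr (mul_nonneg hβ0 (smoothStep_mem t).1))
  -- An exponentially decaying velocity has an integral bounded independently of the length of the
  -- path; κ cancels because β = b κ.
  have hshift : ∀ t ∈ Icc (0 : ℝ) 1, ‖D.shift γ η y t‖ ≤
      K * B / b * X * (1 - Real.exp (-(β * smoothStep t))) := by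
    refine image_norm_le_of_norm_deriv_right_le_deriv_boundary
      (f' := fun t => η (D.curve γ y t) (D.curve' γ y t))
      (B' := fun t => K * B / b * X * (Real.exp (-(β * smoothStep t)) *
        (β * (Real.pi * Real.sin (Real.pi * t) / 2))))
      (fun t _ => (D.hasDerivAt_shift γ hη y t).continuousAt.continuousWithinAt)
      (fun t _ => (D.hasDerivAt_shift γ hη y t).hasDerivWithinAt) ?_ (fun t => ?_) (fun t ht => ?_)
    · simp [smoothStep_zero]
    · refine ((((hasDerivAt_smoothStep t).const_mul β).neg.exp.const_sub 1).const_mul _).congr_deriv ?_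
      simp only [Pi.neg_apply]
      ring
    · refine (ContinuousLinearMap.le_opNorm _ _).trans ((mul_le_mul (hK _)
        (h' t ⟨ht.1, ht.2.le⟩) (norm_nonneg _) hK0).trans (le_of_eq ?_))
      rw [← hβ]
      field_simp
  refine D.mem_leaf_lift γ hη hy z fun t ht => ⟨D.curve_notMem_S γ hy t, ?_, ?_⟩
  · have h1 := h t ht
    have h2 : A * (Real.exp (-(β * smoothStep t)) * X) ≤ A * X :=
      mul_le_mul_of_nonneg_left (mul_le_of_le_one_left hX.le (hexp t)) hA
    have h3 : 0 ≤ K * B / b * X := by positivity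
    simp only
    linarith
  · have h1 := hshift t ht
    have h2 : K * B / b * X * (1 - Real.exp (-(β * smoothStep t))) ≤ K * B / b * X :=
      mul_le_of_le_one_right (by positivity) (by linarith [Real.exp_pos (-(β * smoothStep t))])
    have h3 : 0 ≤ A * X := by positivity
    simp only [add_sub_cancel_left]
    linarith

variable {c₀ v : ℂ} {κ : ℝ}
  {hav : ∀ s ∈ Icc (0 : ℝ) 1, ∀ j, c₀ + v * (Real.exp (κ * s) : ℝ) ≠ D.c j}

/-- The velocity is a real multiple of u - c₀, so the growth of the multipliers is governed by the
real part of rate (u - c₀). -/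
theorem radialPath_u' (t : ℝ) : (radialPath D.c c₀ v κ hav).u' t =
    ((κ * (Real.pi * Real.sin (Real.pi * t) / 2) : ℝ) : ℂ) *
      ((radialPath D.c c₀ v κ hav).u t - c₀) := by
  simp only [radialPath]
  push_cast
  ring

/-- The size of the multipliers along a ray. -/
theorem norm_mult_radialPath_le (i : Fin (m + 1)) {b : ℝ}
    (h : ∀ t ∈ Icc (0 : ℝ) 1, κ * (D.rate i ((radialPath D.c c₀ v κ hav).u t) *
      ((radialPath D.c c₀ v κ hav).u t - c₀)).re ≤ b) {t : ℝ} (ht : t ∈ Icc (0 : ℝ) 1) :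
    ‖D.mult (radialPath D.c c₀ v κ hav) t i‖ ≤ Real.exp (b * smoothStep t) := by
  set γ := radialPath D.c c₀ v κ hav
  rw [mult, Complex.norm_exp]
  refine Real.exp_le_exp.mpr ?_
  have hd : ∀ t : ℝ, HasDerivAt (fun t => (D.logCoord γ i t).re - b * smoothStep t)
      ((D.rate i (γ.u t) * γ.u' t).re - b * (Real.pi * Real.sin (Real.pi * t) / 2)) t := fun t => by
    have h1 := Complex.reCLM.hasFDerivAt.comp_hasDerivAt t (D.hasDerivAt_logCoord γ i t)
    exact h1.sub ((hasDerivAt_smoothStep t).const_mul b)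
  have hanti : AntitoneOn (fun t => (D.logCoord γ i t).re - b * smoothStep t) (Icc 0 1) := by
    refine antitoneOn_of_hasDerivWithinAt_nonpos (convex_Icc 0 1)
      (fun t _ => (hd t).continuousAt.continuousWithinAt)
      (fun t _ => (hd t).hasDerivWithinAt) fun t ht => ?_
    rw [interior_Icc] at ht
    have ht' : t ∈ Icc (0 : ℝ) 1 := ⟨ht.1.le, ht.2.le⟩
    have h1 := mul_le_mul_of_nonneg_left (h t ht') (smoothStep_deriv_nonneg ht')
    rw [radialPath_u', mul_left_comm, Complex.re_ofReal_mul]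
    linarith
  have := hanti (left_mem_Icc.mpr zero_le_one) ht ht.1
  simp only [logCoord_zero, smoothStep_zero, Complex.zero_re] at this
  linarith

theorem norm_curve'_le (γ : UPath D.c) (y : Fin (m + 1) → ℂ) (t : ℝ) {q : ℝ}
    (hq : ∀ i, ‖D.rate i (γ.u t) * γ.u' t‖ ≤ q) :
    ‖D.curve' γ y t‖ ≤ (‖γ.u' t‖ + (1 + ‖γ.u t‖) * q) * ‖D.mult γ t * y‖ := by
  have hq0 : 0 ≤ q := (norm_nonneg _).trans (hq 0)
  have h0 : ∀ i, ‖D.mult γ t i * y i‖ ≤ ‖D.mult γ t * y‖ := fun i =>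
    norm_le_pi_norm (D.mult γ t * y) i
  have h1 : ∀ i, ‖D.rate i (γ.u t) * γ.u' t * (D.mult γ t i * y i)‖ ≤ q * ‖D.mult γ t * y‖ :=
    fun i => by
      rw [norm_mul]
      exact mul_le_mul (hq i) (h0 i) (norm_nonneg _) hq0
  have h2 : ‖γ.u' t * (D.mult γ t 0 * y 0)‖ ≤ ‖γ.u' t‖ * ‖D.mult γ t * y‖ := by
    rw [norm_mul]
    exact mul_le_mul_of_nonneg_left (h0 0) (norm_nonneg _)
  have h3 : ‖γ.u t * (D.rate 0 (γ.u t) * γ.u' t * (D.mult γ t 0 * y 0))‖ ≤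
      ‖γ.u t‖ * (q * ‖D.mult γ t * y‖) := by
    rw [norm_mul]
    exact mul_le_mul_of_nonneg_left (h1 0) (norm_nonneg _)
  have h4 : 0 ≤ ‖γ.u' t‖ * ‖D.mult γ t * y‖ := by positivity
  have h5 : 0 ≤ ‖γ.u t‖ * (q * ‖D.mult γ t * y‖) := by positivity
  have h6 : 0 ≤ q * ‖D.mult γ t * y‖ := by positivity
  refine (pi_norm_le_iff_of_nonneg (by positivity)).mpr fun l => ?_
  refine Fin.lastCases ?_ (fun i => ?_) l
  · simp only [curve', Fin.snoc_last]
    exact (norm_add_le _ _).trans (by linarith)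
  · simp only [curve', Fin.snoc_castSucc]
    linarith [h1 i]

theorem norm_pi_fin_one (y : Fin (0 + 1) → ℂ) : ‖y‖ = ‖y 0‖ := by
  refine le_antisymm ((pi_norm_le_iff_of_nonneg (norm_nonneg _)).mpr fun i => ?_)
    (norm_le_pi_norm y 0)
  rw [show i = 0 from Fin.ext (by omega)]

section Plane

variable {D : Arrangement 0 ι} {η : (Fin (0 + 2) → ℂ) → (Fin (0 + 2) → ℂ) →L[ℂ] (Fin N → ℂ)}

theorem rate_eq_sum (i : Fin (0 + 1)) (u : ℂ) : D.rate i u = ∑ j, D.lam j / (u - D.c j) := by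
  rw [rate, Finset.filter_true_of_mem fun j _ => Fin.ext (by omega)]

/-- After multiplication by u - c_j the pole contributes λ_j, and all other terms together at most b
∑ |λ_k| ≤ b. -/
theorem rate_mul_near (hsum : ∑ j, ‖D.lam j‖ < 1) {b : ℝ} (hb : 0 ≤ b) (hb1 : b ≤ 1) {j : ι}
    {u : ℂ} (hu : u ≠ D.c j) (h : ∀ k, k ≠ j → 0 < ‖u - D.c k‖ ∧ ‖u - D.c j‖ ≤ b * ‖u - D.c k‖)
    (i : Fin (0 + 1)) : ‖D.rate i u * (u - D.c j)‖ ≤ 1 ∧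
      (D.rate i u * (u - D.c j)).re ≤ (D.lam j).re + b := by
  have e : D.rate i u * (u - D.c j) =
      D.lam j + ∑ k ∈ Finset.univ.erase j, D.lam k * ((u - D.c j) / (u - D.c k)) := by
    rw [rate_eq_sum, ← Finset.add_sum_erase _ _ (Finset.mem_univ j), add_mul,
      div_mul_cancel₀ _ (sub_ne_zero.mpr hu), Finset.sum_mul]
    congr 1
    exact Finset.sum_congr rfl fun k _ => by ring
  have hk : ∀ k ∈ Finset.univ.erase j, ‖D.lam k * ((u - D.c j) / (u - D.c k))‖ ≤ b * ‖D.lam k‖ := by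
    intro k hk
    obtain ⟨h1, h2⟩ := h k (Finset.ne_of_mem_erase hk)
    rw [norm_mul, norm_div, mul_comm b]
    exact mul_le_mul_of_nonneg_left ((div_le_iff₀ h1).mpr h2) (norm_nonneg _)
  have hs := norm_sum_le_of_le _ hk
  rw [← Finset.mul_sum] at hs
  have hsum' := hsum
  rw [← Finset.add_sum_erase _ _ (Finset.mem_univ j)] at hsum'
  have h0 : 0 ≤ ∑ k ∈ Finset.univ.erase j, ‖D.lam k‖ := Finset.sum_nonneg fun _ _ => norm_nonneg _
  rw [e]
  constructor
  · refine (norm_add_le _ _).trans ?_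
    nlinarith
  · rw [Complex.add_re]
    have h2 := (Complex.re_le_norm _).trans hs
    nlinarith [norm_nonneg (D.lam j)]

/-- From the neighbourhood of an invariant line the leaves lead away from it. -/
theorem exists_reach_of_near (hη : Continuous η) (hK : ∀ x, ‖η x‖ ≤ K)
    (hc : ∀ j, ‖D.c j‖ ≤ 1) (hinj : Function.Injective D.c) (hre : ∀ j, (D.lam j).re < 0)
    (hsum : ∑ j, ‖D.lam j‖ < 1) : ∃ r > 0, ∃ C, (∀ j k, k ≠ j → r ≤ ‖D.c j - D.c k‖ / 2) ∧
      ∀ u j, u ≠ D.c j → ‖u - D.c j‖ < r → ∀ y : Fin (0 + 1) → ℂ, (∀ i, y i ≠ 0) → ∀ z,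
      ∃ u' y' z', (‖u' - D.c j‖ = r) ∧ (∀ i, y' i ≠ 0) ∧
        D.Reach η (C * ‖y‖) (pt u y, z) (pt u' y', z') := by
  have hK0 : 0 ≤ K := (norm_nonneg _).trans (hK 0)
  -- As 2 b < -Re λ_j, an error b from the other poles still leaves a decay rate b. The radius r is
  -- then chosen small enough for that error.
  obtain ⟨b, ⟨hb1, hb2⟩, hb0⟩ : ∃ b : ℝ, (b < 1 ∧ ∀ j, 2 * b < -(D.lam j).re) ∧ 0 < b := by
    have h1 : ∀ᶠ b : ℝ in 𝓝 0, b < 1 ∧ ∀ j, 2 * b < -(D.lam j).re := by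
      refine (eventually_lt_nhds one_pos).and (eventually_all.mpr fun j => ?_)
      have : ContinuousAt (fun b : ℝ => 2 * b) 0 := by fun_prop
      exact this.eventually_lt continuousAt_const (by simpa using hre j)
    exact ((h1.filter_mono nhdsWithin_le_nhds).and
      (eventually_mem_nhdsWithin (s := Ioi 0))).exists
  obtain ⟨r, ⟨hr1, hr2⟩, hr0⟩ : ∃ r : ℝ, (r < 1 ∧ ∀ p : ι × ι, p.2 ≠ p.1 →
      r < b * (‖D.c p.1 - D.c p.2‖ / 2)) ∧ 0 < r := by
    have h1 : ∀ᶠ r : ℝ in 𝓝 0, r < 1 ∧ ∀ p : ι × ι, p.2 ≠ p.1 →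
        r < b * (‖D.c p.1 - D.c p.2‖ / 2) := by
      refine (eventually_lt_nhds one_pos).and (eventually_all.mpr fun p => ?_)
      by_cases hp : p.2 = p.1
      · exact Eventually.of_forall fun r h => (h hp).elim
      · have : 0 < ‖D.c p.1 - D.c p.2‖ := norm_pos_iff.mpr (sub_ne_zero.mpr fun h => hp (hinj h).symm)
        filter_upwards [eventually_lt_nhds (show 0 < b * (‖D.c p.1 - D.c p.2‖ / 2) by positivity)]
          with r hr _ using hr
    exact ((h1.filter_mono nhdsWithin_le_nhds).and
      (eventually_mem_nhdsWithin (s := Ioi 0))).exists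
  have hr3 : ∀ j k, k ≠ j → r ≤ ‖D.c j - D.c k‖ / 2 := fun j k hk => by
    have h1 := hr2 (j, k) hk
    have h2 := norm_nonneg (D.c j - D.c k)
    simp only at h1
    nlinarith
  have hnear : ∀ j u, ‖u - D.c j‖ ≤ r → ∀ k, k ≠ j →
      0 < ‖u - D.c k‖ ∧ ‖u - D.c j‖ ≤ b * ‖u - D.c k‖ := fun j u hu k hk => by
    have h1 := hr2 (j, k) hk
    have h2 := hr3 j k hk
    have h3 := norm_sub_le_norm_sub_add_norm_sub (D.c j) u (D.c k)
    rw [norm_sub_rev (D.c j) u] at h3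
    simp only at h1
    have h4 : ‖D.c j - D.c k‖ / 2 ≤ ‖u - D.c k‖ := by linarith
    exact ⟨by linarith, by nlinarith⟩
  -- Along the ray ‖u‖ ≤ 2, which gives 3 = 1 + 2 for the position and 4 = 1 + 3 for the velocity.
  refine ⟨r, hr0, 3 + K * 4 / b + 1, hr3, fun u j hu hur y hy z => ?_⟩
  have hv : 0 < ‖u - D.c j‖ := norm_pos_iff.mpr (sub_ne_zero.mpr hu)
  set κ := Real.log (r / ‖u - D.c j‖) with hκ
  have hκ0 : 0 ≤ κ := Real.log_nonneg ((one_le_div hv).mpr hur.le)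
  have hexp : Real.exp κ = r / ‖u - D.c j‖ := Real.exp_log (by positivity)
  have hdist : ∀ s ∈ Icc (0 : ℝ) 1, ‖D.c j + (u - D.c j) * (Real.exp (κ * s) : ℝ) - D.c j‖ ≤ r := by
    intro s hs
    rw [add_sub_cancel_left, norm_mul, Complex.norm_real, Real.norm_of_nonneg (Real.exp_pos _).le]
    have : Real.exp (κ * s) ≤ r / ‖u - D.c j‖ :=
      hexp ▸ Real.exp_le_exp.mpr (mul_le_of_le_one_right hκ0 hs.2)
    calc ‖u - D.c j‖ * Real.exp (κ * s) ≤ ‖u - D.c j‖ * (r / ‖u - D.c j‖) := by gcongr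
      _ = r := by field_simp
  have hav : ∀ s ∈ Icc (0 : ℝ) 1, ∀ k, D.c j + (u - D.c j) * (Real.exp (κ * s) : ℝ) ≠ D.c k := by
    intro s hs k
    by_cases hk : k = j
    · subst hk
      rw [Ne, add_eq_left]
      exact mul_ne_zero (sub_ne_zero.mpr hu) (by exact_mod_cast (Real.exp_pos _).ne')
    · exact sub_ne_zero.mp (norm_pos_iff.mp (hnear j _ (hdist s hs) k hk).1)
  set γ := radialPath D.c (D.c j) (u - D.c j) κ hav with hγ
  have hγr : ∀ t, ‖γ.u t - D.c j‖ ≤ r := fun t => hdist _ (smoothStep_mem t)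
  have hγn : ∀ t, ‖γ.u t‖ ≤ 2 := fun t => by
    have := norm_le_norm_add_norm_sub (D.c j) (γ.u t)
    rw [norm_sub_rev] at this
    linarith [hγr t, hc j]
  have hrate := fun t (i : Fin (0 + 1)) => rate_mul_near hsum hb0.le hb1.le (γ.avoid t j)
    (hnear j _ (hγr t)) i
  have hmult : ∀ t ∈ Icc (0 : ℝ) 1, ‖D.mult γ t * y‖ ≤
      Real.exp (-(b * κ * smoothStep t)) * ‖y‖ := fun t ht => by
    refine (norm_mul_le _ _).trans (mul_le_mul_of_nonneg_right ?_ (norm_nonneg y))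
    refine (pi_norm_le_iff_of_nonneg (Real.exp_pos _).le).mpr fun i => ?_
    rw [← neg_mul]
    refine norm_mult_radialPath_le i (fun t _ => ?_) ht
    have := (hrate t i).2
    have := hb2 j
    nlinarith
  have hspeed : ∀ t ∈ Icc (0 : ℝ) 1, ∀ w : ℂ, ‖w * γ.u' t‖ =
      κ * (Real.pi * Real.sin (Real.pi * t) / 2) * ‖w * (γ.u t - D.c j)‖ := fun t ht w => by
    rw [hγ, radialPath_u', mul_left_comm, norm_mul, Complex.norm_real,
      Real.norm_of_nonneg (mul_nonneg hκ0 (smoothStep_deriv_nonneg ht))]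
  have hy0 := norm_pos_of_forall_ne_zero hy
  have key := reach_of_decay hη hK γ hy hb0 rfl hκ0 (by norm_num : (0 : ℝ) ≤ 3)
    (by norm_num : (0 : ℝ) ≤ 4) hy0 (fun t ht => ?_) (fun t ht => ?_) z
  · have e0 : γ.u 0 = u := by
      change D.c j + (u - D.c j) * (Real.exp (κ * smoothStep 0) : ℝ) = u
      simp [smoothStep_zero]
    rw [e0] at key
    refine ⟨_, _, _, ?_, fun i => mul_ne_zero (D.mult_ne_zero γ 1 i) (hy i), key⟩
    change ‖D.c j + (u - D.c j) * (Real.exp (κ * smoothStep 1) : ℝ) - D.c j‖ = r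
    rw [smoothStep_one, mul_one, hexp, add_sub_cancel_left, norm_mul, Complex.norm_real,
      Real.norm_of_nonneg (by positivity)]
    field_simp
  · refine (norm_pt_le _ _).trans ?_
    have := hγn t
    exact mul_le_mul (by linarith) (hmult t ht) (norm_nonneg _) (by norm_num)
  · have hσ := mul_nonneg hκ0 (smoothStep_deriv_nonneg ht)
    have h1 := D.norm_curve'_le γ y t (q := κ * (Real.pi * Real.sin (Real.pi * t) / 2)) fun i => by
      rw [hspeed t ht]
      exact mul_le_of_le_one_right hσ (hrate t i).1
    have h2 := hspeed t ht 1
    rw [one_mul, one_mul] at h2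
    have h3 := mul_le_mul_of_nonneg_left ((hγr t).trans hr1.le) hσ
    have h4 := mul_le_mul_of_nonneg_right (hγn t) hσ
    exact h1.trans (mul_le_mul (by linarith) (hmult t ht) (norm_nonneg _) (by positivity))

/-- From the neighbourhood of the line at infinity of the `u`-line the leaves lead away from it. -/
theorem exists_reach_of_far (hη : Continuous η) (hK : ∀ x, ‖η x‖ ≤ K)
    (hc : ∀ j, ‖D.c j‖ ≤ 1) (hsum : ∑ j, ‖D.lam j‖ < 1) : ∃ R > 1, ∃ C, ∀ u, R < ‖u‖ →
      ∀ y : Fin (0 + 1) → ℂ, (∀ i, y i ≠ 0) → ∀ z, ∃ u' y' z', ‖u'‖ = R ∧ (∀ i, y' i ≠ 0) ∧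
        D.Reach η (C * ‖pt u y‖) (pt u y, z) (pt u' y', z') := by
  have hK0 : 0 ≤ K := (norm_nonneg _).trans (hK 0)
  set L := ∑ j, ‖D.lam j‖ with hL
  have hL0 : 0 ≤ L := Finset.sum_nonneg fun _ _ => norm_nonneg _
  -- For |u| ≥ R one has L |u| / (|u| - 1) ≤ (1 + L) / 2 = 1 - b. So when u moves inwards, |y| grows
  -- at most like |u|^(b - 1) and |u| |y| decays at least like |u|^b.
  obtain ⟨R, hR⟩ : ∃ R, R = 1 + 2 / (1 - L) := ⟨_, rfl⟩
  have hR1 : 1 < R := by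
    have : 0 < 2 / (1 - L) := div_pos two_pos (by linarith)
    linarith
  have hRL : R * (1 - L) = 1 - L + 2 := by
    have : 1 - L ≠ 0 := by linarith
    rw [hR]; field_simp
  obtain ⟨b, hb⟩ : ∃ b, b = (1 - L) / 2 := ⟨_, rfl⟩
  have hb0 : 0 < b := by linarith
  have hrate : ∀ (i : Fin (0 + 1)) u, R ≤ ‖u‖ → ‖D.rate i u * u‖ ≤ 1 - b := by
    intro i u hu
    rw [rate_eq_sum, Finset.sum_mul]
    have hk : ∀ j ∈ Finset.univ, ‖D.lam j / (u - D.c j) * u‖ ≤ ‖D.lam j‖ * (‖u‖ / (‖u‖ - 1)) := by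
      intro j _
      have h1 : ‖u‖ - 1 ≤ ‖u - D.c j‖ := by
        have := norm_sub_norm_le u (D.c j)
        linarith [hc j]
      rw [div_mul_eq_mul_div, mul_div_assoc, norm_mul, norm_div]
      gcongr
      linarith
    have h1 := norm_sum_le_of_le _ hk
    rw [← Finset.sum_mul (f := fun j => ‖D.lam j‖), ← hL, ← mul_div_assoc] at h1
    refine h1.trans ((div_le_iff₀ (by linarith)).mpr ?_)
    nlinarith
  refine ⟨R, hR1, 2 + K * 3 / b + 1, fun u hu y hy z => ?_⟩
  have hu0 : 0 < ‖u‖ := by linarith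
  have hR0 : 0 < R := by linarith
  obtain ⟨κ, hκ⟩ : ∃ κ, κ = Real.log (‖u‖ / R) := ⟨_, rfl⟩
  have hκ0 : 0 ≤ κ := hκ ▸ Real.log_nonneg ((one_le_div hR0).mpr hu.le)
  have hexp : Real.exp (-κ) = R / ‖u‖ := by
    rw [Real.exp_neg, hκ, Real.exp_log (by positivity), inv_div]
  have hnorm : ∀ s : ℝ, ‖0 + u * (Real.exp (-κ * s) : ℝ)‖ = ‖u‖ * Real.exp (-κ * s) := fun s => by
    rw [zero_add, norm_mul, Complex.norm_real, Real.norm_of_nonneg (Real.exp_pos _).le]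
  have hdist : ∀ s ∈ Icc (0 : ℝ) 1, R ≤ ‖0 + u * (Real.exp (-κ * s) : ℝ)‖ := by
    intro s hs
    have : R / ‖u‖ ≤ Real.exp (-κ * s) := by
      rw [← hexp]
      exact Real.exp_le_exp.mpr (by nlinarith [hs.2])
    rw [hnorm]
    calc R = ‖u‖ * (R / ‖u‖) := by field_simp
      _ ≤ _ := by gcongr
  have hav : ∀ s ∈ Icc (0 : ℝ) 1, ∀ k, 0 + u * (Real.exp (-κ * s) : ℝ) ≠ D.c k := by
    intro s hs k h
    have := hdist s hs
    rw [h] at this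
    linarith [hc k]
  set γ := radialPath D.c 0 u (-κ) hav with hγ
  have hγr : ∀ t, R ≤ ‖γ.u t‖ := fun t => hdist _ (smoothStep_mem t)
  have hmult : ∀ t ∈ Icc (0 : ℝ) 1, ‖γ.u t‖ * ‖D.mult γ t * y‖ ≤
      Real.exp (-(b * κ * smoothStep t)) * (‖u‖ * ‖y‖) := fun t ht => by
    have h1 : ‖D.mult γ t‖ ≤ Real.exp ((1 - b) * κ * smoothStep t) := by
      refine (pi_norm_le_iff_of_nonneg (Real.exp_pos _).le).mpr fun i => ?_
      refine norm_mult_radialPath_le i (fun t _ => ?_) ht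
      rw [sub_zero]
      have h2 := hrate i _ (hγr t)
      have h3 := (abs_le.mp (Complex.abs_re_le_norm (D.rate i (γ.u t) * γ.u t))).1
      nlinarith
    have h2 : ‖γ.u t‖ = ‖u‖ * Real.exp (-κ * smoothStep t) := hnorm _
    calc ‖γ.u t‖ * ‖D.mult γ t * y‖ ≤
        ‖γ.u t‖ * (Real.exp ((1 - b) * κ * smoothStep t) * ‖y‖) := by
          gcongr
          exact (norm_mul_le _ _).trans (by gcongr)
      _ = _ := by
        rw [h2, show -(b * κ * smoothStep t) = -κ * smoothStep t + (1 - b) * κ * smoothStep t by ring,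
          Real.exp_add]
        ring
  have hspeed : ∀ t ∈ Icc (0 : ℝ) 1, ∀ w : ℂ, ‖w * γ.u' t‖ =
      κ * (Real.pi * Real.sin (Real.pi * t) / 2) * ‖w * γ.u t‖ := fun t ht w => by
    rw [hγ, radialPath_u', mul_left_comm, norm_mul, Complex.norm_real, sub_zero, neg_mul, norm_neg,
      Real.norm_of_nonneg (mul_nonneg hκ0 (smoothStep_deriv_nonneg ht))]
  have hy0 := norm_pos_of_forall_ne_zero hy
  have key := reach_of_decay hη hK γ hy hb0 rfl hκ0 (by norm_num : (0 : ℝ) ≤ 2)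
    (by norm_num : (0 : ℝ) ≤ 3) (mul_pos hu0 hy0) (fun t ht => ?_) (fun t ht => ?_) z
  · have e0 : γ.u 0 = u := by
      change 0 + u * (Real.exp (-κ * smoothStep 0) : ℝ) = u
      simp [smoothStep_zero]
    rw [e0] at key
    refine ⟨_, _, _, ?_, fun i => mul_ne_zero (D.mult_ne_zero γ 1 i) (hy i), key.mono ?_⟩
    · change ‖0 + u * (Real.exp (-κ * smoothStep 1) : ℝ)‖ = R
      rw [hnorm, smoothStep_one, mul_one, hexp]
      field_simp
    · refine mul_le_mul_of_nonneg_left ?_ (by positivity)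
      have := norm_le_pi_norm (pt u y) (Fin.last 1)
      rwa [pt_last, norm_mul, ← norm_pi_fin_one] at this
  · refine (norm_pt_le _ _).trans (le_trans ?_ (mul_le_mul_of_nonneg_left (hmult t ht) two_pos.le))
    rw [← mul_assoc]
    refine mul_le_mul_of_nonneg_right ?_ (norm_nonneg _)
    linarith [hγr t]
  · have hσ := mul_nonneg hκ0 (smoothStep_deriv_nonneg ht)
    have h1 := D.norm_curve'_le γ y t (q := κ * (Real.pi * Real.sin (Real.pi * t) / 2)) fun i => by
      rw [hspeed t ht]
      exact mul_le_of_le_one_right hσ ((hrate i _ (hγr t)).trans (by linarith))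
    have h2 := hspeed t ht 1
    rw [one_mul, one_mul] at h2
    refine (h1.trans ?_).trans (mul_le_mul_of_nonneg_left (hmult t ht) (by positivity))
    rw [← mul_assoc _ ‖γ.u t‖]
    refine mul_le_mul_of_nonneg_right ?_ (norm_nonneg _)
    rw [h2]
    nlinarith [hγr t]

end Plane

end Arrangement
end SepVar

end

/-! ### Reaching the slice u = 0 -/

section

namespace SepVar
namespace Arrangement

variable {m N : ℕ} {ι : Type} [Fintype ι] [DecidableEq ι] (D : Arrangement m ι)
  (η : (Fin (m + 2) → ℂ) → (Fin (m + 2) → ℂ) →L[ℂ] (Fin N → ℂ))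

/-- The points over `u` are connected with the slice `u = 0` within a region of their size. -/
def ReachesSlice (u : ℂ) (C : ℝ) : Prop :=
  ∀ y : Fin (m + 1) → ℂ, (∀ i, y i ≠ 0) → ∀ z, ∃ y' z', (∀ i, y' i ≠ 0) ∧
    D.Reach η (C * ‖pt u y‖) (pt u y, z) (pt 0 y', z')

variable {D η} {K : ℝ}

theorem ReachesSlice.mono {u : ℂ} {C C' : ℝ} (h : D.ReachesSlice η u C) (hC : C ≤ C') :
    D.ReachesSlice η u C' := fun y hy z => by
  obtain ⟨y', z', hy', hr⟩ := h y hy z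
  exact ⟨y', z', hy', hr.mono (mul_le_mul_of_nonneg_right hC (norm_nonneg _))⟩

theorem Transport.reachesSlice {u : ℂ} {e : Fin (m + 1) → ℂ} {C : ℝ}
    {b : (Fin (m + 1) → ℂ) → (Fin N → ℂ)} (h : D.Transport η u 0 e C b) : D.ReachesSlice η u C :=
  fun y hy z => ⟨_, _, fun i => mul_ne_zero (h.ne_zero i) (hy i), (h.reach y hy z).mono
    (mul_le_mul_of_nonneg_left (norm_le_norm_pt u y) (zero_le_one.trans h.one_le))⟩

/-- The second excursion starts in the region of the first, at a point of size below C ‖pt u y‖. -/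
theorem ReachesSlice.of_reach {u : ℂ} {C C' : ℝ} (hC' : 0 ≤ C')
    (h : ∀ y : Fin (m + 1) → ℂ, (∀ i, y i ≠ 0) → ∀ z, ∃ u' y' z', D.ReachesSlice η u' C' ∧
      (∀ i, y' i ≠ 0) ∧ D.Reach η (C * ‖pt u y‖) (pt u y, z) (pt u' y', z')) :
    D.ReachesSlice η u (C + C' * C) := fun y hy z => by
  obtain ⟨u', y', z', hs, hy', hr⟩ := h y hy z
  obtain ⟨y'', z'', hy'', hr'⟩ := hs y' hy' z'
  refine ⟨y'', z'', hy'', (hr.trans hr').mono ?_⟩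
  have h1 : ‖pt u' y'‖ < C * ‖pt u y‖ := (leaf_subset hr).2.1
  have := mul_le_mul_of_nonneg_left h1.le hC'
  linarith

/-- Near u₀ a local transport to u₀ followed by one fixed transport to 0 has a uniform constant;
compactness does the rest. -/
theorem exists_reachesSlice_of_isCompact (hη : Continuous η) (hK : ∀ x, ‖η x‖ ≤ K)
    (h0 : ∀ j, (0 : ℂ) ≠ D.c j) {s : Set ℂ} (hs : IsCompact s) (hsc : ∀ u ∈ s, ∀ j, u ≠ D.c j) :
    ∃ C, ∀ u ∈ s, D.ReachesSlice η u C := by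
  refine hs.induction_on (p := fun s => ∃ C, ∀ u ∈ s, D.ReachesSlice η u C) ⟨0, by simp⟩
    (fun s t hst ⟨C, h⟩ => ⟨C, fun u hu => h u (hst hu)⟩) ?_ fun u₀ hu₀ => ?_
  · rintro s t ⟨C, h⟩ ⟨C', h'⟩
    refine ⟨max C C', fun u hu => hu.elim (fun hu => (h u hu).mono (le_max_left _ _))
      fun hu => (h' u hu).mono (le_max_right _ _)⟩
  · obtain ⟨δ, hδ, C, hl⟩ := exists_local_transport hη hK (hsc u₀ hu₀)
    obtain ⟨e₀, C₀, b₀, T₀⟩ := exists_transport_of_ne hη hK (hsc u₀ hu₀) h0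
    refine ⟨Metric.ball u₀ δ, mem_nhdsWithin_of_mem_nhds (Metric.ball_mem_nhds u₀ hδ),
      C + C₀ * C, fun v hv => ?_⟩
    obtain ⟨e, b, T⟩ := (hl v hv u₀ (Metric.mem_ball_self hδ)).2
    refine (T.trans T₀).reachesSlice.mono ?_
    have := mul_le_mul_of_nonneg_left T.norm_le (zero_le_one.trans T₀.one_le)
    linarith

/-- In the plane all points off the invariant lines are connected with the slice `u = 0` within a
region of their size. -/
theorem exists_reachesSlice {D : Arrangement 0 ι}
    {η : (Fin (0 + 2) → ℂ) → (Fin (0 + 2) → ℂ) →L[ℂ] (Fin N → ℂ)} (hη : Continuous η)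
    (hK : ∀ x, ‖η x‖ ≤ K) (hc : ∀ j, ‖D.c j‖ = 1) (hinj : Function.Injective D.c)
    (hre : ∀ j, (D.lam j).re < 0) (hsum : ∑ j, ‖D.lam j‖ < 1) :
    ∃ C, ∀ u, (∀ j, u ≠ D.c j) → D.ReachesSlice η u C := by
  obtain ⟨r, hr, C₁, hgap, h₁⟩ := exists_reach_of_near hη hK (fun j => (hc j).le) hinj hre hsum
  obtain ⟨R, hR, C₂, h₂⟩ := exists_reach_of_far hη hK (fun j => (hc j).le) hsum
  -- Discs about the c_j are left by radial paths ending in the compact set s, and a neighbourhood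
  -- of infinity by radial paths ending on |u| = R, where the points lie in s or in a disc.
  set s : Set ℂ := Metric.closedBall 0 (R + 1 + r) ∩ ⋂ j, {u | r ≤ ‖u - D.c j‖} with hs
  have hsc : IsCompact s := by
    refine (isCompact_closedBall _ _).inter_right (isClosed_iInter fun j => ?_)
    exact isClosed_le continuous_const (by fun_prop)
  have hsc' : ∀ u ∈ s, ∀ j, u ≠ D.c j := by
    rintro u hu j rfl
    have := mem_iInter.mp hu.2 j
    simp only [mem_ofPred_eq, sub_self, norm_zero] at this
    linarith
  have h0 : ∀ j, (0 : ℂ) ≠ D.c j := fun j hj => by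
    have := hc j
    rw [← hj, norm_zero] at this
    norm_num at this
  obtain ⟨C₀, hC₀⟩ := exists_reachesSlice_of_isCompact hη hK h0 hsc hsc'
  have hnear : ∀ u j, u ≠ D.c j → ‖u - D.c j‖ < r →
      D.ReachesSlice η u (|C₁| + |C₀| * |C₁|) := by
    intro u j hu hur
    refine ReachesSlice.of_reach (abs_nonneg _) fun y hy z => ?_
    obtain ⟨u', y', z', hu', hy', hr'⟩ := h₁ u j hu hur y hy z
    refine ⟨u', y', z', (hC₀ u' ⟨?_, mem_iInter.mpr fun k => ?_⟩).mono (le_abs_self _), hy',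
      hr'.mono (mul_le_mul (le_abs_self _) (norm_le_norm_pt u y) (norm_nonneg _) (abs_nonneg _))⟩
    · rw [mem_closedBall_zero_iff]
      have := norm_le_norm_add_norm_sub (D.c j) u'
      rw [norm_sub_rev, hc, hu'] at this
      linarith
    · rw [mem_ofPred_eq]
      by_cases hk : k = j
      · rw [hk, hu']
      · have h3 := norm_sub_le_norm_sub_add_norm_sub (D.c j) u' (D.c k)
        rw [norm_sub_rev (D.c j) u', hu'] at h3
        linarith [hgap j k hk]
  have hmid : ∀ u, (∀ j, u ≠ D.c j) → ‖u‖ ≤ R →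
      D.ReachesSlice η u (|C₀| + (|C₁| + |C₀| * |C₁|)) := by
    intro u hu huR
    by_cases h : ∃ j, ‖u - D.c j‖ < r
    · obtain ⟨j, hj⟩ := h
      exact (hnear u j (hu j) hj).mono (by linarith [abs_nonneg C₀])
    · push Not at h
      refine (hC₀ u ⟨?_, mem_iInter.mpr h⟩).mono ?_
      · rw [mem_closedBall_zero_iff]; linarith
      · have : 0 ≤ |C₁| + |C₀| * |C₁| := by positivity
        linarith [le_abs_self C₀]
  obtain ⟨C₃, hC₃⟩ : ∃ C₃, C₃ = |C₀| + (|C₁| + |C₀| * |C₁|) := ⟨_, rfl⟩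
  have hC₃0 : 0 ≤ C₃ := hC₃ ▸ by positivity
  refine ⟨C₃ + (|C₂| + C₃ * |C₂|), fun u hu => ?_⟩
  rcases le_or_gt ‖u‖ R with h | h
  · refine (hmid u hu h).mono ?_
    rw [← hC₃]
    have : 0 ≤ |C₂| + C₃ * |C₂| := by positivity
    linarith
  · refine ReachesSlice.mono (C := |C₂| + C₃ * |C₂|) (ReachesSlice.of_reach hC₃0 fun y hy z => ?_)
      (by linarith)
    obtain ⟨u', y', z', hu', hy', hr'⟩ := h₂ u h y hy z
    refine ⟨u', y', z', hC₃ ▸ hmid u' (fun j hj => ?_) hu'.le, hy',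
      hr'.mono (mul_le_mul_of_nonneg_right (le_abs_self _) (norm_nonneg _))⟩
    rw [hj, hc] at hu'
    linarith

end Arrangement
end SepVar

end

/-! ### The polynomial field: invariant hyperplanes and dense orbits -/

section

namespace SepVar
namespace Arrangement

variable {m N : ℕ} {ι : Type} [Fintype ι] [DecidableEq ι] (D : Arrangement m ι)

/-- The polynomial components of the vector field. -/
def poly : Fin (m + 2) → MvPolynomial (Fin (m + 2)) ℂ :=
  let l : ι → MvPolynomial (Fin (m + 2)) ℂ := fun j =>
    MvPolynomial.X (Fin.last (m + 1)) - MvPolynomial.C (D.c j) * MvPolynomial.X 0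
  let k : Fin (m + 1) → MvPolynomial (Fin (m + 2)) ℂ := fun i =>
    ∑ j ∈ Finset.univ.filter (fun j => D.blk j = i),
      MvPolynomial.C (D.lam j) * ∏ k ∈ Finset.univ.erase j, l k
  Fin.snoc (α := fun _ => MvPolynomial (Fin (m + 2)) ℂ)
    (fun i : Fin (m + 1) => MvPolynomial.X i.castSucc * k i)
    (∏ j, l j + MvPolynomial.X (Fin.last (m + 1)) * k 0)

theorem polyField_poly : polyField D.poly = D.field := by
  funext x l
  refine Fin.lastCases ?_ (fun i => ?_) l
  · simp [polyField, poly, cofactor, L, map_sum, map_prod]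
  · simp [polyField, poly, cofactor, L, map_sum, map_prod]

theorem differentiable_L (j : ι) : Differentiable ℂ (D.L j) := by
  unfold L; fun_prop

theorem differentiable_cofactor (i : Fin (m + 1)) : Differentiable ℂ (D.cofactor i) := by
  unfold cofactor
  refine Differentiable.fun_sum fun j _ => Differentiable.const_mul ?_ _
  exact fun x =>
    (HasFDerivAt.finsetProd fun k _ => (D.differentiable_L k x).hasFDerivAt).differentiableAt

theorem differentiable_field : Differentiable ℂ D.field := by
  rw [differentiable_pi]
  intro l
  have h := D.differentiable_cofactor
  have h' := D.differentiable_L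
  refine Fin.lastCases ?_ (fun i => ?_) l
  · simp only [field_last]
    have : Differentiable ℂ fun x => ∏ j, D.L j x :=
      fun x =>
      (HasFDerivAt.finsetProd fun k _ => (h' k x).hasFDerivAt).differentiableAt
    fun_prop
  · simp only [field_castSucc]
    fun_prop

/-- The linear form of the `j`-th hyperplane. -/
def dualL (j : ι) : Module.Dual ℂ (Fin (m + 2) → ℂ) :=
  LinearMap.proj (Fin.last (m + 1)) - D.c j • LinearMap.proj 0

theorem dualL_apply (j : ι) (x : Fin (m + 2) → ℂ) : D.dualL j x = D.L j x := by
  simp [dualL, L]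

theorem isHyperplaneUnion_S : IsHyperplaneUnion D.S := by
  classical
  refine ⟨Finset.univ.image (fun i : Fin (m + 1) => LinearMap.proj (R := ℂ) (φ := fun _ => ℂ)
    i.castSucc) ∪ Finset.univ.image D.dualL, ?_, ?_, ?_⟩
  · exact ((Finset.univ_nonempty).image _).mono Finset.subset_union_left
  · intro l hl
    rcases Finset.mem_union.mp hl with hl | hl
    · obtain ⟨i, -, rfl⟩ := Finset.mem_image.mp hl
      intro h
      simpa using LinearMap.congr_fun h (Pi.single i.castSucc 1)
    · obtain ⟨j, -, rfl⟩ := Finset.mem_image.mp hl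
      intro h
      have := LinearMap.congr_fun h (Pi.single (Fin.last (m + 1)) 1)
      rw [dualL_apply, L] at this
      simp at this
  · ext x
    simp only [S, mem_ofPred_eq, Finset.mem_union, Finset.mem_image, Finset.mem_univ, true_and]
    constructor
    · rintro (⟨i, hi⟩ | ⟨j, hj⟩)
      · exact ⟨_, Or.inl ⟨i, rfl⟩, hi⟩
      · exact ⟨_, Or.inr ⟨j, rfl⟩, (D.dualL_apply j x).trans hj⟩
    · rintro ⟨l, ⟨i, rfl⟩ | ⟨j, rfl⟩, h⟩
      · exact Or.inl ⟨i, h⟩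
      · exact Or.inr ⟨j, (D.dualL_apply j x).symm.trans h⟩

theorem dense_compl_S : Dense D.Sᶜ := by
  obtain ⟨s, -, hs, hS⟩ := D.isHyperplaneUnion_S
  have : D.Sᶜ = ⋂ l ∈ s, {x | l x ≠ 0} := by
    ext x
    simp [hS]
  rw [this]
  refine dense_biInter_of_isOpen (fun l _ => ?_) s.countable_toSet fun l hl => ?_
  · exact isOpen_compl_singleton.preimage (LinearMap.toContinuousLinearMap l).continuous
  · have ho : IsOpenMap (LinearMap.toContinuousLinearMap l) :=
      ContinuousLinearMap.isOpenMap _ (LinearMap.surjective (hs l hl))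
    exact (dense_compl_singleton (0 : ℂ)).preimage ho

/-- The linear form divides its derivative along the field, which makes the hyperplane L_j = 0
invariant. -/
theorem L_field (j : ι) (x : Fin (m + 2) → ℂ) :
    D.L j (D.field x) = (∏ k ∈ Finset.univ.erase j, D.L k x + D.cofactor 0 x) * D.L j x := by
  rw [L, field_last, field_zero, ← Finset.mul_prod_erase _ _ (Finset.mem_univ j), L]
  ring

theorem isInvariant_S : IsInvariant D.field univ D.S := by
  rintro p ⟨-, hp⟩ q hq
  rcases hp with ⟨i, hi⟩ | ⟨j, hj⟩
  · refine Or.inl ⟨i, eq_zero_of_mem_leaf (ContinuousLinearMap.proj (R := ℂ) (φ := fun _ => ℂ)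
      i.castSucc) (D.cofactor i) (D.differentiable_cofactor i).continuous.continuousOn
      (fun x _ => ?_) hi hq⟩
    simp [mul_comm]
  · refine Or.inr ⟨j, ?_⟩
    rw [← dualL_apply]
    have hc : Continuous fun x => ∏ k ∈ Finset.univ.erase j, D.L k x + D.cofactor 0 x :=
      (continuous_finsetProd _ fun k _ => D.continuous_L k).add
        (D.differentiable_cofactor 0).continuous
    refine eq_zero_of_mem_leaf (LinearMap.toContinuousLinearMap (D.dualL j)) _ hc.continuousOn
      (fun x _ => ?_) ((D.dualL_apply j p).trans hj) hq
    simp only [LinearMap.coe_toContinuousLinearMap', dualL_apply, L_field]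

variable {D} {n : ℕ} {ℓ : ι → UPath D.c}

theorem IsGood.zero_ne_c (h : D.IsGood ℓ n) (j : ι) : (0 : ℂ) ≠ D.c j := fun hj => by
  have := h.norm_c j
  rw [← hj, norm_zero] at this
  exact zero_ne_one this

theorem fst_mem_leaf {η : (Fin (m + 2) → ℂ) → (Fin (m + 2) → ℂ) →L[ℂ] (Fin N → ℂ)}
    {Ω : Set ((Fin (m + 2) → ℂ) × (Fin N → ℂ))} {p q : (Fin (m + 2) → ℂ) × (Fin N → ℂ)}
    (h : q ∈ leaf (D.lift η) Ω p) : q.1 ∈ leaf D.field univ p.1 :=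
  map_mem_leaf (Z := D.lift η) (X := D.field)
    (ContinuousLinearMap.fst ℂ (Fin (m + 2) → ℂ) (Fin N → ℂ)) (fun _ _ => rfl)
    (fun _ _ => mem_univ _) h

/-- The orbits off the invariant hyperplanes are dense. -/
theorem IsGood.dense_leaf (h : D.IsGood ℓ n) {p : Fin (m + 2) → ℂ} (hp : p ∉ D.S) :
    Dense (leaf D.field univ p) := by
  suffices hsub : D.Sᶜ ⊆ closure (leaf D.field univ p) by
    have := D.dense_compl_S.mono hsub
    rwa [dense_closure] at this
  intro q hq
  obtain ⟨u, y, hy, hu, rfl⟩ := D.exists_eq_pt hp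
  obtain ⟨u', y', hy', hu', rfl⟩ := D.exists_eq_pt hq
  -- Without z-coordinates, with target ℂ^0 and η = 0, the transports are those of the field itself.
  obtain ⟨η, hη, hK⟩ : ∃ η : (Fin (m + 2) → ℂ) → (Fin (m + 2) → ℂ) →L[ℂ] (Fin 0 → ℂ),
      Continuous η ∧ ∀ x, ‖η x‖ ≤ 0 := ⟨fun _ => 0, continuous_const, fun x => by simp⟩
  obtain ⟨e₁, C₁, b₁, T₁⟩ := exists_transport_of_ne hη hK hu h.zero_ne_c
  obtain ⟨e₂, C₂, b₂, T₂⟩ := exists_transport_of_ne hη hK h.zero_ne_c hu'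
  have hmem : ∀ e ∈ D.Holonomy η, pt u' (e₂ * (e * (e₁ * y))) ∈ leaf D.field univ (pt u y) := by
    rintro e ⟨C, b, T⟩
    have hT := (T₁.trans T).trans T₂
    have := fst_mem_leaf (hT.reach y hy 0)
    rwa [mul_assoc, mul_assoc] at this
  have hy₁ : ∀ i, (e₁ * y) i ≠ 0 := fun i => mul_ne_zero (T₁.ne_zero i) (hy i)
  have hcont : Continuous fun w => pt (m := m) u' (e₂ * w) :=
    continuous_pt.comp (continuous_const.prodMk (continuous_const.mul continuous_id))
  have hw : y' = e₂ * (e₂⁻¹ * y') := (inv_mul_cancel_of_ne_zero T₂.ne_zero y').symm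
  rw [hw]
  have hcl : e₂⁻¹ * y' ∈ closure ((fun e => e * (e₁ * y)) '' D.Holonomy η) := by
    refine Metric.mem_closure_iff.mpr fun ε hε => ?_
    obtain ⟨e, he, hd⟩ := exists_mul_close (fun v hv ε hε => h.exists_mem_holonomy hη hK v hv hε)
      hy₁ (y' := e₂⁻¹ * y') (fun i => mul_ne_zero (inv_ne_zero (T₂.ne_zero i)) (hy' i)) hε
    exact ⟨_, ⟨e, he, rfl⟩, by rwa [dist_comm, dist_eq_norm]⟩
  have := mem_closure_image hcont.continuousAt hcl
  refine closure_mono ?_ this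
  rintro _ ⟨_, ⟨e, he, rfl⟩, rfl⟩
  exact hmem e he

end Arrangement
end SepVar

end

/-! ### Density in the levels near the origin -/

section

namespace SepVar

/-- A continuous map on a closed ball extends to a bounded continuous map. -/
theorem exists_bounded_extension {E F : Type*} [NormedAddCommGroup E] [NormedSpace ℝ E]
    [ProperSpace E] [NormedAddCommGroup F] {R : ℝ} (hR : 0 < R) {f : E → F}
    (hf : ContinuousOn f (Metric.closedBall 0 R)) :
    ∃ (f' : E → F) (K : ℝ), Continuous f' ∧ (∀ x, ‖f' x‖ ≤ K) ∧ ∀ x, ‖x‖ ≤ R → f' x = f x := by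
  obtain ⟨K, hK⟩ := (isCompact_closedBall (0 : E) R).exists_bound_of_continuousOn hf
  have hpos : ∀ x : E, 0 < max R ‖x‖ := fun x => hR.trans_le (le_max_left _ _)
  have hmem : ∀ x : E, (R / max R ‖x‖) • x ∈ Metric.closedBall (0 : E) R := fun x => by
    rw [mem_closedBall_zero_iff, norm_smul, Real.norm_of_nonneg (div_pos hR (hpos x)).le,
      div_mul_eq_mul_div, div_le_iff₀ (hpos x)]
    exact mul_le_mul_of_nonneg_left (le_max_right _ _) hR.le
  have hcont : Continuous fun x : E => (R / max R ‖x‖) • x :=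
    (continuous_const.div (continuous_const.max continuous_norm) fun x => (hpos x).ne').smul
      continuous_id
  refine ⟨fun x => f ((R / max R ‖x‖) • x), K, hf.comp_continuous hcont hmem,
    fun x => hK _ (hmem x), fun x hx => ?_⟩
  simp only
  rw [max_eq_left hx, div_self hR.ne', one_smul]

theorem leavesDenseInLevels_congr {E F : Type*} [NormedAddCommGroup E] [NormedSpace ℂ E]
    {Z Z' : E → E} {H : E → F} {Ω : Set E} (hZ : ∀ x ∈ Ω, Z x = Z' x)
    (h : LeavesDenseInLevels Z H Ω) : LeavesDenseInLevels Z' H Ω := fun p hp => by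
  rw [← leaf_congr hZ]
  exact h p hp

namespace Arrangement

variable {m N : ℕ} {ι : Type} [Fintype ι] [DecidableEq ι] {D : Arrangement m ι} {ℓ : ι → UPath D.c}
  {n : ℕ} {η : (Fin (m + 2) → ℂ) → (Fin (m + 2) → ℂ) →L[ℂ] (Fin N → ℂ)}

/-- The derivative of the first integral along the lift is T(ω · X) - dg(X) = 0. -/
theorem firstIntegral_eq_of_mem_leaf {κ : ℕ} {U V : Set (Fin (m + 2) → ℂ)} {ω : FormTuple (m + 2) N}
    {T : (Fin N → ℂ) →ₗ[ℂ] (Fin κ → ℂ)} {g : (Fin (m + 2) → ℂ) → (Fin κ → ℂ)}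
    (hI : IsFirstIntegralData U ω V T g) {Ω : Set ((Fin (m + 2) → ℂ) × (Fin N → ℂ))}
    (hΩ : ∀ p ∈ Ω, p.1 ∈ V ∧ η p.1 = formCLM ω p.1) {p q : (Fin (m + 2) → ℂ) × (Fin N → ℂ)}
    (hq : q ∈ leaf (D.lift η) Ω p) : firstIntegral T g q = firstIntegral T g p := by
  refine eq_of_mem_leaf (fun p => (LinearMap.toContinuousLinearMap T).comp
    (ContinuousLinearMap.snd ℂ (Fin (m + 2) → ℂ) (Fin N → ℂ)) -
    (fderiv ℂ g p.1).comp (ContinuousLinearMap.fst ℂ (Fin (m + 2) → ℂ) (Fin N → ℂ)))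
    (fun p hp => ?_) (fun p hp => ?_) hq
  · have hg : HasFDerivAt g (fderiv ℂ g p.1) p.1 :=
      (hI.differentiableOn.differentiableAt (hI.isOpen.mem_nhds (hΩ p hp).1)).hasFDerivAt
    have h1 : HasFDerivAt (fun p : (Fin (m + 2) → ℂ) × (Fin N → ℂ) => T p.2)
        ((LinearMap.toContinuousLinearMap T).comp
          (ContinuousLinearMap.snd ℂ (Fin (m + 2) → ℂ) (Fin N → ℂ))) p :=
      (LinearMap.toContinuousLinearMap T).hasFDerivAt.comp p hasFDerivAt_snd
    exact h1.sub (HasFDerivAt.comp p hg hasFDerivAt_fst)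
  · simp only [sub_apply, ContinuousLinearMap.comp_apply, lift,
      ContinuousLinearMap.coe_snd', ContinuousLinearMap.coe_fst',
      LinearMap.coe_toContinuousLinearMap']
    rw [(hΩ p hp).2, formCLM_apply, hI.fderiv_eq _ (hΩ p hp).1, sub_self]

/-- A bounded continuous form η that agrees with ω on a ball replaces it globally, which gives
uniform constants for all lifts. In the region of size R the two lifted fields coincide. -/
theorem IsGood.exists_leavesDenseInLevels {d : ℕ} (h : D.IsGood ℓ n) (hn : d + 3 < n) {κ : ℕ}
    {U V : Set (Fin (m + 2) → ℂ)} {ω : FormTuple (m + 2) N} (hω : DifferentiableOn ℂ ω U)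
    (hd : jetSpan (jet d ω) = W ω) {T : (Fin N → ℂ) →ₗ[ℂ] (Fin κ → ℂ)}
    {g : (Fin (m + 2) → ℂ) → (Fin κ → ℂ)} (hI : IsFirstIntegralData U ω V T g)
    {Δ : Set ((Fin (m + 2) → ℂ) × (Fin N → ℂ))} (hΔ : Δ ∈ 𝓝 0) :
    ∃ R > 0, ∃ ε > 0, ∃ (η : (Fin (m + 2) → ℂ) → (Fin (m + 2) → ℂ) →L[ℂ] (Fin N → ℂ)) (K : ℝ),
      Continuous η ∧ (∀ x, ‖η x‖ ≤ K) ∧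
      (∀ p : (Fin (m + 2) → ℂ) × (Fin N → ℂ), ‖p.1‖ < R → ‖p.2‖ < R → p ∈ Δ) ∧
      LeavesDenseInLevels (D.lift (formCLM ω)) (firstIntegral T g) (D.saturation η R ε) := by
  obtain ⟨R, hR, hRV, hRΔ⟩ : ∃ R > 0, Metric.closedBall (0 : Fin (m + 2) → ℂ) R ⊆ V ∧
      Metric.closedBall (0 : (Fin (m + 2) → ℂ) × (Fin N → ℂ)) R ⊆ Δ := by
    obtain ⟨R₁, h₁, hb₁⟩ := Metric.nhds_basis_closedBall.mem_iff.mp (hI.isOpen.mem_nhds hI.zero_mem)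
    obtain ⟨R₂, h₂, hb₂⟩ := Metric.nhds_basis_closedBall.mem_iff.mp hΔ
    exact ⟨min R₁ R₂, lt_min h₁ h₂, (Metric.closedBall_subset_closedBall (min_le_left _ _)).trans hb₁,
      (Metric.closedBall_subset_closedBall (min_le_right _ _)).trans hb₂⟩
  have hdiff : ∀ x ∈ V, DifferentiableAt ℂ ω x := fun x hx =>
    (hω.mono hI.subset).differentiableAt (hI.isOpen.mem_nhds hx)
  obtain ⟨η, K, hη, hK, hηω⟩ := exists_bounded_extension hR (f := formCLM ω) fun x hx =>
    (differentiableAt_formCLM (hdiff x (hRV hx))).continuousAt.continuousWithinAt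
  have hev : ∀ᶠ x in 𝓝 0, η x = formCLM ω x := by
    filter_upwards [Metric.closedBall_mem_nhds (0 : Fin (m + 2) → ℂ) hR] with x hx
    exact hηω x (mem_closedBall_zero_iff.mp hx)
  have hreg : ∀ p ∈ D.region R (0 : Fin N → ℂ), p.1 ∈ V ∧ η p.1 = formCLM ω p.1 := fun p hp =>
    ⟨hRV (mem_closedBall_zero_iff.mpr hp.2.1.le), hηω _ hp.2.1.le⟩
  have hH : ∀ p q, q ∈ leaf (D.lift η) (D.region R 0) p →
      firstIntegral T g q = firstIntegral T g p := fun p q => firstIntegral_eq_of_mem_leaf hI hreg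
  have hF : FormHolNearZero ω := by
    filter_upwards [hI.isOpen.mem_nhds hI.zero_mem] with x hx using hdiff x hx
  have hG := fun v hv ε hε => h.exists_mem_holonomy hη hK v hv (ε := ε) hε
  -- A contraction in the holonomy: at distance below 1/4 from a vector of norm 1/4, it has norm at
  -- most 1/2.
  obtain ⟨a, ⟨C, b, Ta⟩, ha⟩ := hG (fun _ => 1 / 4) (fun _ => by norm_num) (1 / 4) (by norm_num)
  have ha' : ‖a‖ ≤ 1 / 2 := by
    have h1 := norm_le_norm_sub_add a (fun _ : Fin (m + 1) => (1 / 4 : ℂ))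
    have h2 : ‖(fun _ : Fin (m + 1) => (1 / 4 : ℂ))‖ ≤ 1 / 4 :=
      (pi_norm_le_iff_of_nonneg (by norm_num)).mpr fun _ => by norm_num
    linarith
  have hcomm := fun σ : ι × ι => exists_transport_commShift D (h.loop_zero σ.1) (h.loop_one σ.1)
    (h.loop_zero σ.2) (h.loop_one σ.2) hη hK
  choose Cσ hCσ using hcomm
  have hCσ0 : ∀ σ, 0 ≤ Cσ σ := fun σ => zero_le_one.trans (hCσ σ).one_le
  obtain ⟨ε, hε, hdense⟩ := exists_slice_subset_closure ha'
    (exists_transport_pow h.zero_ne_c Ta ha') hG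
    (c := fun σ : ι × ι => D.commShift (ℓ σ.1) (ℓ σ.2) η)
    (fun σ => (hCσ σ).mono (Finset.single_le_sum (fun σ _ => hCσ0 σ) (Finset.mem_univ σ)))
    (Finset.sum_nonneg fun σ _ => hCσ0 σ)
    ⟨1, one_pos, fun y hy _ => h.subset_span_commShift hn hη hK hF hev hd hy⟩
    hI.surjective hI.ker_eq
    (hI.differentiableOn.continuousOn.continuousAt (hI.isOpen.mem_nhds hI.zero_mem)) hR hH
  refine ⟨R, hR, ε, hε, η, K, hη, hK, fun p h1 h2 => hRΔ ?_, ?_⟩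
  · rw [mem_closedBall_zero_iff, Prod.norm_def]
    exact max_le h1.le h2.le
  · refine leavesDenseInLevels_congr (fun p hp => ?_)
      (leavesDenseInLevels_saturation hη hH hdense)
    rw [lift, lift, (hreg p (saturation_subset hp)).2]

theorem saturation_nonempty (h0 : ∀ j, (0 : ℂ) ≠ D.c j) {R ε : ℝ} (hR : 0 < R) (hε : 0 < ε) :
    (D.saturation η R ε).Nonempty := by
  obtain ⟨δ, hδ, hδ'⟩ := exists_between (lt_min hR hε)
  have hn : ‖(fun _ : Fin (m + 1) => (δ : ℂ))‖ ≤ δ := (pi_norm_le_iff_of_nonneg hδ.le).mpr fun _ => by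
    rw [Complex.norm_real, Real.norm_of_nonneg hδ.le]
  have hy : ∀ i : Fin (m + 1), (fun _ : Fin (m + 1) => (δ : ℂ)) i ≠ 0 := fun i => by
    exact Complex.ofReal_ne_zero.mpr hδ.ne'
  refine ⟨(pt 0 fun _ => (δ : ℂ), 0), _, 0, hy, hn.trans_lt (hδ'.trans_le (min_le_right _ _)),
    by simpa using hε, mem_leaf_self ⟨D.pt_notMem_S hy h0, ?_, by simpa using hR⟩⟩
  exact ((norm_pt_zero_le _).trans hn).trans_lt (hδ'.trans_le (min_le_left _ _))

/-- In the plane the saturation of the slice contains all points near the origin off the invariant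
lines. -/
theorem IsGood.exists_region_subset_saturation {D : Arrangement 0 ι} {ℓ : ι → UPath D.c}
    {η : (Fin (0 + 2) → ℂ) → (Fin (0 + 2) → ℂ) →L[ℂ] (Fin N → ℂ)} {K : ℝ} (h : D.IsGood ℓ n)
    (hη : Continuous η) (hK : ∀ x, ‖η x‖ ≤ K) {R ε : ℝ} (hR : 0 < R) (hε : 0 < ε) :
    ∃ δ > 0, δ ≤ R ∧ D.region δ 0 ⊆ D.saturation η R ε := by
  obtain ⟨C₀, hC₀⟩ := exists_reachesSlice hη hK h.norm_c h.injective_c h.re_lam_neg h.sum_lam_lt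
  obtain ⟨C, hC⟩ : ∃ C, C = |C₀| := ⟨_, rfl⟩
  have hC0 : 0 ≤ C := hC ▸ abs_nonneg C₀
  have hpos : 0 < min R ε := lt_min hR hε
  -- With δ + C δ = min R ε the excursion to the slice stays within R and ends within ε.
  obtain ⟨δ, hδ⟩ : ∃ δ, δ = min R ε / (C + 1) := ⟨_, rfl⟩
  have hδ0 : 0 < δ := hδ ▸ by positivity
  have hδC : δ + C * δ = min R ε := by
    rw [hδ]; field_simp; ring
  have hδR : δ + C * δ ≤ R := hδC ▸ min_le_left _ _
  have hδε : δ + C * δ ≤ ε := hδC ▸ min_le_right _ _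
  have hCδ : 0 ≤ C * δ := mul_nonneg hC0 hδ0.le
  refine ⟨δ, hδ0, by linarith, ?_⟩
  rintro ⟨x, z⟩ ⟨hxS, hx, hz⟩
  obtain ⟨u, y, hy, hu, rfl⟩ := D.exists_eq_pt hxS
  simp only [sub_zero] at hx hz
  obtain ⟨y', z', hy', hr⟩ := (hC₀ u hu).mono (hC ▸ le_abs_self C₀) y hy z
  have h1 : ‖pt 0 y'‖ < C * ‖pt u y‖ := (leaf_subset hr).2.1
  have h2 := hr.norm_lt
  have h3 := norm_le_norm_pt 0 y'
  have h4 := norm_le_norm_sub_add z' z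
  have h5 := mul_le_mul_of_nonneg_left hx.le hC0
  simp only at h2
  refine ⟨y', z', hy', by linarith, by linarith, hr.mem_leaf ?_⟩
  simp only [sub_zero]
  linarith

end Arrangement
end SepVar

end

/-! ### The lifted field and the main theorem -/

section

namespace SepVar
namespace Arrangement

variable {m N : ℕ} {ι : Type} [Fintype ι] [DecidableEq ι] (D : Arrangement m ι)

theorem isLegendrian_lift {U : Set (Fin (m + 2) → ℂ)} (hU : IsOpen U) {ω : FormTuple (m + 2) N}
    (hω : DifferentiableOn ℂ ω U) : IsLegendrian ω (D.lift (formCLM ω)) (U ×ˢ univ) := by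
  refine ⟨fun p hp => ?_, fun p _ => formCLM_apply ω p.1 _⟩
  have h1 : DifferentiableAt ℂ (fun p : (Fin (m + 2) → ℂ) × (Fin N → ℂ) => formCLM ω p.1) p :=
    (differentiableAt_formCLM (hω.differentiableAt (hU.mem_nhds hp.1))).comp p differentiableAt_fst
  have h2 : DifferentiableAt ℂ (fun p : (Fin (m + 2) → ℂ) × (Fin N → ℂ) => D.field p.1) p :=
    (D.differentiable_field p.1).comp p differentiableAt_fst
  exact (h2.prodMk (h1.clm_apply h2)).differentiableWithinAt

theorem isInvariant_lift {η : (Fin (m + 2) → ℂ) → (Fin (m + 2) → ℂ) →L[ℂ] (Fin N → ℂ)}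
    {Ω : Set ((Fin (m + 2) → ℂ) × (Fin N → ℂ))} : IsInvariant (D.lift η) Ω (D.S ×ˢ univ) := by
  rintro p ⟨-, hp, -⟩ q hq
  exact ⟨D.isInvariant_S p.1 ⟨mem_univ _, hp⟩ (fst_mem_leaf hq), mem_univ _⟩

end Arrangement
end SepVar

end

end

theorem mainTheorem7 (M N : ℕ) (hM : 2 ≤ M) (hN : 1 ≤ N) :
    -- one choice of a polynomial vector field for each order and each jet of that order
    ∃ A : ℕ → SepVar.Jet M N → Fin M → MvPolynomial (Fin M) ℂ,
    ∀ (U : Set (Fin M → ℂ)) (ω : SepVar.FormTuple M N),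
      IsOpen U → (0 : Fin M → ℂ) ∈ U → DifferentiableOn ℂ ω U →
    -- jets of large order span `W_𝒟`, and each such jet gives a vector field with the properties
    (∃ d₀ : ℕ, ∀ d ≥ d₀, SepVar.jetSpan (SepVar.jet d ω) = SepVar.W ω) ∧
    -- the first integral `H_𝒟` exists
    (∃ (κ : ℕ) (V : Set (Fin M → ℂ)) (T : (Fin N → ℂ) →ₗ[ℂ] (Fin κ → ℂ))
      (g : (Fin M → ℂ) → (Fin κ → ℂ)), SepVar.IsFirstIntegralData U ω V T g) ∧
    ∀ d : ℕ, SepVar.jetSpan (SepVar.jet d ω) = SepVar.W ω →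
    ∃ (X : (Fin M → ℂ) → (Fin M → ℂ)) (S : Set (Fin M → ℂ))
      (Z : (Fin M → ℂ) × (Fin N → ℂ) → (Fin M → ℂ) × (Fin N → ℂ)),
      X = SepVar.polyField (A d (SepVar.jet d ω)) ∧
      -- `Z` is a Legendrian holomorphic vector field on the domain of `𝒟`, the lift of `X`
      SepVar.IsLegendrian ω Z (U ×ˢ univ) ∧
      (∀ x ∈ U, ∀ z, Z (x, z) = (X x, ω x ![X x])) ∧
      (∀ x ∈ U, ∀ z z', Z (x, z) = Z (x, z')) ∧
      -- the invariant union of hyperplanes, and the density of the orbits outside it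
      SepVar.IsHyperplaneUnion S ∧
      SepVar.IsInvariant X univ S ∧
      (∀ p ∉ S, Dense (SepVar.leaf X univ p)) ∧
      -- somewhere density of the leaves of `Z` in the levels of `H_𝒟`
      (∀ (κ : ℕ) (V : Set (Fin M → ℂ)) (T : (Fin N → ℂ) →ₗ[ℂ] (Fin κ → ℂ))
        (g : (Fin M → ℂ) → (Fin κ → ℂ)), SepVar.IsFirstIntegralData U ω V T g →
        ∀ Δ ∈ 𝓝 (0 : (Fin M → ℂ) × (Fin N → ℂ)), Δ ⊆ V ×ˢ univ →
        ∃ Δ' : Set ((Fin M → ℂ) × (Fin N → ℂ)), Δ' ⊆ Δ ∧ IsOpen Δ' ∧ Δ'.Nonempty ∧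
          SepVar.LeavesDenseInLevels Z (SepVar.firstIntegral T g) Δ') ∧
      -- the case `M = 2`: the hypersurface `S × ℂ^N` in the domain of `𝒟` is invariant by `Z`,
      -- and the open set can be taken to be its complement in a neighbourhood of the origin
      (M = 2 →
        SepVar.IsInvariant Z (U ×ˢ univ) (S ×ˢ univ) ∧
        ∀ (κ : ℕ) (V : Set (Fin M → ℂ)) (T : (Fin N → ℂ) →ₗ[ℂ] (Fin κ → ℂ))
          (g : (Fin M → ℂ) → (Fin κ → ℂ)), SepVar.IsFirstIntegralData U ω V T g →
          ∀ Δ ∈ 𝓝 (0 : (Fin M → ℂ) × (Fin N → ℂ)), Δ ⊆ V ×ˢ univ →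
          ∃ B ∈ 𝓝 (0 : (Fin M → ℂ) × (Fin N → ℂ)), B ⊆ Δ ∧
            IsOpen (B \ (S ×ˢ univ)) ∧ (B \ (S ×ˢ univ)).Nonempty ∧
            SepVar.LeavesDenseInLevels Z (SepVar.firstIntegral T g) (B \ (S ×ˢ univ))) := by
  obtain ⟨m, rfl⟩ : ∃ m, M = m + 2 := ⟨M - 2, by omega⟩
  -- The field depends on d and on the dimension only, not on the jet. The value d + 4 is the least
  -- n with d + 3 < n, as `IsGood.map_dCoeff_eq_zero` requires.
  choose D ℓ hD using fun d : ℕ => SepVar.Arrangement.exists_isGood m (d + 4)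
  refine ⟨fun d _ => (D d).poly, fun U ω hU h0 hω => ⟨SepVar.exists_jetSpan_eq ω,
    SepVar.exists_isFirstIntegralData hU h0 hω, fun d hd => ?_⟩⟩
  have hn : d + 3 < d + 4 := Nat.lt_succ_self _
  have hgood := hD d
  refine ⟨(D d).field, (D d).S, (D d).lift (SepVar.formCLM ω), (D d).polyField_poly.symm,
    (D d).isLegendrian_lift hU hω, fun x _ z => ?_, fun _ _ _ _ => rfl, (D d).isHyperplaneUnion_S,
    (D d).isInvariant_S, fun p hp => hgood.dense_leaf hp, ?_, ?_⟩
  · rw [SepVar.Arrangement.lift, SepVar.formCLM_apply]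
  · intro κ V T g hI Δ hΔ _
    obtain ⟨R, hR, ε, hε, η, K, hη, -, hsub, hdense⟩ :=
      hgood.exists_leavesDenseInLevels hn hω hd hI hΔ
    refine ⟨(D d).saturation η R ε, fun p hp => ?_, SepVar.Arrangement.isOpen_saturation hη R ε,
      SepVar.Arrangement.saturation_nonempty hgood.zero_ne_c hR hε, hdense⟩
    have hp' := SepVar.Arrangement.saturation_subset hp
    exact hsub p hp'.2.1 (by simpa using hp'.2.2)
  · intro hM2
    obtain rfl : m = 0 := by omega
    refine ⟨(D d).isInvariant_lift, fun κ V T g hI Δ hΔ _ => ?_⟩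
    obtain ⟨R, hR, ε, hε, η, K, hη, hK, hsub, hdense⟩ :=
      hgood.exists_leavesDenseInLevels hn hω hd hI hΔ
    obtain ⟨δ, hδ, hδR, hreg⟩ := hgood.exists_region_subset_saturation hη hK hR hε
    -- A ball alone need not be a union of leaves. With the saturation added, the complement of the
    -- hypersurface is exactly the saturation.
    have hB : (Metric.ball 0 δ ∪ (D d).saturation η R ε) \ ((D d).S ×ˢ univ) =
        (D d).saturation η R ε := by
      ext p
      constructor
      · rintro ⟨hp | hp, hpS⟩
        · rw [mem_ball_zero_iff, Prod.norm_def, max_lt_iff] at hp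
          exact hreg ⟨fun h => hpS ⟨h, mem_univ _⟩, hp.1, by simpa using hp.2⟩
        · exact hp
      · exact fun hp => ⟨Or.inr hp, fun h => (SepVar.Arrangement.saturation_subset hp).1 h.1⟩
    refine ⟨Metric.ball 0 δ ∪ (D d).saturation η R ε,
      mem_of_superset (Metric.ball_mem_nhds 0 hδ) subset_union_left, ?_, ?_⟩
    · rintro p (hp | hp)
      · rw [mem_ball_zero_iff, Prod.norm_def, max_lt_iff] at hp
        exact hsub p (hp.1.trans_le hδR) (hp.2.trans_le hδR)
      · have hp' := SepVar.Arrangement.saturation_subset hp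
        exact hsub p hp'.2.1 (by simpa using hp'.2.2)
    · rw [hB]
      exact ⟨SepVar.Arrangement.isOpen_saturation hη R ε,
        SepVar.Arrangement.saturation_nonempty hgood.zero_ne_c hR hε, hdense⟩
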